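/- **Games and sinks.** Consider finite strategic games $\langle N,(\Sigma_i),(u_i)\rangle$. The state graph has the strategy profiles as vertices, and an arc from $S$ to $S'$ whenever $S'$ arises from $S$ by a change of the strategy of a single player $i$ with $u_i(S')>u_i(S)$. A sink equilibrium is a strongly connected component of the state graph without outgoing arcs; it is non-singleton if it contains more than one state (equivalently, it is not a pure Nash equilibrium). HAS A NON-SINGLETON SINK is the problem to decide, given an instance of a game, whether the game has a non-singleton sink equilibrium. **Many-to-one two-sided market games.** There are active agents $x\in\mathcal X$ (the players) and passive agents $y\in\mathcal Y$. The strategy set of $x$ is a non-empty lower-ideal family $\mathcal F_x\subseteq 2^{\mathcal Y}$, and $x$ has a utility function $u_x:2^{\mathcal Y}\to\mathbb Z$. Each $y$ has a strict preference list over the active agents that have a strategy containing $y$. In a profile $S=(s_x)_x$, the passive agent $y$ is won by the agent it likes best among the $x$ with $y\in s_x$. The utility of $x$ in $S$ is $u_x(T_x(S))$, where $T_x(S)$ is the set of passive agents won by $x$. An instance lists, for each $x$, finitely many (at least one) sets generating $\mathcal F_x$ (i.e. $\mathcal F_x$ consists of their subsets), the preference lists, and, for each $x$, a finite list of pairs $(c,A)\in\mathbb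 Z\times 2^{\mathcal Y}$ representing $u_x(T)=\sum_{(c,A):A\subseteq T}c$ (every integer-valued set function has such a representation). **Uniform utility-based two-sided market games.** These are the same games with $u_x(T)=\sum_{y\in T}v_y$ for all $x$, where $v_y\in\mathbb N$ is a value of $y$ that does not depend on $x$. An instance gives the values $v_y$ in place of the functions $u_x$. **Valid-utility games.** There is a finite ground set $V$. Each player $i\in U$ has a family $F_i\subseteq 2^V$ of strategies with $\emptyset\in F_i$ (taking no action), and a utility function $u_i$, and there is a social function $\gamma:\prod_{i\in U}2^V\to\mathbb R_{\ge0}$, such that (1) $\gamma$ is submodular and non-decreasing; (2) $u_i(S)\ge\gamma(S)-\gamma(S_{-i},\emptyset)$ for every strategy profile $S$ and player $i$; (3) $\sum_i u_i(S)\le\gamma(S)$ for every strategy profile $S$. An instance lists the strategies of each player, and gives the (integer-valued) functions $u_i$ and $\gamma$ as finite lists of pairs $(c,A)$ with $c\in\mathbb Z$ and $A\subseteq U\times V$, as above, where the profile $S$ is identified with the set $\{(i,e): e\in s_i\}$. Instances are written as words over a finite alphabet, with utilities and values in binary and names of agents, players and elements in unary. **Theorem.** HAS A NON-SINGLETON SINK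 is PSPACE-hard (under polynomial-time many-one reductions) for (i) uniform utility-based two-sided market games, (ii) many-to-one two-sided market games, and (iii) valid-utility games. -/

import Mathlib

namespace SinkEquilibria

open Computability Turing

/-! ### Complexity: `PSPACE`, polynomial-time reductions, hardness -/

/-- The displacement of the head caused by executing one step of the machine `M` in the
configuration `c`. -/
def headShift {Γ Λ : Type} [Inhabited Γ] [Inhabited Λ] (M : TM0.Machine Γ Λ)
    (c : TM0.Cfg Γ Λ) : ℤ :=
  match M c.q c.Tape.head with
  | some (_, TM0.Stmt.move Dir.left) => -1
  | some (_, TM0.Stmt.move Dir.right) => 1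
  | _ => 0

/-- `Visits M c k c' k'`: if the machine `M` is in configuration `c` with its head on the tape
cell number `k`, then it is after some number of steps in configuration `c'` with its head on
the cell number `k'`. -/
def Visits {Γ Λ : Type} [Inhabited Γ] [Inhabited Λ] (M : TM0.Machine Γ Λ)
    (c : TM0.Cfg Γ Λ) (k : ℤ) (c' : TM0.Cfg Γ Λ) (k' : ℤ) : Prop :=
  Relation.ReflTransGen
    (fun a b : TM0.Cfg Γ Λ × ℤ => b.1 ∈ TM0.step M a.1 ∧ b.2 = a.2 + headShift M a.1)
    (c, k) (c', k')

/-- `L ∈ PSPACE`: some deterministic single-tape Turing machine with a finite alphabet and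
finitely many states, and some polynomial `p`, are such that on every input word `x` the
machine, started on the first symbol of `x` (cell number `0`), only visits the cells from
`-p(|x|)` to `p(|x|)`, and halts, in an accepting state if and only if `x ∈ L`. -/
def InPSPACE (L : Set (List Bool)) : Prop :=
  ∃ (Γ Λ : Type) (_ : Inhabited Γ) (_ : Fintype Γ) (_ : Inhabited Λ) (_ : Fintype Λ)
    (M : TM0.Machine Γ Λ) (symbol : Bool ↪ Γ) (accept : Set Λ) (p : Polynomial ℕ),
    (∀ b, symbol b ≠ default) ∧
    ∀ x : List Bool,
      (∀ c k, Visits M (TM0.init (x.map symbol)) 0 c k → |k| ≤ ((p.eval x.length : ℕ) : ℤ)) ∧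
      ∃ c, TM0.Reaches M (TM0.init (x.map symbol)) c ∧ TM0.step M c = none ∧
        (c.q ∈ accept ↔ x ∈ L)

/-- The decision problem "does the instance `a` satisfy `P`?", with instances written as words
through the encoding `e`, is `PSPACE`-hard: every language in `PSPACE` is many-one reducible
to it in polynomial time. -/
def PSPACEHard {I A : Type} (e : Encoding I A) (P : I → Prop) : Prop :=
  ∀ L : Set (List Bool), InPSPACE L →
    ∃ f : List Bool → I,
      Nonempty (TM2ComputableInPolyTime (encodingList Bool).encode e.encode f) ∧
      ∀ x, x ∈ L ↔ P (f x)

/-! ### Strategic games and sink equilibria -/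

/-- A strategic game with the players `0, …, n - 1`. -/
structure StrategicGame (n : ℕ) where
  /-- the strategies of every player -/
  Strat : Fin n → Type
  /-- the utility of every player in every strategy profile -/
  utility : Fin n → (∀ i, Strat i) → ℝ

namespace StrategicGame

variable {n : ℕ} (G : StrategicGame n)

/-- Strategy profiles, also called states. -/
abbrev State : Type := ∀ i, G.Strat i

/-- The arcs of the state graph: a single player changes his strategy and thereby
improves his utility. -/
def Arc (S S' : G.State) : Prop :=
  ∃ i, (∀ j, j ≠ i → S' j = S j) ∧ G.utility i S < G.utility i S'

/-- A sink equilibrium: a strongly connected component of the state graph without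
outgoing arcs. -/
def IsSinkEquilibrium (T : Set G.State) : Prop :=
  T.Nonempty ∧
  (∀ S ∈ T, ∀ S' ∈ T, Relation.ReflTransGen G.Arc S S') ∧
  (∀ S ∈ T, ∀ S', G.Arc S S' → S' ∈ T)

/-- The game has a sink equilibrium with more than one state. -/
def HasNonSingletonSink : Prop :=
  ∃ T : Set G.State, G.IsSinkEquilibrium T ∧ T.Nontrivial

end StrategicGame

/-! ### Sparse representation of set functions -/

/-- An explicit representation of an integer-valued set function: the list of pairs
`(c, A)` stands for the function that maps `T` to the sum of the `c` for which `A ⊆ T`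
(a multilinear polynomial in the membership indicators). Every integer-valued function on
the subsets of a finite set has such a representation. -/
abbrev SetPoly (α : Type) : Type := List (ℤ × List α)

/-- The value of the represented set function. -/
def SetPoly.eval {α : Type} [DecidableEq α] (p : SetPoly α) (T : Finset α) : ℤ :=
  (p.map fun t => if t.2.toFinset ⊆ T then t.1 else 0).sum

/-! ### Two-sided markets -/

/-- The part of a two-sided market between active agents `x : Fin n` and passive agents
`y : Fin m` that concerns strategies and the preferences of the passive agents. -/
structure MarketFrame where
  /-- number of active agents -/
  n : ℕ
  /-- number of passive agents -/
  m : ℕ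
  /-- for every active agent a list of sets that generates its lower ideal of strategies -/
  gens : Fin n → List (List (Fin m))
  /-- every active agent has a strategy -/
  gens_ne : ∀ x, gens x ≠ []
  /-- the preference list of every passive agent, most preferred active agent first -/
  pref : Fin m → List (Fin n)
  /-- preferences are strict -/
  pref_nodup : ∀ y, (pref y).Nodup
  /-- the preference list of `y` consists of the active agents that can play `y` -/
  mem_pref : ∀ x y, x ∈ pref y ↔ ∃ A ∈ gens x, y ∈ A

namespace MarketFrame

variable (F : MarketFrame)

/-- The lower-ideal family of strategies of the active agent `x`. -/
def feasible (x : Fin F.n) : Set (Finset (Fin F.m)) :=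
  {s | ∃ A ∈ F.gens x, s ⊆ A.toFinset}

theorem feasible_lower (x : Fin F.n) : IsLowerSet (F.feasible x) :=
  fun _ _ hst ⟨A, hA, hs⟩ => ⟨A, hA, hst.trans hs⟩

/-- The winner of the passive agent `y`: the most preferred active agent that plays `y`. -/
def winner (S : Fin F.n → Finset (Fin F.m)) (y : Fin F.m) : Option (Fin F.n) :=
  (F.pref y).find? fun x => decide (y ∈ S x)

/-- The set of passive agents that the active agent `x` wins. -/
def won (S : Fin F.n → Finset (Fin F.m)) (x : Fin F.n) : Finset (Fin F.m) :=
  Finset.univ.filter fun y => F.winner S y = some x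

/-- The game among the active agents, where `u x T` is the utility that `x` has for winning
exactly the set `T`. -/
def game (u : Fin F.n → Finset (Fin F.m) → ℝ) : StrategicGame F.n where
  Strat x := {s : Finset (Fin F.m) // s ∈ F.feasible x}
  utility x S := u x (F.won (fun z => (S z).1) x)

end MarketFrame

/-- An instance of a uniform utility-based two-sided market game: every passive agent has a
value, which is the same for all active agents. -/
structure UniformMarket extends MarketFrame where
  /-- the value of every passive agent -/
  value : Fin m → ℕ

/-- The utility of an active agent is the total value of the passive agents that it wins. -/
noncomputable def UniformMarket.game (I : UniformMarket) : StrategicGame I.n :=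
  I.toMarketFrame.game fun _ T => ∑ y ∈ T, (I.value y : ℝ)

/-- An instance of a many-to-one two-sided market game: every active agent has an arbitrary
(integer-valued) utility function on sets of passive agents. -/
structure ManyToOneMarket extends MarketFrame where
  /-- the utility function of every active agent -/
  util : Fin n → SetPoly (Fin m)

/-- The utility of an active agent is the utility of the set of passive agents that it wins. -/
noncomputable def ManyToOneMarket.game (I : ManyToOneMarket) : StrategicGame I.n :=
  I.toMarketFrame.game fun x T => ((I.util x).eval T : ℝ)

/-! ### Valid-utility games -/

/-- The conditions on a valid-utility game with strategy families `F i`, utility functions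
`u i` and social function `γ`. -/
structure IsValidUtility {n m : ℕ} (F : Fin n → Set (Finset (Fin m)))
    (u : Fin n → (Fin n → Finset (Fin m)) → ℝ) (γ : (Fin n → Finset (Fin m)) → ℝ) : Prop where
  /-- the social function is non-negative -/
  nonneg : ∀ S, 0 ≤ γ S
  /-- the social function is non-decreasing -/
  mono : ∀ S S', S ≤ S' → γ S ≤ γ S'
  /-- the social function is submodular -/
  submodular : ∀ S S', γ (S ⊔ S') + γ (S ⊓ S') ≤ γ S + γ S'
  /-- the utility of a player is at least his contribution to the social function -/
  contribution : ∀ S, (∀ i, S i ∈ F i) → ∀ i, γ S - γ (Function.update S i ∅) ≤ u i S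
  /-- the sum of the utilities is at most the social function -/
  sum_le : ∀ S, (∀ i, S i ∈ F i) → ∑ i, u i S ≤ γ S

/-- The set of the pairs `(i, e)` such that player `i` plays a set that contains `e`. -/
def incidence {n m : ℕ} (S : Fin n → Finset (Fin m)) : Finset (Fin n × Fin m) :=
  Finset.univ.filter fun t => t.2 ∈ S t.1

/-- An instance of a valid-utility game on the ground set `Fin m`: the strategies of each player
are listed, and the utility functions and the social function are given as set functions of the
incidences between players and elements. The ground set of a player is the union of his
strategies. -/
structure ValidUtilityInstance where
  /-- number of players -/
  n : ℕ
  /-- number of elements of the ground set -/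
  m : ℕ
  /-- the strategies of every player -/
  strats : Fin n → List (List (Fin m))
  /-- every player may take no action -/
  empty_mem : ∀ i, [] ∈ strats i
  /-- the utility function of every player -/
  util : Fin n → SetPoly (Fin n × Fin m)
  /-- the social function -/
  social : SetPoly (Fin n × Fin m)
  /-- the conditions on a valid-utility game -/
  valid : IsValidUtility (fun i => {s | ∃ A ∈ strats i, s = A.toFinset})
    (fun i S => ((util i).eval (incidence S) : ℝ)) (fun S => (social.eval (incidence S) : ℝ))

/-- The game of the instance. -/
noncomputable def ValidUtilityInstance.game (I : ValidUtilityInstance) :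
    StrategicGame I.n where
  Strat i := {s : Finset (Fin I.m) // ∃ A ∈ I.strats i, s = A.toFinset}
  utility i S := ((I.util i).eval (incidence fun j => (S j).1) : ℝ)

/-! ### Encoding of instances as words

Words over the finite alphabet `Γ'`, consisting of `blank`, `bit false`, `bit true`, `bra`, `ket`
and `comma`. Utilities are written in binary; numbers of agents and names of agents in unary
(which changes the length of an instance only polynomially). -/

/-- A number in unary, followed by a blank. -/
def encIndex (k : ℕ) : List Γ' := List.replicate k (Γ'.bit true) ++ [Γ'.blank]

/-- A number in binary, least significant bit first, followed by a blank. -/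
def encNat (k : ℕ) : List Γ' := (encodeNat k).map Γ'.bit ++ [Γ'.blank]

/-- A sign bit and the absolute value in binary. -/
def encInt (z : ℤ) : List Γ' := Γ'.bit (decide (z < 0)) :: encNat z.natAbs

/-- A list: every entry is preceded by a comma, and the list is followed by a bracket. -/
def encList {α : Type} (e : α → List Γ') : List α → List Γ'
  | [] => [Γ'.ket]
  | a :: l => Γ'.comma :: (e a ++ encList e l)

/-- A pair: both components, one after the other. -/
def encPair {α β : Type} (e : α → List Γ') (e' : β → List Γ') (t : α × β) : List Γ' :=
  e t.1 ++ e' t.2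

/-- A number below `n` in unary. -/
def encFin {n : ℕ} (i : Fin n) : List Γ' := encIndex i

/-- A family indexed by `Fin n`, as the list of its values. -/
def encFamily {α : Type} (e : α → List Γ') {n : ℕ} (f : Fin n → α) : List Γ' :=
  encList e (List.ofFn f)

/-- A represented set function, as the list of its terms. -/
def encSetPoly {α : Type} (e : α → List Γ') (p : SetPoly α) : List Γ' :=
  encList (encPair encInt (encList e)) p

def encMarketFrame (F : MarketFrame) : List Γ' :=
  encIndex F.n ++ (encIndex F.m ++
    (encFamily (encList (encList encFin)) F.gens ++ encFamily (encList encFin) F.pref))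

def encUniformMarket (I : UniformMarket) : List Γ' :=
  encMarketFrame I.toMarketFrame ++ encFamily encNat I.value

def encManyToOneMarket (I : ManyToOneMarket) : List Γ' :=
  encMarketFrame I.toMarketFrame ++ encFamily (encSetPoly encFin) I.util

def encValidUtility (I : ValidUtilityInstance) : List Γ' :=
  encIndex I.n ++ (encIndex I.m ++
    (encFamily (encList (encList encFin)) I.strats ++
      (encFamily (encSetPoly (encPair encFin encFin)) I.util ++
        encSetPoly (encPair encFin encFin) I.social)))

/-! Unique readability of the encodings. -/

/-- Code words can be read off uniquely from the beginning of a word. -/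
def Readable {α : Type} (e : α → List Γ') : Prop :=
  ∀ a b r s, e a ++ r = e b ++ s → a = b ∧ r = s

theorem readable_bits : Readable fun l : List Bool => l.map Γ'.bit ++ [Γ'.blank] := by
  intro a
  induction a with
  | nil => intro b r s h; cases b <;> simp_all
  | cons x a ih =>
    intro b r s h
    cases b with
    | nil => simp at h
    | cons y b =>
      simp only [List.map_cons, List.cons_append, List.cons.injEq, Γ'.bit.injEq] at h
      obtain ⟨h1, h2⟩ := ih b r s h.2
      exact ⟨by rw [h.1, h1], h2⟩

theorem readable_index : Readable encIndex := by
  intro a b r s h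
  have := readable_bits (List.replicate a true) (List.replicate b true) r s
    (by simpa [encIndex] using h)
  exact ⟨by simpa using congrArg List.length this.1, this.2⟩

theorem readable_nat : Readable encNat := by
  intro a b r s h
  have := readable_bits (encodeNat a) (encodeNat b) r s h
  exact ⟨encodingNatBool.encode_injective this.1, this.2⟩

theorem readable_int : Readable encInt := by
  intro a b r s h
  simp only [encInt, List.cons_append, List.cons.injEq, Γ'.bit.injEq, decide_eq_decide] at h
  obtain ⟨h1, h2⟩ := readable_nat _ _ r s h.2
  exact ⟨by omega, h2⟩

theorem readable_fin {n : ℕ} : Readable (encFin (n := n)) := by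
  intro a b r s h
  obtain ⟨h1, h2⟩ := readable_index _ _ r s h
  exact ⟨Fin.ext h1, h2⟩

theorem readable_pair {α β : Type} {e : α → List Γ'} {e' : β → List Γ'} (h : Readable e)
    (h' : Readable e') : Readable (encPair e e') := by
  rintro ⟨a, a'⟩ ⟨b, b'⟩ r s hh
  simp only [encPair, List.append_assoc] at hh
  obtain ⟨h1, h2⟩ := h _ _ _ _ hh
  obtain ⟨h3, h4⟩ := h' _ _ _ _ h2
  exact ⟨by rw [h1, h3], h4⟩

theorem readable_list {α : Type} {e : α → List Γ'} (h : Readable e) :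
    Readable (encList e) := by
  intro a
  induction a with
  | nil => intro b r s hh; cases b <;> simp_all [encList]
  | cons x a ih =>
    intro b r s hh
    cases b with
    | nil => simp [encList] at hh
    | cons y b =>
      simp only [encList, List.cons_append, List.append_assoc, List.cons.injEq, true_and] at hh
      obtain ⟨h1, h2⟩ := h _ _ _ _ hh
      obtain ⟨h3, h4⟩ := ih b r s h2
      exact ⟨by rw [h1, h3], h4⟩

theorem readable_family {α : Type} {e : α → List Γ'} (h : Readable e) {n : ℕ} :
    Readable (encFamily e (n := n)) := by
  intro a b r s hh
  obtain ⟨h1, h2⟩ := readable_list h _ _ r s hh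
  exact ⟨List.ofFn_injective h1, h2⟩

theorem readable_setPoly {α : Type} {e : α → List Γ'} (h : Readable e) :
    Readable (encSetPoly e) :=
  readable_list (readable_pair readable_int (readable_list h))

theorem readable_marketFrame : Readable encMarketFrame := by
  rintro ⟨n, m, g, _, p, _, _⟩ ⟨n', m', g', _, p', _, _⟩ r s h
  simp only [encMarketFrame, List.append_assoc] at h
  obtain ⟨rfl, h1⟩ := readable_index _ _ _ _ h
  obtain ⟨rfl, h2⟩ := readable_index _ _ _ _ h1
  obtain ⟨rfl, h3⟩ := readable_family (readable_list (readable_list readable_fin)) _ _ _ _ h2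
  obtain ⟨rfl, h4⟩ := readable_family (readable_list readable_fin) _ _ _ _ h3
  exact ⟨rfl, h4⟩

theorem encUniformMarket_injective : Function.Injective encUniformMarket := by
  rintro ⟨F, v⟩ ⟨F', v'⟩ hh
  obtain ⟨h1, h2⟩ := readable_marketFrame _ _ _ _ hh
  dsimp only at h1
  subst h1
  obtain ⟨h3, -⟩ := readable_family readable_nat v v' [] [] (by simpa using h2)
  rw [h3]

theorem encManyToOneMarket_injective : Function.Injective encManyToOneMarket := by
  rintro ⟨F, v⟩ ⟨F', v'⟩ hh
  obtain ⟨h1, h2⟩ := readable_marketFrame _ _ _ _ hh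
  dsimp only at h1
  subst h1
  obtain ⟨h3, -⟩ := readable_family (readable_setPoly readable_fin) v v' [] []
    (by simpa using h2)
  rw [h3]

theorem encValidUtility_injective : Function.Injective encValidUtility := by
  rintro ⟨n, m, a, _, u, g, _⟩ ⟨n', m', a', _, u', g', _⟩ h
  simp only [encValidUtility] at h
  have hp {k l : ℕ} : Readable (encSetPoly (encPair (encFin (n := k)) (encFin (n := l)))) :=
    readable_setPoly (readable_pair readable_fin readable_fin)
  obtain ⟨rfl, h1⟩ := readable_index _ _ _ _ h
  obtain ⟨rfl, h2⟩ := readable_index _ _ _ _ h1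
  obtain ⟨rfl, h3⟩ := readable_family (readable_list (readable_list readable_fin)) _ _ _ _ h2
  obtain ⟨rfl, h4⟩ := readable_family hp _ _ _ _ h3
  obtain ⟨rfl, -⟩ := hp g g' [] [] (by simpa using h4)
  rfl

open Classical in
/-- The encoding with a given injective encoding function. -/
noncomputable def encodingOfInjective {α A : Type} (e : α → List A)
    (he : Function.Injective e) : Encoding α A where
  encode := e
  decode w := if h : ∃ a, e a = w then some h.choose else none
  decode_encode a := by
    have h : ∃ b, e b = e a := ⟨a, rfl⟩
    rw [dif_pos h, he h.choose_spec]

noncomputable def uniformMarketEncoding : Encoding UniformMarket Γ' :=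
  encodingOfInjective encUniformMarket encUniformMarket_injective

noncomputable def manyToOneMarketEncoding : Encoding ManyToOneMarket Γ' :=
  encodingOfInjective encManyToOneMarket encManyToOneMarket_injective

noncomputable def validUtilityEncoding : Encoding ValidUtilityInstance Γ' :=
  encodingOfInjective encValidUtility encValidUtility_injective

end SinkEquilibria

/-! Every language in PSPACE is reduced to all three problems through an intermediate kind of game,
the `LossGame`: a player loses one unit for each player whose strategy hinders his own, and a `Move`
takes a player from positive loss to loss zero.

The loss game `simulation` runs a space-bounded machine on a cyclic tape. Every cell is a player; a
control player announces the next act (read, write or reset), and a memory player holds the last act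
that was completed. Hindrance makes them take turns: a cell obeys the order of the control, the
memory copies the act of the control once it is carried out, and the control picks an act that may
follow the remembered one and agrees with the scanned symbol. A reset restores the initial tape and
restarts the computation; it may follow any read. A read at which the machine halts without
accepting may follow itself, so there the control can rest.

If the input is accepted, play from the initial configuration never comes to rest and losses stay at
most one (`Act.Sound.step`, `Act.Sound.exists_step`), so some profile is `Live`. If it is rejected,
an equilibrium can be reached from every profile, if need be by resetting and replaying the
computation up to the rejecting halt (`Act.exists_stuck`), so the game is `Terminating`.

An `Implementation` carries this over to a strategic game. In a finite state graph, if no state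
reachable from a given one is arcless, a minimal forward-closed set of reachable states is a
non-singleton sink; if an arcless state can be reached from everywhere, all sinks are singletons.

Two implementations cover the three classes. In the market, the bundle of a strategy `b` of `x`
contains one item for each player, which that player takes away exactly if he hinders `b`, together
with items by which `x` hinders others or harmless substitutes for these. Every bundle thus wins a
fixed number of items minus the loss (`card_gain_full`). All items have value one, so the same
market is an instance of both market classes. In the valid-utility game a player gets one unit for
acting and one for each acting player who does not hinder him; the utilities are bounded, so a large
constant is a valid social function.

The reductions are computable in polynomial time because the instances are written by nested loops
with polynomial bounds and simple tests (`Gen`). These compile to counter programs (`Cmd`) and then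
to a multi-stack machine (`Cmd.Exec.steps`, `Gen.runs`). -/

namespace SinkEquilibria
open Computability Turing

/-! ### Structured programs and their execution by multi-stack Turing machines -/

/-- Structured programs that work on an input stack, an auxiliary stack of bits, an output stack
and counters `0, 1, 2, …`. -/
inductive Cmd
  | skip
  | emit (a : Γ')
  | inc (r : ℕ)
  | seq (p q : Cmd)
  /-- if counter `r` is positive, decrement it and run `p`, otherwise run `q` -/
  | ifReg (r : ℕ) (p q : Cmd)
  /-- as long as counter `r` is positive, decrement it and run `p` -/
  | loop (r : ℕ) (p : Cmd)
  /-- remove the next input symbol, if any, and continue depending on it -/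
  | popIn (p : Option Bool → Cmd)
  /-- move the input to the auxiliary stack, running `p` for every symbol -/
  | scan (p : Cmd)
  /-- push a bit to the auxiliary stack -/
  | save (b : Bool)
  /-- move the auxiliary stack back to the input stack -/
  | restore
  /-- empty the input stack -/
  | clearIn

namespace Cmd

/-- The data on which programs work. -/
@[ext]
structure Store where
  /-- input stack -/
  inp : List Bool
  /-- auxiliary stack -/
  aux : List Bool
  /-- output stack -/
  out : List Γ'
  /-- counters -/
  reg : ℕ → ℕ

/-- `Exec c s s' t`: the program `c` transforms `s` to `s'` in `t` steps. -/
inductive Exec : Cmd → Store → Store → ℕ → Prop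
  | skip (s) : Exec skip s s 1
  | emit (a s) : Exec (emit a) s { s with out := a :: s.out } 1
  | inc (r) (s : Store) : Exec (inc r) s { s with reg := Function.update s.reg r (s.reg r + 1) } 1
  | seq {p q s s' s'' t t'} : Exec p s s' t → Exec q s' s'' t' → Exec (seq p q) s s'' (t + t')
  | ifReg_pos {r p q s s' t k} : s.reg r = k + 1 →
      Exec p { s with reg := Function.update s.reg r k } s' t → Exec (ifReg r p q) s s' (1 + t)
  | ifReg_zero {r p q s s' t} : s.reg r = 0 → Exec q s s' t → Exec (ifReg r p q) s s' (1 + t)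
  | loop_pos {r p s s' s'' t t' k} : s.reg r = k + 1 →
      Exec p { s with reg := Function.update s.reg r k } s' t → Exec (loop r p) s' s'' t' →
      Exec (loop r p) s s'' (1 + t + t')
  | loop_zero {r p s} : s.reg r = 0 → Exec (loop r p) s s 1
  | popIn {p s s' t} : Exec (p s.inp.head?) { s with inp := s.inp.tail } s' t →
      Exec (popIn p) s s' (1 + t)
  | scan_cons {p b l s s' s'' t t'} : s.inp = b :: l →
      Exec p { s with inp := l, aux := b :: s.aux } s' t → Exec (scan p) s' s'' t' →
      Exec (scan p) s s'' (1 + t + t')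
  | scan_nil {p s} : s.inp = [] → Exec (scan p) s s 1
  | save (b s) : Exec (save b) s { s with aux := b :: s.aux } 1
  | restore_cons {b l s s' t} : s.aux = b :: l →
      Exec restore { s with inp := b :: s.inp, aux := l } s' t → Exec restore s s' (1 + t)
  | restore_nil {s} : s.aux = [] → Exec restore s s 1
  | clearIn_cons {b l s s' t} : s.inp = b :: l →
      Exec clearIn { s with inp := l } s' t → Exec clearIn s s' (1 + t)
  | clearIn_nil {s} : s.inp = [] → Exec clearIn s s 1

/-- All counters used are at most `R`. -/
def Below (R : ℕ) : Cmd → Prop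
  | inc r => r ≤ R
  | seq p q => p.Below R ∧ q.Below R
  | ifReg r p q => r ≤ R ∧ p.Below R ∧ q.Below R
  | loop r p => r ≤ R ∧ p.Below R
  | popIn p => ∀ o, (p o).Below R
  | scan p => p.Below R
  | _ => True

theorem Below.mono {R R' : ℕ} (h : R ≤ R') : ∀ {c : Cmd}, c.Below R → c.Below R'
  | skip, _ | emit _, _ | save _, _ | restore, _ | clearIn, _ => trivial
  | inc _, hc => le_trans hc h
  | seq _ _, hc => ⟨hc.1.mono h, hc.2.mono h⟩
  | ifReg _ _ _, hc => ⟨hc.1.trans h, hc.2.1.mono h, hc.2.2.mono h⟩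
  | loop _ _, hc => ⟨hc.1.trans h, hc.2.mono h⟩
  | popIn _, hc => fun o => (hc o).mono h
  | scan p, hc => Below.mono h (c := p) hc

/-- Needed because a machine has finitely many stacks, one for each counter. The branches of `popIn`
are indexed by the finite type `Option Bool`, so their bounds can be summed. -/
theorem exists_below (c : Cmd) : ∃ R, c.Below R := by
  induction c with
  | skip | emit | save | restore | clearIn => exact ⟨0, trivial⟩
  | inc r => exact ⟨r, le_rfl⟩
  | seq p q hp hq =>
    obtain ⟨a, ha⟩ := hp
    obtain ⟨b, hb⟩ := hq
    exact ⟨a + b, ha.mono (by omega), hb.mono (by omega)⟩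
  | ifReg r p q hp hq =>
    obtain ⟨a, ha⟩ := hp
    obtain ⟨b, hb⟩ := hq
    exact ⟨r + a + b, by omega, ha.mono (by omega), hb.mono (by omega)⟩
  | loop r p hp =>
    obtain ⟨a, ha⟩ := hp
    exact ⟨r + a, by omega, ha.mono (by omega)⟩
  | popIn p hp =>
    choose a ha using hp
    exact ⟨∑ o, a o, fun o => (ha o).mono (Finset.single_le_sum (fun _ _ => Nat.zero_le _)
      (Finset.mem_univ o))⟩
  | scan p hp => exact hp

/-- The control locations of a program. -/
def Label : Cmd → Type
  | seq p q => p.Label ⊕ q.Label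
  | ifReg _ p q => Option (p.Label ⊕ q.Label)
  | loop _ p => Option p.Label
  | popIn p => Option (Σ o, (p o).Label)
  | scan p => Option p.Label
  | _ => Unit

noncomputable instance fintypeLabel : ∀ c : Cmd, Fintype c.Label
  | seq p q => @instFintypeSum _ _ (fintypeLabel p) (fintypeLabel q)
  | ifReg _ p q =>
    @instFintypeOption _ (@instFintypeSum _ _ (fintypeLabel p) (fintypeLabel q))
  | loop _ p => @instFintypeOption _ (fintypeLabel p)
  | popIn p => @instFintypeOption _ (@Sigma.instFintype _ _ (fun o => fintypeLabel (p o)) _)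
  | scan p => @instFintypeOption _ (fintypeLabel p)
  | skip | emit _ | save _ | restore | clearIn | inc _ => inferInstanceAs (Fintype Unit)

/-- The control location at which the execution of a program starts. -/
def entry : ∀ c : Cmd, c.Label
  | seq p _ => Sum.inl p.entry
  | ifReg _ _ _ => none
  | loop _ _ => none
  | popIn _ => none
  | scan _ => none
  | skip | emit _ | save _ | restore | clearIn | inc _ => ()

/-- The stacks of the machine for programs with the counters `0, …, R`. -/
abbrev Stack (R : ℕ) : Type := Fin 3 ⊕ Fin (R + 1)

/-- The stack alphabets. -/
def Alphabet {R : ℕ} : Stack R → Type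
  | Sum.inl 0 => Bool
  | Sum.inl 1 => Bool
  | Sum.inl 2 => Γ'
  | Sum.inr _ => Unit

/-- The stack that holds counter `r`. -/
def counter (R r : ℕ) : Stack R := Sum.inr (Fin.ofNat (R + 1) r)

/-- The machine code of a program, where `emb` embeds the control locations of the program into
those of the whole machine and `next` is the location at which the machine continues. -/
def code (R : ℕ) {Λ : Type} : ∀ (c : Cmd), (c.Label → Λ) → Λ → c.Label →
    TM2.Stmt (Alphabet (R := R)) Λ (Option Bool)
  | skip, _, next, _ => .goto fun _ => next
  | emit a, _, next, _ => .push (Sum.inl 2) (fun _ => a) (.goto fun _ => next)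
  | inc r, _, next, _ => .push (counter R r) (fun _ => ()) (.goto fun _ => next)
  | seq p q, emb, next, Sum.inl l => p.code R (fun l => emb (Sum.inl l)) (emb (Sum.inr q.entry)) l
  | seq _ q, emb, next, Sum.inr l => q.code R (fun l => emb (Sum.inr l)) next l
  | ifReg r p q, emb, _, none =>
    .pop (counter R r) (fun _ o => o.map fun _ => true) (.goto fun v =>
      if v.isSome then emb (some (Sum.inl p.entry)) else emb (some (Sum.inr q.entry)))
  | ifReg _ p _, emb, next, some (Sum.inl l) => p.code R (fun l => emb (some (Sum.inl l))) next l
  | ifReg _ _ q, emb, next, some (Sum.inr l) => q.code R (fun l => emb (some (Sum.inr l))) next l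
  | loop r p, emb, next, none =>
    .pop (counter R r) (fun _ o => o.map fun _ => true) (.goto fun v =>
      if v.isSome then emb (some p.entry) else next)
  | loop _ p, emb, _, some l => p.code R (fun l => emb (some l)) (emb none) l
  | popIn p, emb, _, none =>
    .pop (Sum.inl 0) (fun _ o => o) (.goto fun v => emb (some ⟨v, (p v).entry⟩))
  | popIn p, emb, next, some ⟨o, l⟩ => (p o).code R (fun l => emb (some ⟨o, l⟩)) next l
  | scan p, emb, next, none =>
    .pop (Sum.inl 0) (fun _ o => o) (.branch (fun v => v.isSome)
      (.push (Sum.inl 1) (fun v => v.getD false) (.goto fun _ => emb (some p.entry)))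
      (.goto fun _ => next))
  | scan p, emb, _, some l => p.code R (fun l => emb (some l)) (emb none) l
  | save b, _, next, _ => .push (Sum.inl 1) (fun _ => b) (.goto fun _ => next)
  | restore, emb, next, l =>
    .pop (Sum.inl 1) (fun _ o => o) (.branch (fun v => v.isSome)
      (.push (Sum.inl 0) (fun v => v.getD false) (.goto fun _ => emb l))
      (.goto fun _ => next))
  | clearIn, emb, next, l =>
    .pop (Sum.inl 0) (fun _ o => o) (.goto fun v => if v.isSome then emb l else next)

/-- The contents of the stack for a counter with the value `n`. -/
def pile (R r n : ℕ) : List (Alphabet (counter R r)) := List.replicate n ()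

/-- The contents of the stacks. -/
def Store.stacks (R : ℕ) (s : Store) : ∀ k : Stack R, List (Alphabet k)
  | Sum.inl 0 => s.inp
  | Sum.inl 1 => s.aux
  | Sum.inl 2 => s.out
  | Sum.inr r => List.replicate (s.reg r) ()

/-- `Steps f t a b`: the state `b` is reached from `a` by exactly `t` steps of `f`. -/
def Steps {α : Type} (f : α → Option α) (t : ℕ) (a b : α) : Prop :=
  (flip bind f)^[t] (some a) = some b

theorem Steps.trans {α : Type} {f : α → Option α} {t t' : ℕ} {a b c : α} (h : Steps f t a b)
    (h' : Steps f t' b c) : Steps f (t + t') a c := by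
  rw [Steps, add_comm, Function.iterate_add_apply, h, h']

theorem Steps.single {α : Type} {f : α → Option α} {a b : α} (h : f a = some b) :
    Steps f 1 a b := h

theorem stacks_update_counter {R r : ℕ} (hr : r ≤ R) (s : Store) (n : ℕ) :
    Function.update (s.stacks R) (counter R r) (pile R r n) =
      ({ s with reg := Function.update s.reg r n } : Store).stacks R := by
  funext k
  by_cases hk : k = counter R r
  · subst hk
    have : r % (R + 1) = r := Nat.mod_eq_of_lt (by omega)
    simp [Store.stacks, counter, pile, this]
  · rw [Function.update_of_ne hk]
    match k with
    | Sum.inl 0 | Sum.inl 1 | Sum.inl 2 => rfl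
    | Sum.inr i =>
      have : (i : ℕ) ≠ r := by
        rintro rfl
        exact hk (by simp [counter])
      simp [Store.stacks, Function.update_of_ne this]

theorem stacks_counter {R r : ℕ} (hr : r ≤ R) (s : Store) :
    s.stacks R (counter R r) = pile R r (s.reg r) := by
  have : r % (R + 1) = r := Nat.mod_eq_of_lt (by omega)
  exact congrArg (fun i => List.replicate (s.reg i) ()) this

theorem stacks_update_inp {R : ℕ} (s : Store) (l : List Bool) :
    Function.update (s.stacks R) (Sum.inl 0) l = ({ s with inp := l } : Store).stacks R := by
  funext k
  match k with
  | Sum.inl 0 | Sum.inl 1 | Sum.inl 2 | Sum.inr _ => rfl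

theorem stacks_update_aux {R : ℕ} (s : Store) (l : List Bool) :
    Function.update (s.stacks R) (Sum.inl 1) l = ({ s with aux := l } : Store).stacks R := by
  funext k
  match k with
  | Sum.inl 0 | Sum.inl 1 | Sum.inl 2 | Sum.inr _ => rfl

theorem stacks_update_out {R : ℕ} (s : Store) (l : List Γ') :
    Function.update (s.stacks R) (Sum.inl 2) l = ({ s with out := l } : Store).stacks R := by
  funext k
  match k with
  | Sum.inl 0 | Sum.inl 1 | Sum.inl 2 | Sum.inr _ => rfl

theorem stacks_update_inp_aux {R : ℕ} (s : Store) (l l' : List Bool) :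
    Function.update (Function.update (s.stacks R) (Sum.inl 0) l) (Sum.inl 1) l' =
      ({ s with inp := l, aux := l' } : Store).stacks R := by
  funext k
  match k with
  | Sum.inl 0 | Sum.inl 1 | Sum.inl 2 | Sum.inr _ => rfl

theorem stacks_update_aux_inp {R : ℕ} (s : Store) (l l' : List Bool) :
    Function.update (Function.update (s.stacks R) (Sum.inl 1) l) (Sum.inl 0) l' =
      ({ s with inp := l', aux := l } : Store).stacks R := by
  funext k
  match k with
  | Sum.inl 0 | Sum.inl 1 | Sum.inl 2 | Sum.inr _ => rfl

theorem update_of_eq {R : ℕ} {S : ∀ k : Stack R, List (Alphabet k)} {k : Stack R}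
    {s : List (Alphabet k)} (h : S k = s) : Function.update S k s = S := by
  rw [← h, Function.update_eq_self]

theorem step_push {R : ℕ} {Λ : Type} {M : Λ → TM2.Stmt (Alphabet (R := R)) Λ (Option Bool)}
    {l l' : Λ} {v : Option Bool} {S : ∀ k, List (Alphabet k)} {k : Stack R} {a : Alphabet k}
    {s : List (Alphabet k)} (hM : M l = .push k (fun _ => a) (.goto fun _ => l'))
    (hS : S k = s) :
    TM2.step M ⟨some l, v, S⟩ = some ⟨some l', v, Function.update S k (a :: s)⟩ := by
  rw [TM2.step, hM, ← hS]
  rfl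

theorem step_pop {R : ℕ} {Λ : Type} {M : Λ → TM2.Stmt (Alphabet (R := R)) Λ (Option Bool)}
    {l : Λ} {v : Option Bool} {S : ∀ k, List (Alphabet k)} {k : Stack R}
    {f : Option (Alphabet k) → Option Bool} {q : TM2.Stmt Alphabet Λ (Option Bool)}
    {s : List (Alphabet k)} (hM : M l = .pop k (fun _ => f) q) (hS : S k = s) :
    TM2.step M ⟨some l, v, S⟩ = some (TM2.stepAux q (f s.head?) (Function.update S k s.tail)) := by
  rw [TM2.step, hM, ← hS]
  rfl

theorem steps_pop_counter_pos {R r k : ℕ} {Λ : Type} {M : Λ → TM2.Stmt Alphabet Λ (Option Bool)}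
    {l : Λ} {f : Option Bool → Λ} (hr : r ≤ R)
    (hM : M l = .pop (counter R r) (fun _ o => o.map fun _ => true) (.goto f)) {s : Store}
    (hs : s.reg r = k + 1) (v : Option Bool) :
    Steps (TM2.step M) 1 ⟨some l, v, s.stacks R⟩
      ⟨some (f (some true)), some true,
        ({ s with reg := Function.update s.reg r k } : Store).stacks R⟩ := by
  refine Steps.single ((step_pop hM ((stacks_counter hr s).trans (congrArg (pile R r) hs))).trans ?_)
  rw [← stacks_update_counter hr]
  rfl

theorem steps_pop_counter_zero {R r : ℕ} {Λ : Type} {M : Λ → TM2.Stmt Alphabet Λ (Option Bool)}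
    {l : Λ} {f : Option Bool → Λ} (hr : r ≤ R)
    (hM : M l = .pop (counter R r) (fun _ o => o.map fun _ => true) (.goto f)) {s : Store}
    (hs : s.reg r = 0) (v : Option Bool) :
    Steps (TM2.step M) 1 ⟨some l, v, s.stacks R⟩ ⟨some (f none), none, s.stacks R⟩ := by
  have h := (stacks_counter hr s).trans (congrArg (pile R r) hs)
  refine Steps.single ((step_pop hM h).trans ?_)
  exact congrArg some (congrArg (TM2.Cfg.mk _ _)
    (update_of_eq h))

/-- The machine code of a program executes the program. -/
theorem Exec.steps {R : ℕ} {Λ : Type} {M : Λ → TM2.Stmt Alphabet Λ (Option Bool)} {c : Cmd}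
    {s s' : Store} {t : ℕ} (h : Exec c s s' t) (hb : c.Below R) (emb : c.Label → Λ) (next : Λ)
    (hM : ∀ l, M (emb l) = c.code R emb next l) (v : Option Bool) :
    ∃ v', Steps (TM2.step M) t ⟨some (emb c.entry), v, s.stacks R⟩
      ⟨some next, v', s'.stacks R⟩ := by
  induction h generalizing next v with
  | skip s => exact ⟨v, Steps.single (by simp [TM2.step, hM, code])⟩
  | emit a s =>
    refine ⟨v, Steps.single ((step_push (hM _) rfl).trans ?_)⟩
    exact congrArg some (congrArg _ (stacks_update_out ..))
  | inc r s =>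
    refine ⟨v, Steps.single ((step_push (hM _) (stacks_counter hb s)).trans ?_)⟩
    exact congrArg some (congrArg _ (stacks_update_counter hb s (s.reg r + 1)))
  | seq _ _ ih ih' =>
    obtain ⟨v', h1⟩ := ih hb.1 (fun l => emb (Sum.inl l)) (emb (Sum.inr (entry _)))
      (fun l => hM (Sum.inl l)) v
    obtain ⟨v'', h2⟩ := ih' hb.2 (fun l => emb (Sum.inr l)) next (fun l => hM (Sum.inr l)) v'
    exact ⟨v'', h1.trans h2⟩
  | ifReg_pos hs _ ih =>
    obtain ⟨v', h1⟩ := ih hb.2.1 (fun l => emb (some (Sum.inl l))) next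
      (fun l => hM (some (Sum.inl l))) (some true)
    exact ⟨v', (steps_pop_counter_pos hb.1 (hM none) hs v).trans h1⟩
  | ifReg_zero hs _ ih =>
    obtain ⟨v', h1⟩ := ih hb.2.2 (fun l => emb (some (Sum.inr l))) next
      (fun l => hM (some (Sum.inr l))) none
    exact ⟨v', (steps_pop_counter_zero hb.1 (hM none) hs v).trans h1⟩
  | loop_pos hs _ _ ih ih' =>
    -- The body continues at `emb none`, the head of the loop, where the counter is tested again.
    obtain ⟨v', h1⟩ := ih hb.2 (fun l => emb (some l)) (emb none) (fun l => hM (some l))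
      (some true)
    obtain ⟨v'', h2⟩ := ih' hb emb next hM v'
    exact ⟨v'', ((steps_pop_counter_pos hb.1 (hM none) hs v).trans h1).trans h2⟩
  | loop_zero hs => exact ⟨none, steps_pop_counter_zero hb.1 (hM none) hs v⟩
  | @popIn p s _ _ _ ih =>
    obtain ⟨v', h1⟩ := ih (hb _) (fun l => emb (some ⟨s.inp.head?, l⟩)) next
      (fun l => hM (some ⟨_, l⟩)) s.inp.head?
    refine ⟨v', Steps.trans (Steps.single ((step_pop (k := Sum.inl 0) (hM none) (s := s.inp) rfl).trans ?_)) h1⟩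
    exact congrArg some (congrArg _ (stacks_update_inp ..))
  | @scan_cons p b l s _ _ _ _ hs _ _ ih ih' =>
    obtain ⟨v', h1⟩ := ih hb (fun l => emb (some l)) (emb none) (fun l => hM (some l)) (some b)
    obtain ⟨v'', h2⟩ := ih' hb emb next hM v'
    refine ⟨v'', Steps.trans (Steps.trans (Steps.single
      ((step_pop (k := Sum.inl 0) (hM none) (s := (b :: l : List Bool)) hs).trans ?_)) h1) h2⟩
    exact congrArg some (congrArg _ (stacks_update_inp_aux ..))
  | @scan_nil p s hs =>
    refine ⟨none, Steps.single ((step_pop (k := Sum.inl 0) (hM none) (s := ([] : List Bool)) hs).trans ?_)⟩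
    exact congrArg some (congrArg (TM2.Cfg.mk _ _)
      (update_of_eq (k := Sum.inl 0) hs))
  | save b s =>
    refine ⟨v, Steps.single ((step_push (hM _) rfl).trans ?_)⟩
    exact congrArg some (congrArg _ (stacks_update_aux ..))
  | @restore_cons b l s _ _ hs _ ih =>
    obtain ⟨v', h1⟩ := ih hb emb next hM (some b)
    refine ⟨v', Steps.trans (Steps.single
      ((step_pop (k := Sum.inl 1) (hM _) (s := (b :: l : List Bool)) hs).trans ?_)) h1⟩
    exact congrArg some (congrArg _ (stacks_update_aux_inp ..))
  | @restore_nil s hs =>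
    refine ⟨none, Steps.single ((step_pop (k := Sum.inl 1) (hM _) (s := ([] : List Bool)) hs).trans ?_)⟩
    exact congrArg some (congrArg (TM2.Cfg.mk _ _)
      (update_of_eq (k := Sum.inl 1) hs))
  | @clearIn_cons b l s _ _ hs _ ih =>
    obtain ⟨v', h1⟩ := ih hb emb next hM (some b)
    refine ⟨v', Steps.trans (Steps.single
      ((step_pop (k := Sum.inl 0) (hM _) (s := (b :: l : List Bool)) hs).trans ?_)) h1⟩
    exact congrArg some (congrArg _ (stacks_update_inp ..))
  | @clearIn_nil s hs =>
    refine ⟨none, Steps.single ((step_pop (k := Sum.inl 0) (hM _) (s := ([] : List Bool)) hs).trans ?_)⟩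
    exact congrArg some (congrArg (TM2.Cfg.mk _ _)
      (update_of_eq (k := Sum.inl 0) hs))

/-- The machine that executes a program and halts. -/
noncomputable def machine (R : ℕ) (c : Cmd) : FinTM2 where
  K := Stack R
  k₀ := Sum.inl 0
  k₁ := Sum.inl 2
  Γ := Alphabet
  Λ := Option c.Label
  main := some c.entry
  σ := Option Bool
  initialState := none
  Γk₀Fin := inferInstanceAs (Fintype Bool)
  m
    -- The last pop may have left a symbol in the internal state, but the final configuration must
    -- carry the initial one.
    | none => .load (fun _ => none) .halt
    | some l => c.code R some none l

/-- A function is computable in polynomial time if a program computes it in polynomial time. -/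
theorem computableInPolyTime {I : Type} {enc : I → List Γ'} {f : List Bool → I} (c : Cmd)
    (T : Polynomial ℕ)
    (h : ∀ x, ∃ t ≤ T.eval x.length,
      Exec c ⟨x, [], [], fun _ => 0⟩ ⟨[], [], enc (f x), fun _ => 0⟩ t) :
    Nonempty (TM2ComputableInPolyTime (encodingList Bool).encode enc f) := by
  obtain ⟨R, hR⟩ := c.exists_below
  refine ⟨⟨⟨machine R c, Equiv.refl _, Equiv.refl _⟩, T + 1, fun x => ?_⟩⟩
  -- Stated for words equal to `x` and `enc (f x)`, since the definition of computability maps both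
  -- along alphabet equivalences, here identities.
  have key : ∀ (y : List Bool) (z : List Γ'), y = x → z = enc (f x) →
      ∃ t ≤ T.eval x.length, Steps (machine R c).step (t + 1)
        (initList (machine R c) y) (haltList (machine R c) z) := by
    rintro y _ rfl rfl
    obtain ⟨t, ht, he⟩ := h y
    obtain ⟨v, hv⟩ := he.steps hR some none (M := (machine R c).m) (fun _ => rfl) none
    refine ⟨t, ht, ?_⟩
    have h1 : initList (machine R c) y =
        ⟨some (some c.entry), none, Store.stacks R ⟨y, [], [], fun _ => 0⟩⟩ := by
      refine congrArg (TM2.Cfg.mk _ _) ?_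
      funext k
      match k with
      | Sum.inl 0 | Sum.inl 1 | Sum.inl 2 | Sum.inr _ => rfl
    have h2 : haltList (machine R c) (enc (f y)) =
        ⟨none, none, Store.stacks R ⟨[], [], enc (f y), fun _ => 0⟩⟩ := by
      refine congrArg (TM2.Cfg.mk _ _) ?_
      funext k
      match k with
      | Sum.inl 0 | Sum.inl 1 | Sum.inl 2 | Sum.inr _ => rfl
    rw [h1, h2]
    exact hv.trans (Steps.single rfl)
  replace key := key _ _ (List.map_id x) (List.map_id _)
  exact ⟨⟨key.choose + 1, key.choose_spec.2⟩, by
    rw [Polynomial.eval_add, Polynomial.eval_one]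
    exact Nat.succ_le_succ key.choose_spec.1⟩

end Cmd
end SinkEquilibria

/-! ### Upper bounds for the running time of programs -/

namespace SinkEquilibria
open Computability Turing

namespace Cmd

/-- The program `c` transforms `s` to `s'` in at most `T` steps. -/
def Runs (c : Cmd) (s s' : Store) (T : ℕ) : Prop := ∃ t ≤ T, Exec c s s' t

theorem Runs.mono {c : Cmd} {s s' : Store} {T T' : ℕ} (h : Runs c s s' T) (hT : T ≤ T') :
    Runs c s s' T' :=
  let ⟨t, ht, he⟩ := h
  ⟨t, ht.trans hT, he⟩

theorem Runs.congr {c : Cmd} {s s' u u' : Store} {T T' : ℕ} (h : Runs c s s' T)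
    (hs : s = u) (hs' : s' = u') (hT : T ≤ T') : Runs c u u' T' :=
  hs ▸ hs' ▸ h.mono hT

theorem Store.reg_congr {i a : List Bool} {o : List Γ'} {g g' : ℕ → ℕ} (h : ∀ r, g r = g' r) :
    Store.mk i a o g = ⟨i, a, o, g'⟩ :=
  congrArg _ (funext h)

theorem Exec.runs {c : Cmd} {s s' : Store} {t : ℕ} (h : Exec c s s' t) : Runs c s s' t :=
  ⟨t, le_rfl, h⟩

theorem Runs.seq {p q : Cmd} {s s' s'' : Store} {T T' : ℕ} (h : Runs p s s' T)
    (h' : Runs q s' s'' T') : Runs (p.seq q) s s'' (T + T') :=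
  let ⟨t, ht, he⟩ := h
  let ⟨t', ht', he'⟩ := h'
  ⟨t + t', by omega, .seq he he'⟩

theorem Runs.ifReg_pos {r k : ℕ} {p q : Cmd} {s s' : Store} {T : ℕ} (hs : s.reg r = k + 1)
    (h : Runs p { s with reg := Function.update s.reg r k } s' T) :
    Runs (ifReg r p q) s s' (1 + T) :=
  let ⟨t, ht, he⟩ := h
  ⟨1 + t, by omega, .ifReg_pos hs he⟩

theorem Runs.ifReg_zero {r : ℕ} {p q : Cmd} {s s' : Store} {T : ℕ} (hs : s.reg r = 0)
    (h : Runs q s s' T) : Runs (ifReg r p q) s s' (1 + T) :=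
  let ⟨t, ht, he⟩ := h
  ⟨1 + t, by omega, .ifReg_zero hs he⟩

theorem Runs.popIn {p : Option Bool → Cmd} {s s' : Store} {T : ℕ}
    (h : Runs (p s.inp.head?) { s with inp := s.inp.tail } s' T) :
    Runs (popIn p) s s' (1 + T) :=
  let ⟨t, ht, he⟩ := h
  ⟨1 + t, by omega, .popIn he⟩

/-- The rule for loops, for a family of invariants indexed by the loop counter. -/
theorem Runs.loop {r n : ℕ} {p : Cmd} {T : ℕ} (I : ℕ → Store) (h0 : (I 0).reg r = 0)
    (hI : ∀ k < n, (I (k + 1)).reg r = k + 1 ∧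
      Runs p { I (k + 1) with reg := Function.update (I (k + 1)).reg r k } (I k) T) :
    Runs (loop r p) (I n) (I 0) (n * (T + 1) + 1) := by
  induction n with
  | zero => simpa using (Exec.loop_zero h0).runs
  | succ n ih =>
    obtain ⟨t, ht, he⟩ := ih fun k hk => hI k (by omega)
    obtain ⟨hr, t', ht', he'⟩ := hI n (by omega)
    exact ⟨1 + t' + t, by rw [Nat.succ_mul]; omega, .loop_pos hr he' he⟩

theorem runs_loop_inc {u f : ℕ} (huf : u ≠ f) (s : Store) :
    Runs (loop u (inc f)) s { s with
      reg := Function.update (Function.update s.reg f (s.reg f + s.reg u)) u 0 }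
      (s.reg u * 2 + 1) := by
  have h := Runs.loop (r := u) (n := s.reg u) (p := inc f) (T := 1) (fun k => { s with
    reg := Function.update (Function.update s.reg f (s.reg f + (s.reg u - k))) u k })
    (by simp) (fun k hk => ⟨by simp, ?_⟩)
  · exact h.congr (by simp) rfl le_rfl
  · refine (Exec.inc f _).runs.congr rfl (Store.reg_congr fun r => ?_) le_rfl
    simp only [Function.update_apply]
    split_ifs <;> omega

theorem runs_loop_skip (u : ℕ) (s : Store) :
    Runs (loop u skip) s { s with reg := Function.update s.reg u 0 } (s.reg u * 2 + 1) := by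
  have h := Runs.loop (r := u) (n := s.reg u) (p := skip) (T := 1) (fun k => { s with
    reg := Function.update s.reg u k }) (by simp) (fun k hk => ⟨by simp, ?_⟩)
  · exact h.congr (by simp) rfl le_rfl
  · exact (Exec.skip _).runs.congr rfl (by simp) le_rfl

theorem runs_loop_inc_inc {f u v : ℕ} (hfu : f ≠ u) (hfv : f ≠ v) (huv : u ≠ v) (s : Store) :
    Runs (loop f ((inc u).seq (inc v))) s { s with
      reg := Function.update (Function.update (Function.update s.reg u (s.reg u + s.reg f))
        v (s.reg v + s.reg f)) f 0 } (s.reg f * 3 + 1) := by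
  have h := Runs.loop (r := f) (n := s.reg f) (p := (inc u).seq (inc v)) (T := 2)
    (fun k => { s with
      reg := Function.update (Function.update (Function.update s.reg u (s.reg u + (s.reg f - k)))
        v (s.reg v + (s.reg f - k))) f k })
    (by simp) (fun k hk => ⟨by simp, ?_⟩)
  · exact h.congr (by simp) rfl le_rfl
  · refine ((Exec.inc u _).runs.seq (Exec.inc v _).runs).congr rfl
      (Store.reg_congr fun r => ?_) le_rfl
    simp only [Function.update_apply]
    split_ifs <;> omega

/-- Add counter `u` to counter `v`, using the auxiliary counter `f`. -/
def copy (u v f : ℕ) : Cmd := (loop u (inc f)).seq (loop f ((inc u).seq (inc v)))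

/-- Reading a counter destroys it: `u` is emptied into `f`, and `f` is then emptied into both `u`
and `v`. -/
theorem runs_copy {u v f : ℕ} (huf : u ≠ f) (hvf : v ≠ f) (huv : u ≠ v) {s : Store}
    (hf : s.reg f = 0) :
    Runs (copy u v f) s { s with reg := Function.update s.reg v (s.reg v + s.reg u) }
      (5 * s.reg u + 2) := by
  refine ((runs_loop_inc huf s).seq (runs_loop_inc_inc huf.symm hvf.symm huv _)).congr rfl
    (Store.reg_congr fun r => ?_) ?_
  · simp only [Function.update_apply]
    split_ifs <;> first | omega | simp_all
  · simp only [Function.update_apply, if_neg huf.symm, hf, if_true]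
    omega

theorem runs_restore (s : Store) :
    Runs restore s { s with inp := s.aux.reverse ++ s.inp, aux := [] } (s.aux.length + 1) := by
  obtain ⟨i, a, o, g⟩ := s
  induction a generalizing i with
  | nil => exact (Exec.restore_nil rfl).runs
  | cons b l ih =>
    obtain ⟨t, ht, he⟩ := ih (b :: i)
    refine ⟨1 + t, by simp at ht ⊢; omega, .restore_cons rfl ?_⟩
    simpa using he

theorem runs_scan_inc (v : ℕ) (s : Store) :
    Runs (scan (inc v)) s { s with
      inp := [], aux := s.inp.reverse ++ s.aux,
      reg := Function.update s.reg v (s.reg v + s.inp.length) } (2 * s.inp.length + 1) := by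
  obtain ⟨i, a, o, g⟩ := s
  induction i generalizing a g with
  | nil => simpa using (Exec.scan_nil rfl).runs
  | cons b l ih =>
    obtain ⟨t, ht, he⟩ := ih (b :: a) (Function.update g v (g v + 1))
    refine ⟨1 + 1 + t, by simp at ht ⊢; omega, .scan_cons rfl (.inc v _) ?_⟩
    simpa [add_assoc, add_comm 1] using he

theorem runs_clearIn (s : Store) : Runs clearIn s { s with inp := [] } (s.inp.length + 1) := by
  obtain ⟨i, a, o, g⟩ := s
  induction i with
  | nil => exact (Exec.clearIn_nil rfl).runs
  | cons b l ih =>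
    obtain ⟨t, ht, he⟩ := ih
    exact ⟨1 + t, by simp at ht ⊢; omega, .clearIn_cons rfl he⟩

end Cmd

open Cmd

/-! ### Arithmetical expressions -/

/-- Arithmetical expressions in the variables `0, 1, 2, …` and the length of the input. -/
inductive Ex
  | var (i : ℕ)
  | const (k : ℕ)
  | len
  | add (e e' : Ex)
  | mul (e e' : Ex)

namespace Ex

/-- The value of an expression. -/
def eval (x : List Bool) (env : ℕ → ℕ) : Ex → ℕ
  | var i => env i
  | const k => k
  | len => x.length
  | add e e' => e.eval x env + e'.eval x env
  | mul e e' => e.eval x env * e'.eval x env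

/-- All variables are less than `d`. -/
def Closed (d : ℕ) : Ex → Prop
  | var i => i < d
  | const _ => True
  | len => True
  | add e e' => e.Closed d ∧ e'.Closed d
  | mul e e' => e.Closed d ∧ e'.Closed d

/-- A bound for the value of an expression. -/
noncomputable def bound : Ex → Polynomial ℕ
  | var _ => .X
  | const k => .C k
  | len => .X
  | add e e' => e.bound + e'.bound
  | mul e e' => e.bound * e'.bound

/-- The program that adds the value of an expression to counter `v`, using the auxiliary
counters `f, f + 1, …`. -/
def addTo (v f : ℕ) : Ex → Cmd
  | var i => copy i v f
  | const k => (List.replicate k (inc v)).foldr seq skip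
  | len => (scan (inc v)).seq restore
  | add e e' => (e.addTo v f).seq (e'.addTo v f)
  -- The first factor becomes the loop counter `f`, so scratch space now begins at `f + 1`.
  | mul e e' => (e.addTo f (f + 1)).seq (.loop f (e'.addTo v (f + 1)))

/-- A bound for the time to evaluate an expression. -/
noncomputable def time : Ex → Polynomial ℕ
  | var _ => 5 * .X + 2
  | const k => .C k + 1
  | len => 3 * .X + 2
  | add e e' => e.time + e'.time
  | mul e e' => e.time + (e.bound * (e'.time + 1) + 1)

theorem eval_congr {x : List Bool} {d : ℕ} {env env' : ℕ → ℕ} (h : ∀ r < d, env r = env' r) :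
    ∀ {e : Ex}, e.Closed d → e.eval x env = e.eval x env'
  | var i, he => h i he
  | const _, _ | len, _ => rfl
  | add _ _, he => congrArg₂ (· + ·) (eval_congr h he.1) (eval_congr h he.2)
  | mul _ _, he => congrArg₂ (· * ·) (eval_congr h he.1) (eval_congr h he.2)

theorem eval_le_bound {x : List Bool} {d m : ℕ} {env : ℕ → ℕ} (h : ∀ r < d, env r ≤ m)
    (hx : x.length ≤ m) : ∀ {e : Ex}, e.Closed d → e.eval x env ≤ e.bound.eval m
  | var i, he => by simpa [eval, bound] using h i he
  | const _, _ => by simp [eval, bound]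
  | len, _ => by simpa [eval, bound] using hx
  | add _ _, he => by
    simpa [eval, bound] using Nat.add_le_add (eval_le_bound h hx he.1) (eval_le_bound h hx he.2)
  | mul _ _, he => by
    simpa [eval, bound] using Nat.mul_le_mul (eval_le_bound h hx he.1) (eval_le_bound h hx he.2)

/-- Counters below `d` hold variables and those from `f` on are scratch space with value zero. Both
are left as they were found, which lets evaluations be chained and nested. -/
theorem runs {d m : ℕ} (e : Ex) (he : e.Closed d) {v f : ℕ} {s : Store} (hdv : d ≤ v)
    (hvf : v < f) (hz : ∀ r ≥ f, s.reg r = 0) (ha : s.aux = []) (hm : ∀ r < d, s.reg r ≤ m)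
    (hx : s.inp.length ≤ m) :
    Runs (e.addTo v f) s
      { s with reg := Function.update s.reg v (s.reg v + e.eval s.inp s.reg) }
      (e.time.eval m) := by
  induction e generalizing v f s with
  | var i =>
    have hi : i < d := he
    refine (runs_copy (by omega) (by omega) (by omega) (hz f le_rfl)).mono ?_
    have := hm i hi
    simp [time]
    omega
  | const k =>
    clear he hx hm hz
    simp only [addTo, eval, time, Polynomial.eval_add, Polynomial.eval_C, Polynomial.eval_one]
    induction k generalizing s with
    | zero => simpa using (Exec.skip s).runs
    | succ k ih =>
      have := (Exec.inc v s).runs.seq (ih (s := { s with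
        reg := Function.update s.reg v (s.reg v + 1) }) ha)
      simp only [List.replicate_succ, List.foldr_cons]
      convert this.mono (T' := k + 1 + 1) (by omega) using 2
      simp [add_assoc, add_comm 1]
  | len =>
    have := (runs_scan_inc v s).seq (runs_restore _)
    refine Runs.mono (T := 2 * s.inp.length + 1 + (s.inp.length + 1)) ?_
      (by simp [time]; omega)
    simpa [ha, eval, addTo] using this
  | add e e' ih ih' =>
    have h1 := ih he.1 hdv hvf hz ha hm hx
    have h2 := ih' he.2 (s := { s with
      reg := Function.update s.reg v (s.reg v + e.eval s.inp s.reg) }) hdv hvf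
      (fun r hr => by simp [Function.update_of_ne (show r ≠ v by omega), hz r hr]) ha
      (fun r hr => by simp [Function.update_of_ne (show r ≠ v by omega), hm r hr]) hx
    have h3 : e'.eval s.inp (Function.update s.reg v (s.reg v + e.eval s.inp s.reg)) =
        e'.eval s.inp s.reg :=
      eval_congr (fun r hr => by simp [Function.update_of_ne (show r ≠ v by omega)]) he.2
    refine (h1.seq h2).congr rfl (Store.reg_congr fun r => ?_) (by simp [time])
    simp [h3, eval, add_assoc]
  | mul e e' ih ih' =>
    have h1 := ih he.1 (v := f) (f := f + 1) (s := s) (by omega) (by omega)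
      (fun r hr => hz r (by omega)) ha hm hx
    -- With `k` rounds left, the second factor has been added `e.eval - k` times.
    have h2 := Runs.loop (r := f) (n := e.eval s.inp s.reg) (p := e'.addTo v (f + 1))
      (T := e'.time.eval m) (fun k => { s with
        reg := Function.update (Function.update s.reg v
          (s.reg v + (e.eval s.inp s.reg - k) * e'.eval s.inp s.reg)) f k })
      (by simp) (fun k hk => ⟨by simp, ?_⟩)
    · refine (h1.seq (h2.congr (Store.reg_congr fun r => ?_) rfl le_rfl)).congr rfl
        (Store.reg_congr fun r => ?_) ?_
      · simp only [Function.update_apply, hz f le_rfl, Nat.sub_self, zero_mul]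
        split_ifs with h3 h4
        · omega
        · rw [h4, Nat.add_zero]
        · rfl
      · simp only [Function.update_apply, eval, Nat.sub_zero]
        split_ifs with h3 h4 h4
        · omega
        · rw [h3, hz f le_rfl]
        · rfl
        · rfl
      · have := Nat.mul_le_mul_right (e'.time.eval m + 1) (eval_le_bound hm hx he.1)
        simp only [time, Polynomial.eval_add, Polynomial.eval_mul, Polynomial.eval_one]
        omega
    · set g := Function.update s.reg v
        (s.reg v + (e.eval s.inp s.reg - (k + 1)) * e'.eval s.inp s.reg) with hg
      have h3 := ih' he.2 (v := v) (f := f + 1)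
        (s := { s with reg := Function.update (Function.update g f (k + 1)) f k }) hdv (by omega)
        (fun r hr => by
          simp [hg, show r ≠ v by omega, show r ≠ f by omega]
          exact hz r (by omega)) ha
        (fun r hr => by
          simpa [hg, Function.update_apply, show r ≠ v by omega, show r ≠ f by omega]
            using hm r hr) hx
      have h4 : e'.eval s.inp (Function.update (Function.update g f (k + 1)) f k) =
          e'.eval s.inp s.reg :=
        eval_congr (fun r hr => by
          simp [hg, show r ≠ v by omega, show r ≠ f by omega]) he.2
      refine h3.congr rfl (Store.reg_congr fun r => ?_) le_rfl
      have h5 : e.eval s.inp s.reg - k = e.eval s.inp s.reg - (k + 1) + 1 := by omega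
      dsimp only
      rw [h4]
      simp only [hg, Function.update_apply, h5, Nat.succ_mul]
      clear ih ih' h1 h3 h4
      split_ifs <;> omega

end Ex
/-! ### Word generators -/

/-- Programs that generate words. The variables of a generator that occurs within `d` loops
are `0, …, d - 1`. -/
inductive Gen
  | emit (w : List Γ')
  | seq (g h : Gen)
  /-- the words for all values of a new variable below the value of `e` -/
  | loop (e : Ex) (g : Gen)
  | ifEq (e e' : Ex) (g h : Gen)
  /-- continue depending on the input symbol at the position given by `e` -/
  | caseBit (e : Ex) (g : Option Bool → Gen)

namespace Gen

/-- The word generated from an input and values of the variables. -/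
def denote (x : List Bool) : Gen → ℕ → (ℕ → ℕ) → List Γ'
  | emit w, _, _ => w
  | seq g h, d, env => g.denote x d env ++ h.denote x d env
  | loop e g, d, env =>
    (List.range (e.eval x env)).flatMap fun k => g.denote x (d + 1) (Function.update env d k)
  | ifEq e e' g h, d, env =>
    if e.eval x env = e'.eval x env then g.denote x d env else h.denote x d env
  | caseBit e g, d, env => (g x[e.eval x env]?).denote x d env

/-- The variables are as they should be within `d` loops. -/
def Closed : Gen → ℕ → Prop
  | emit _, _ => True
  | seq g h, d => g.Closed d ∧ h.Closed d
  | loop e g, d => e.Closed d ∧ g.Closed (d + 1)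
  | ifEq e e' g h, d => e.Closed d ∧ e'.Closed d ∧ g.Closed d ∧ h.Closed d
  | caseBit e g, d => e.Closed d ∧ ∀ o, (g o).Closed d

/-- The program that outputs the generated word. -/
def compile : Gen → ℕ → Cmd
  | emit w, _ => (w.map Cmd.emit).foldr (fun c p => p.seq c) .skip
  -- The output is a stack, so words are produced from their end: the second part comes first, and
  -- loops run through their values downwards.
  | seq g h, d => (h.compile d).seq (g.compile d)
  | loop e g, d => (e.addTo d (d + 1)).seq (.loop d (g.compile (d + 1)))
  | ifEq e e' g h, d =>
    ((e.addTo d (d + 1)).seq (e'.addTo (d + 1) (d + 2))).seq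
      (((Cmd.loop d (.ifReg (d + 1) .skip (.inc (d + 2)))).seq
        (Cmd.loop (d + 1) (.inc (d + 2)))).seq
          -- Counter `d + 2` holds the distance of the two values. If it is positive, what `ifReg`
          -- leaves of it has to be cleared before `h` may use it.
          (.ifReg (d + 2) ((Cmd.loop (d + 2) .skip).seq (h.compile d)) (g.compile d)))
  | caseBit e g, d =>
    ((e.addTo d (d + 1)).seq (.loop d (.popIn fun o => o.elim Cmd.skip Cmd.save))).seq
      (.popIn fun o => ((o.elim Cmd.skip Cmd.save).seq .restore).seq ((g o).compile d))

/-- A bound for the time to generate a word. -/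
noncomputable def time : Gen → Polynomial ℕ
  | emit w => .C w.length + 1
  | seq g h => h.time + g.time
  -- The new variable is bounded by the value of `e` and not by `m`, so the body is charged for `m +
  -- e.bound`.
  | loop e g => e.time + (e.bound * (g.time.comp (.X + e.bound) + 1) + 1)
  | ifEq e e' g h =>
    e.time + e'.time + (3 * e.bound + 1 + (2 * e'.bound + 1) +
      (2 + 2 * (e.bound + e'.bound) + (g.time + h.time)))
  | caseBit e g =>
    e.time + (3 * e.bound + 1) + (1 + (1 + (.X + 1) + ((g none).time + ((g (some true)).time +
      (g (some false)).time))))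

theorem runs_emit (w : List Γ') (d : ℕ) (s : Store) :
    Runs ((emit w).compile d) s { s with out := w ++ s.out } (w.length + 1) := by
  simp only [compile]
  induction w with
  | nil => exact (Exec.skip s).runs
  | cons a w ih =>
    exact (ih.seq (Exec.emit a _).runs).congr rfl rfl (by simp)

/-- The sum of the two truncated differences vanishes exactly if the counters agree; this is the
equality test behind `ifEq`. -/
theorem runs_diff {u v f : ℕ} (huv : u ≠ v) (huf : u ≠ f) (hvf : v ≠ f) (s : Store)
    (hf : s.reg f = 0) :
    Runs ((Cmd.loop u (.ifReg v .skip (.inc f))).seq (Cmd.loop v (.inc f))) s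
      { s with
        reg := Function.update (Function.update (Function.update s.reg u 0) v 0) f
          (s.reg u - s.reg v + (s.reg v - s.reg u)) } (s.reg u * 3 + 1 + (s.reg v * 2 + 1)) := by
  have h := Runs.loop (r := u) (n := s.reg u) (p := .ifReg v .skip (.inc f)) (T := 2)
    (fun k => { s with
      reg := Function.update (Function.update (Function.update s.reg u k)
        v (s.reg v - (s.reg u - k))) f (s.reg u - k - s.reg v) })
    (by simp [huf, huv]) (fun k hk => ⟨by
      simp [huf, huv], ?_⟩)
  · refine (h.seq (runs_loop_inc hvf _)).congr (Store.reg_congr fun r => ?_)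
      (Store.reg_congr fun r => ?_) ?_
    · simp only [Function.update_apply]
      split_ifs <;> simp_all
    · simp only [Function.update_apply, if_neg hvf, if_true]
      split_ifs <;> omega
    · simp only [Function.update_apply, if_neg hvf, if_true]
      omega
  · rcases hc : s.reg v - (s.reg u - (k + 1)) with _ | j
    · refine (Runs.ifReg_zero (by simp [hvf, huv.symm])
        (Exec.inc f _).runs).congr rfl (Store.reg_congr fun r => ?_) le_rfl
      simp only [Function.update_apply]
      split_ifs <;> omega
    · refine (Runs.ifReg_pos (k := j) (by simp [hvf, huv.symm])
        (Exec.skip _).runs).congr rfl (Store.reg_congr fun r => ?_) le_rfl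
      simp only [Function.update_apply]
      split_ifs <;> omega

/-- Popping an empty input yields `none` and saves nothing, so positions past the end of the input
do no harm. -/
theorem runs_scanTo {d : ℕ} (s : Store) (ha : s.aux = []) :
    Runs (.loop d (.popIn fun o => o.elim Cmd.skip Cmd.save)) s
      { s with inp := s.inp.drop (s.reg d), aux := (s.inp.take (s.reg d)).reverse,
               reg := Function.update s.reg d 0 } (s.reg d * 3 + 1) := by
  have h := Runs.loop (r := d) (n := s.reg d) (p := .popIn fun o => o.elim Cmd.skip Cmd.save) (T := 2)
    (fun k => { s with
      inp := s.inp.drop (s.reg d - k)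
      aux := (s.inp.take (s.reg d - k)).reverse
      reg := Function.update s.reg d k })
    (by simp) (fun k hk => ⟨by simp, ?_⟩)
  · refine h.congr (Store.ext ?_ ?_ rfl ?_) rfl le_rfl <;> simp [ha]
  · have h5 : s.reg d - k = s.reg d - (k + 1) + 1 := by omega
    simp only [h5]
    refine Runs.mono (T := 1 + 1) (Runs.popIn ?_) le_rfl
    rcases hc : s.inp[s.reg d - (k + 1)]? with _ | b
    · rw [List.getElem?_eq_none_iff] at hc
      simp only [List.drop_eq_nil_of_le hc, List.take_of_length_le hc, List.head?_nil,
        List.drop_eq_nil_of_le (hc.trans (Nat.le_succ _)),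
        List.take_of_length_le (hc.trans (Nat.le_succ _))]
      exact (Exec.skip _).runs.congr rfl (by simp) le_rfl
    · rw [List.head?_drop, hc]
      exact (Exec.save b _).runs.congr rfl (by
        simp [List.take_add_one, hc]) le_rfl

/-- The invariant is that a compiled generator changes nothing but the output, to which it prepends
its word; hence generators can be nested freely. -/
theorem runs (g : Gen) {d m : ℕ} (hg : g.Closed d) {s : Store} (hz : ∀ r ≥ d, s.reg r = 0)
    (ha : s.aux = []) (hm : ∀ r < d, s.reg r ≤ m) (hx : s.inp.length ≤ m) :
    Runs (g.compile d) s { s with out := g.denote s.inp d s.reg ++ s.out } (g.time.eval m) := by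
  induction g generalizing d m s with
  | emit w => exact (runs_emit w d s).congr rfl rfl (by simp [time])
  | seq g h ihg ihh =>
    refine ((ihh hg.2 hz ha hm hx).seq (ihg (s := { s with
      out := h.denote s.inp d s.reg ++ s.out }) hg.1 hz ha hm hx)).congr rfl ?_ ?_
    · simp [denote]
    · simp [time]
  | loop e g ih =>
    have h1 := e.runs hg.1 (v := d) (f := d + 1) le_rfl (by omega)
      (fun r hr => hz r (by omega)) ha hm hx
    have h0 := hz d le_rfl
    have hE := Ex.eval_le_bound hm hx hg.1
    -- When the counter is `k`, the words for `k, …, e.eval - 1` are already on the output.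
    have h2 := Runs.loop (r := d) (n := e.eval s.inp s.reg) (p := g.compile (d + 1))
      (T := g.time.eval (m + e.bound.eval m)) (fun k => { s with
        out := ((List.range' k (e.eval s.inp s.reg - k)).flatMap fun k =>
          g.denote s.inp (d + 1) (Function.update s.reg d k)) ++ s.out
        reg := Function.update s.reg d k })
      (by simp) (fun k hk => ⟨by simp, ?_⟩)
    · refine (h1.seq (h2.congr ?_ rfl le_rfl)).congr rfl ?_ ?_
      · simp [h0]
      · have : Function.update s.reg d 0 = s.reg := by rw [← h0, Function.update_eq_self]
        simp [denote, this, List.range_eq_range']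
      · have := Nat.mul_le_mul_right (g.time.eval (m + e.bound.eval m) + 1) hE
        simp [time]
        omega
    · have h3 := ih (d := d + 1) (m := m + e.bound.eval m) hg.2 (s := { s with
        out := ((List.range' (k + 1) (e.eval s.inp s.reg - (k + 1))).flatMap fun k =>
          g.denote s.inp (d + 1) (Function.update s.reg d k)) ++ s.out
        reg := Function.update s.reg d k })
        (fun r hr => by simp [show r ≠ d by omega, hz r (by omega)]) ha
        (fun r hr => by
          simp only [Function.update_apply]
          split_ifs with h
          · omega
          · have := hm r (by omega)
            omega) (by simp; omega)
      have h5 : e.eval s.inp s.reg - k = e.eval s.inp s.reg - (k + 1) + 1 := by omega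
      refine h3.congr (by simp) ?_ le_rfl
      simp [h5, List.range'_succ]
  | ifEq e e' g h ihg ihh =>
    have h0 := hz d le_rfl
    have h0' := hz (d + 1) (by omega)
    have h0'' := hz (d + 2) (by omega)
    have h1 := e.runs hg.1 (v := d) (f := d + 1) le_rfl (by omega)
      (fun r hr => hz r (by omega)) ha hm hx
    have h2 := e'.runs hg.2.1 (v := d + 1) (f := d + 2) (s := { s with
      reg := Function.update s.reg d (s.reg d + e.eval s.inp s.reg) }) (by omega) (by omega)
      (fun r hr => by simp [show r ≠ d by omega, hz r (by omega)]) ha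
      (fun r hr => by simp [show r ≠ d by omega, hm r hr]) hx
    have hE := Ex.eval_le_bound hm hx hg.1
    have hE' := Ex.eval_le_bound hm hx hg.2.1
    have he' : e'.eval s.inp (Function.update s.reg d (e.eval s.inp s.reg)) =
        e'.eval s.inp s.reg :=
      Ex.eval_congr (fun r hr => by simp [Function.update_of_ne (show r ≠ d by omega)]) hg.2.1
    have h3 := runs_diff (u := d) (v := d + 1) (f := d + 2) (by omega) (by omega) (by omega)
      { s with
        reg := Function.update (Function.update s.reg d (e.eval s.inp s.reg))
          (d + 1) (e'.eval s.inp s.reg) }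
      (by simpa [Function.update_apply] using h0'')
    have h4 := (h1.seq h2).congr (T' := e.time.eval m + e'.time.eval m)
      (u' := { s with
        reg := Function.update (Function.update s.reg d (e.eval s.inp s.reg))
          (d + 1) (e'.eval s.inp s.reg) }) rfl (by
        simp only [h0, Nat.zero_add, Function.update_of_ne (show d + 1 ≠ d by omega), h0', he'])
        le_rfl
    set E := e.eval s.inp s.reg with hE1
    set E' := e'.eval s.inp s.reg with hE1'
    have h5 := h3.congr (T' := 3 * e.bound.eval m + 1 + (2 * e'.bound.eval m + 1))
      (u' := { s with reg := Function.update s.reg (d + 2) (E - E' + (E' - E)) }) rfl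
      (Store.reg_congr fun r => by
        simp only [Function.update_apply, if_true, show d ≠ d + 1 by omega, if_false]
        split_ifs <;> first | rfl | omega | simp_all only) (by
        simp only [Function.update_apply, if_true, show d ≠ d + 1 by omega, if_false]
        omega)
    have h6 : Runs (.ifReg (d + 2) ((Cmd.loop (d + 2) .skip).seq (h.compile d)) (g.compile d))
        { s with reg := Function.update s.reg (d + 2) (E - E' + (E' - E)) }
        { s with out := (ifEq e e' g h).denote s.inp d s.reg ++ s.out }
        (2 + 2 * (e.bound.eval m + e'.bound.eval m) + (g.time.eval m + h.time.eval m)) := by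
      have hu : Function.update s.reg (d + 2) 0 = s.reg := by
        rw [← h0'', Function.update_eq_self]
      by_cases hEE : E = E'
      · refine (Runs.ifReg_zero h0'' (ihg hg.2.2.1 hz ha hm hx)).congr ?_ ?_ (by omega)
        · simp only [hEE, Nat.sub_self, hu]
        · simp only [denote, ← hE1, ← hE1', if_pos hEE]
      · obtain ⟨k, hk⟩ : ∃ k, E - E' + (E' - E) = k + 1 := ⟨E - E' + (E' - E) - 1, by omega⟩
        rw [hk]
        have h7 := (runs_loop_skip (d + 2) { s with
          reg := Function.update (Function.update s.reg (d + 2) (k + 1)) (d + 2) k }).congr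
          (u' := s) rfl (Store.ext rfl rfl rfl (by simp [hu])) le_rfl
        refine (Runs.ifReg_pos (k := k) (by simp)
          (h7.seq (ihh hg.2.2.2 hz ha hm hx))).congr rfl ?_ ?_
        · simp only [denote, ← hE1, ← hE1', if_neg hEE]
        · simp
          omega
    refine (h4.seq (h5.seq h6)).congr rfl rfl ?_
    simp [time]
  | caseBit e g ih =>
    have h0 := hz d le_rfl
    have h1 := e.runs hg.1 (v := d) (f := d + 1) le_rfl (by omega)
      (fun r hr => hz r (by omega)) ha hm hx
    have hE := Ex.eval_le_bound hm hx hg.1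
    rw [h0, Nat.zero_add] at h1
    have hu : Function.update s.reg d 0 = s.reg := by rw [← h0, Function.update_eq_self]
    have h2 := h1.seq (runs_scanTo (d := d) _ ha)
    simp only [Function.update_self, Function.update_idem, hu] at h2
    set i := e.eval s.inp s.reg with hi
    have h3 := ih s.inp[i]? (hg.2 _) hz ha hm hx
    have ht : (g s.inp[i]?).time.eval m ≤ (g none).time.eval m + ((g (some true)).time.eval m +
        (g (some false)).time.eval m) := by
      rcases s.inp[i]? with _ | _ | _ <;> omega
    have h4 : Runs (.popIn fun o => ((o.elim Cmd.skip Cmd.save).seq .restore).seq ((g o).compile d))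
        { s with inp := s.inp.drop i, aux := (s.inp.take i).reverse }
        { s with out := (g s.inp[i]?).denote s.inp d s.reg ++ s.out }
        (1 + (1 + (m + 1) + (g s.inp[i]?).time.eval m)) := by
      refine Runs.popIn ?_
      rw [List.head?_drop]
      refine Runs.seq ?_ h3
      rcases hc : s.inp[i]? with _ | b
      · rw [List.getElem?_eq_none_iff] at hc
        refine ((Exec.skip _).runs.seq (runs_restore _)).congr rfl ?_ ?_
        · refine Store.ext ?_ ha.symm rfl rfl
          simp [List.drop_eq_nil_of_le hc, List.take_of_length_le hc]
        · simp
          omega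
      · refine ((Exec.save b _).runs.seq (runs_restore _)).congr rfl ?_ ?_
        · have : s.inp = s.inp.take i ++ b :: s.inp.drop (i + 1) := by
            obtain ⟨hl, rfl⟩ := List.getElem?_eq_some_iff.1 hc
            rw [List.cons_getElem_drop_succ, List.take_append_drop]
          refine Store.ext ?_ ha.symm rfl rfl
          simpa using this.symm
        · have := (List.getElem?_eq_some_iff.1 hc).1
          simp
          omega
    refine (h2.seq h4).congr rfl (by simp [denote, hi]) ?_
    simp [time]
    omega

/-- A function is computable in polynomial time if a generator generates its values. -/
theorem computableInPolyTime {I : Type} {enc : I → List Γ'} {f : List Bool → I} (g : Gen)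
    (hg : g.Closed 0) (h : ∀ x, g.denote x 0 (fun _ => 0) = enc (f x)) :
    Nonempty (TM2ComputableInPolyTime (encodingList Bool).encode enc f) := by
  -- Generators preserve the input, whereas only the output stack may be non-empty at the end.
  refine Cmd.computableInPolyTime ((g.compile 0).seq .clearIn) (g.time + (.X + 1)) fun x => ?_
  have h1 := g.runs (m := x.length) hg (s := ⟨x, [], [], fun _ => 0⟩) (fun _ _ => rfl) rfl
    (fun _ _ => Nat.zero_le _) le_rfl
  refine (h1.seq (runs_clearIn _)).congr rfl ?_ ?_
  · simp [h]
  · simp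

end Gen
end SinkEquilibria

namespace SinkEquilibria
open Computability Turing

/-! ### Functions generated in polynomial time -/

/-- Types of values for the variables of a generator. -/
class Context (α : Type) where
  /-- number of variables -/
  depth : ℕ
  /-- the values of the variables -/
  env : α → ℕ → ℕ

instance : Context Unit := ⟨0, fun _ _ => 0⟩

/-- Entering a loop appends one variable, stored at the index equal to the previous depth. -/
instance {α : Type} [Context α] : Context (α × ℕ) :=
  ⟨Context.depth α + 1, fun p => Function.update (Context.env p.1) (Context.depth α) p.2⟩

section
variable {α : Type} [Context α]

/-- The word `F x a` is given by a generator. -/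
def Generated (F : List Bool → α → List Γ') : Prop :=
  ∃ g : Gen, g.Closed (Context.depth α) ∧
    ∀ x a, g.denote x (Context.depth α) (Context.env a) = F x a

/-- The number `e x a` is given by an expression. -/
def IsExpr (e : List Bool → α → ℕ) : Prop :=
  ∃ E : Ex, E.Closed (Context.depth α) ∧ ∀ x a, E.eval x (Context.env a) = e x a

/-- The number `N x` is given by an expression without variables. -/
def IsClosedExpr (N : List Bool → ℕ) : Prop :=
  ∃ E : Ex, E.Closed 0 ∧ ∀ x env, E.eval x env = N x

/-- Generators can decide `b x a`. -/
def IsTest (b : List Bool → α → Bool) : Prop :=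
  ∀ F G : List Bool → α → List Γ', Generated F → Generated G →
    Generated fun x a => if b x a then F x a else G x a

/-- `π` is the value of one of the variables. -/
def IsVariable (π : α → ℕ) : Prop :=
  ∃ i < Context.depth α, ∀ a, Context.env a i = π a

theorem IsVariable.last : IsVariable fun p : α × ℕ => p.2 :=
  ⟨Context.depth α, Nat.lt_succ_self _, fun a => by simp [Context.env]⟩

theorem IsVariable.fst {π : α → ℕ} (h : IsVariable π) : IsVariable fun p : α × ℕ => π p.1 :=
  let ⟨i, hi, he⟩ := h
  ⟨i, Nat.lt_succ_of_lt hi, fun a => by simp [Context.env, hi.ne, he]⟩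

theorem IsExpr.var {π : α → ℕ} (h : IsVariable π) : IsExpr fun _ a => π a :=
  let ⟨i, hi, he⟩ := h
  ⟨.var i, hi, fun _ a => he a⟩

theorem IsExpr.const (k : ℕ) : IsExpr fun _ (_ : α) => k :=
  ⟨.const k, trivial, fun _ _ => rfl⟩

theorem IsExpr.add {e e' : List Bool → α → ℕ} (h : IsExpr e) (h' : IsExpr e') :
    IsExpr fun x a => e x a + e' x a :=
  let ⟨E, hE, he⟩ := h
  let ⟨E', hE', he'⟩ := h'
  ⟨.add E E', ⟨hE, hE'⟩, fun x a => by simp [Ex.eval, he, he']⟩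

theorem IsExpr.mul {e e' : List Bool → α → ℕ} (h : IsExpr e) (h' : IsExpr e') :
    IsExpr fun x a => e x a * e' x a :=
  let ⟨E, hE, he⟩ := h
  let ⟨E', hE', he'⟩ := h'
  ⟨.mul E E', ⟨hE, hE'⟩, fun x a => by simp [Ex.eval, he, he']⟩

theorem Ex.Closed.mono {d d' : ℕ} (h : d ≤ d') : ∀ {e : Ex}, e.Closed d → e.Closed d'
  | .var _, he => lt_of_lt_of_le he h
  | .const _, _ | .len, _ => trivial
  | .add _ _, he => ⟨he.1.mono h, he.2.mono h⟩
  | .mul _ _, he => ⟨he.1.mono h, he.2.mono h⟩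

theorem IsClosedExpr.isExpr {N : List Bool → ℕ} (h : IsClosedExpr N) :
    IsExpr fun x (_ : α) => N x :=
  let ⟨E, hE, he⟩ := h
  ⟨E, hE.mono (Nat.zero_le _), fun x _ => he x _⟩

theorem IsClosedExpr.const (k : ℕ) : IsClosedExpr fun _ => k :=
  ⟨.const k, trivial, fun _ _ => rfl⟩

theorem IsClosedExpr.length : IsClosedExpr fun x => x.length :=
  ⟨.len, trivial, fun _ _ => rfl⟩

theorem IsClosedExpr.add {N N' : List Bool → ℕ} (h : IsClosedExpr N) (h' : IsClosedExpr N') :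
    IsClosedExpr fun x => N x + N' x :=
  let ⟨E, hE, he⟩ := h
  let ⟨E', hE', he'⟩ := h'
  ⟨.add E E', ⟨hE, hE'⟩, fun x a => by simp [Ex.eval, he, he']⟩

theorem IsClosedExpr.mul {N N' : List Bool → ℕ} (h : IsClosedExpr N) (h' : IsClosedExpr N') :
    IsClosedExpr fun x => N x * N' x :=
  let ⟨E, hE, he⟩ := h
  let ⟨E', hE', he'⟩ := h'
  ⟨.mul E E', ⟨hE, hE'⟩, fun x a => by simp [Ex.eval, he, he']⟩

theorem IsClosedExpr.polynomial (p : Polynomial ℕ) : IsClosedExpr fun x => p.eval x.length := by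
  induction p using Polynomial.induction_on with
  | C a => simpa using IsClosedExpr.const a
  | add p q hp hq => simpa using hp.add hq
  | monomial n a ih =>
    convert ih.mul .length using 2
    simp [pow_succ, mul_assoc]

theorem Generated.word (w : List Γ') : Generated fun _ (_ : α) => w :=
  ⟨.emit w, trivial, fun _ _ => rfl⟩

theorem Generated.append {F G : List Bool → α → List Γ'} (h : Generated F) (h' : Generated G) :
    Generated fun x a => F x a ++ G x a :=
  let ⟨f, hf, hF⟩ := h
  let ⟨g, hg, hG⟩ := h'
  ⟨.seq f g, ⟨hf, hg⟩, fun x a => by simp [Gen.denote, hF, hG]⟩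

theorem Generated.cons {F : List Bool → α → List Γ'} (h : Generated F) (c : Γ') :
    Generated fun x a => c :: F x a :=
  (Generated.word [c]).append h

theorem Generated.range {e : List Bool → α → ℕ} {F : List Bool → α → ℕ → List Γ'}
    (he : IsExpr e) (h : Generated fun x (p : α × ℕ) => F x p.1 p.2) :
    Generated fun x a => (List.range (e x a)).flatMap fun i => F x a i :=
  let ⟨E, hE, he⟩ := he
  let ⟨f, hf, hF⟩ := h
  ⟨.loop E f, ⟨hE, hf⟩, fun x a => by
    simp only [Gen.denote, he]
    exact congrArg (List.flatMap · _) (funext fun i => hF x (a, i))⟩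

theorem Generated.list {ι : Type} (l : List ι) {F : ι → List Bool → α → List Γ'}
    (h : ∀ i, Generated (F i)) : Generated fun x a => l.flatMap fun i => F i x a := by
  induction l with
  | nil => exact Generated.word []
  | cons i l ih => simpa using (h i).append ih

theorem Generated.ite {b : List Bool → α → Bool} (hb : IsTest b) {F G : List Bool → α → List Γ'}
    (h : Generated F) (h' : Generated G) : Generated fun x a => if b x a then F x a else G x a :=
  hb F G h h'

theorem Generated.index {e : List Bool → α → ℕ} (he : IsExpr e) :
    Generated fun x a => encIndex (e x a) := by
  have : (fun x a => encIndex (e x a)) = fun x a =>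
      ((List.range (e x a)).flatMap fun _ => [Γ'.bit true]) ++ [Γ'.blank] := by
    funext x a
    simp only [encIndex, ← List.map_eq_flatMap]
    simp
  rw [this]
  exact (Generated.range he (.word _)).append (.word _)

theorem IsTest.const (b : Bool) : IsTest fun _ (_ : α) => b := by
  intro F G hF hG
  cases b
  · simpa using hG
  · simpa using hF

/-- Branches are nested and a generator is duplicated, so no truth value is ever computed. The
number of copies does not depend on the input. -/
theorem IsTest.and {b b' : List Bool → α → Bool} (h : IsTest b) (h' : IsTest b') :
    IsTest fun x a => b x a && b' x a := by
  intro F G hF hG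
  convert h _ _ (h' _ _ hF hG) hG using 3
  rename_i x a
  cases hb : b x a <;> simp [hb]

theorem IsTest.or {b b' : List Bool → α → Bool} (h : IsTest b) (h' : IsTest b') :
    IsTest fun x a => b x a || b' x a := by
  intro F G hF hG
  convert h _ _ hF (h' _ _ hF hG) using 3
  rename_i x a
  cases hb : b x a <;> simp [hb]

theorem IsTest.not {b : List Bool → α → Bool} (h : IsTest b) : IsTest fun x a => !b x a := by
  intro F G hF hG
  convert h _ _ hG hF using 3
  rename_i x a
  cases hb : b x a <;> simp [hb]

theorem IsTest.eq {e e' : List Bool → α → ℕ} (h : IsExpr e) (h' : IsExpr e') :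
    IsTest fun x a => decide (e x a = e' x a) := by
  rintro F G ⟨f, hf, hF⟩ ⟨g, hg, hG⟩
  obtain ⟨E, hE, he⟩ := h
  obtain ⟨E', hE', he'⟩ := h'
  exact ⟨.ifEq E E' f g, ⟨hE, hE', hf, hg⟩, fun x a => by simp [Gen.denote, he, he', hF, hG]⟩

/-- The only way in which the symbols of the input, as opposed to its length, enter an instance. -/
theorem IsTest.bit {e : List Bool → α → ℕ} (he : IsExpr e) (b : Option Bool → Bool) :
    IsTest fun x a => b x[e x a]? := by
  rintro F G ⟨f, hf, hF⟩ ⟨g, hg, hG⟩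
  obtain ⟨E, hE, he⟩ := he
  refine ⟨.caseBit E fun o => if b o then f else g, ⟨hE, fun o => ?_⟩, fun x a => ?_⟩
  · cases hb : b o <;> simp [hb, hf, hg]
  · simp only [Gen.denote, he]
    split_ifs
    exacts [hF x a, hG x a]

end

theorem Generated.computableInPolyTime {I : Type} {enc : I → List Γ'} {f : List Bool → I}
    (h : Generated fun x (_ : Unit) => enc (f x)) :
    Nonempty (TM2ComputableInPolyTime (encodingList Bool).encode enc f) :=
  let ⟨g, hg, hf⟩ := h
  g.computableInPolyTime hg fun x => hf x ()

/-! ### Encodings of lists -/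

/-- The entries of an encoded list. -/
def encEntries {α : Type} (e : α → List Γ') (l : List α) : List Γ' :=
  l.flatMap fun a => Γ'.comma :: e a

theorem encList_eq {α : Type} (e : α → List Γ') (l : List α) :
    encList e l = encEntries e l ++ [Γ'.ket] := by
  induction l with
  | nil => rfl
  | cons a l ih => simp [encList, ih, encEntries]

theorem encFamily_eq {α : Type} (e : α → List Γ') {n : ℕ} (f : Fin n → α) :
    encFamily e f = ((List.finRange n).flatMap fun i => Γ'.comma :: e (f i)) ++ [Γ'.ket] := by
  rw [encFamily, encList_eq, encEntries, List.ofFn_eq_map, List.flatMap_map]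

section
variable {α β : Type} (e : α → List Γ')

theorem encEntries_append (l l' : List α) :
    encEntries e (l ++ l') = encEntries e l ++ encEntries e l' :=
  List.flatMap_append

theorem encEntries_flatMap (l : List β) (f : β → List α) :
    encEntries e (l.flatMap f) = l.flatMap fun b => encEntries e (f b) :=
  List.flatMap_assoc

theorem encEntries_map (l : List β) (f : β → α) :
    encEntries e (l.map f) = l.flatMap fun b => Γ'.comma :: e (f b) :=
  List.flatMap_map ..

theorem encEntries_singleton (a : α) : encEntries e [a] = Γ'.comma :: e a := by
  simp [encEntries]

theorem encEntries_pair (a b : α) :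
    encEntries e [a, b] = Γ'.comma :: e a ++ Γ'.comma :: e b := by
  simp [encEntries]

end

theorem finRange_flatMap {β : Type} {n : ℕ} (g : ℕ → List β) {f : Fin n → List β}
    (h : ∀ i, f i = g i) : (List.finRange n).flatMap f = (List.range n).flatMap g := by
  rw [show f = fun i : Fin n => g i from funext h, ← List.map_coe_finRange_eq_range,
    List.flatMap_map]

/-- `finProdFinEquiv` numbers pairs lexicographically, so a family indexed by a product can be
written by nested loops. -/
theorem finRange_mul_flatMap {β : Type} {m n : ℕ} (f : Fin (m * n) → List β) :
    (List.finRange (m * n)).flatMap f =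
      (List.finRange m).flatMap fun i => (List.finRange n).flatMap fun j =>
        f (finProdFinEquiv (i, j)) := by
  have : List.finRange (m * n) = (List.finRange m).flatMap fun i =>
      (List.finRange n).map fun j => finProdFinEquiv (i, j) := by
    have h := List.ofFn_mul (m := m) (n := n) (fun i => i)
    rw [List.ofFn_eq_map, List.map_id'] at h
    rw [h, List.flatMap_def, List.ofFn_eq_map]
    refine congrArg List.flatten (List.map_congr_left fun i _ => ?_)
    rw [List.ofFn_eq_map]
    refine List.map_congr_left fun j _ => Fin.ext ?_
    simp [finProdFinEquiv, mul_comm, add_comm]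
  rw [this, List.flatMap_assoc]
  simp [List.flatMap_map]

end SinkEquilibria

namespace SinkEquilibria
open Relation

/-! ### Existence of non-singleton sinks -/

namespace StrategicGame

variable {n : ℕ} {G : StrategicGame n}

theorem Arc.ne {S S' : G.State} (h : G.Arc S S') : S ≠ S' := by
  rintro rfl
  obtain ⟨i, -, hi⟩ := h
  exact lt_irrefl _ hi

theorem arc_update {S : G.State} {i : Fin n} {a : G.Strat i}
    (h : G.utility i S < G.utility i (Function.update S i a)) :
    G.Arc S (Function.update S i a) :=
  ⟨i, fun _ hj => Function.update_of_ne hj _ _, h⟩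

theorem Arc.eq_update {S S' : G.State} (h : G.Arc S S') :
    ∃ i, S' = Function.update S i (S' i) ∧ G.utility i S < G.utility i S' := by
  obtain ⟨i, h1, h2⟩ := h
  refine ⟨i, funext fun j => ?_, h2⟩
  by_cases hj : j = i
  · subst hj
    simp
  · rw [Function.update_of_ne hj, h1 j hj]

/-- The players are adjusted one after the other. `P x` concerns only the strategy of `x`, so later
adjustments cannot spoil it, while `I` provides what each adjustment needs. -/
theorem exists_reaches_forall {I : G.State → Prop} {P : ∀ x, G.Strat x → Prop}
    (h : ∀ S, I S → ∀ x, ∃ t, ReflTransGen G.Arc S (Function.update S x t) ∧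
      I (Function.update S x t) ∧ P x t) (S : G.State) (hS : I S) :
    ∃ S', ReflTransGen G.Arc S S' ∧ I S' ∧ ∀ x, P x (S' x) := by
  classical
  suffices ∀ A : Finset (Fin n), ∃ S', ReflTransGen G.Arc S S' ∧ I S' ∧ ∀ x ∈ A, P x (S' x) by
    simpa using this Finset.univ
  intro A
  induction A using Finset.induction_on with
  | empty => exact ⟨S, .refl, hS, by simp⟩
  | insert x A _ ih =>
    obtain ⟨S', h1, h2, h3⟩ := ih
    obtain ⟨t, h4, h5, h6⟩ := h S' h2 x
    refine ⟨_, h1.trans h4, h5, fun z hz => ?_⟩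
    by_cases hzx : z = x
    · subst hzx
      simpa using h6
    · simpa [hzx] using h3 z ((Finset.mem_insert.1 hz).resolve_left hzx)

theorem mem_of_reaches {T : Set G.State} (hT : ∀ S ∈ T, ∀ S', G.Arc S S' → S' ∈ T)
    {S S' : G.State} (hS : S ∈ T) (h : ReflTransGen G.Arc S S') : S' ∈ T := by
  induction h with
  | refl => exact hS
  | tail _ h ih => exact hT _ ih _ h

/-- Take a state reachable from `S₀` whose set of reachable states is smallest. Every state in that
set reaches all of it, so the set is a sink, and an arc leaving the chosen state leads to a second
element. -/
theorem hasNonSingletonSink_of_forall_exists_arc [Finite G.State] (S₀ : G.State)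
    (h : ∀ S, ReflTransGen G.Arc S₀ S → ∃ S', G.Arc S S') : G.HasNonSingletonSink := by
  let R : G.State → Set G.State := fun S => {S' | ReflTransGen G.Arc S S'}
  obtain ⟨S, hS, hmin⟩ := (measure fun S => (R S).ncard).wf.has_min (R S₀) ⟨S₀, .refl⟩
  have back : ∀ S' ∈ R S, ReflTransGen G.Arc S' S := by
    intro S' hS'
    have hsub : R S' ⊆ R S := fun _ h' => ReflTransGen.trans hS' h'
    have heq : R S' = R S := Set.eq_of_subset_of_ncard_le hsub
      (not_lt.1 (hmin S' (ReflTransGen.trans hS hS'))) (Set.toFinite _)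
    have : S ∈ R S' := heq ▸ (ReflTransGen.refl : S ∈ R S)
    exact this
  obtain ⟨S', hS'⟩ := h S hS
  exact ⟨R S, ⟨⟨S, .refl⟩, fun A hA B hB => (back A hA).trans hB,
    fun A hA B hB => ReflTransGen.tail hA hB⟩, S, .refl, S', .single hS', hS'.ne⟩

/-- A sink contains everything that its states reach, in particular an arcless state, and from that
state no second state can be reached. -/
theorem not_hasNonSingletonSink (h : ∀ S, ∃ S', ReflTransGen G.Arc S S' ∧ ∀ S'', ¬ G.Arc S' S'') :
    ¬ G.HasNonSingletonSink := by
  rintro ⟨T, ⟨⟨S, hS⟩, hconn, hout⟩, hT⟩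
  obtain ⟨S', hSS', hS'⟩ := h S
  have hmem := mem_of_reaches hout hS hSS'
  obtain ⟨S'', hS'', hne⟩ := hT.exists_ne S'
  rcases (hconn S' hmem S'' hS'').cases_head with h1 | ⟨A, hA, -⟩
  exacts [hne h1.symm, hS' A hA]

end StrategicGame

/-! ### Loss games -/

/-- A game in which every player `x` loses one unit for each player `z` whose strategy is bad
for the strategy of `x`. -/
structure LossGame where
  /-- number of players -/
  n : ℕ
  /-- range of the first component of strategies -/
  J : ℕ
  /-- range of the second component of strategies -/
  k : ℕ
  /-- `bad x a z b`: the strategy `b` of `z` is bad for the strategy `a` of `x` -/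
  bad : Fin n → Fin J × Fin k → Fin n → Fin J × Fin k → Bool
  /-- no player hinders himself -/
  bad_self : ∀ x a b, bad x a x b = false
  /-- players have strategies -/
  nonempty : Nonempty (Fin J × Fin k)

namespace LossGame

variable (L : LossGame)

/-- The strategies of every player. -/
abbrev Strategy : Type := Fin L.J × Fin L.k

/-- Strategy profiles. -/
abbrev Profile : Type := Fin L.n → L.Strategy

/-- The loss of a player. -/
def loss (x : Fin L.n) (s : L.Profile) : ℕ :=
  (Finset.univ.filter fun z => L.bad x (s x) z (s z) = true).card

/-- A player with positive loss changes his strategy and thereby avoids any loss. -/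
def Move (s s' : L.Profile) : Prop :=
  ∃ x a, 1 ≤ L.loss x s ∧ s' = Function.update s x a ∧ L.loss x s' = 0

/-- No player can decrease his loss. -/
def IsEquilibrium (s : L.Profile) : Prop :=
  ∀ x a, L.loss x s ≤ L.loss x (Function.update s x a)

/-- From every profile that can be reached from `s`, a further move is possible, and losses
are at most one. -/
def Live (s : L.Profile) : Prop :=
  ∀ s', ReflTransGen L.Move s s' → (∀ x, L.loss x s' ≤ 1) ∧ ∃ s'', L.Move s' s''

/-- From every profile an equilibrium can be reached. -/
def Terminating : Prop :=
  ∀ s, ∃ s', ReflTransGen L.Move s s' ∧ L.IsEquilibrium s'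

/-- A strategic game that behaves like the loss game `L`. -/
structure Implementation (G : StrategicGame L.n) where
  /-- states that represent a profile -/
  Rel : G.State → L.Profile → Prop
  /-- a representative of a profile -/
  state : L.Profile → G.State
  rel_state : ∀ s, Rel (state s) s
  exists_reaches : ∀ S, ∃ S' s, ReflTransGen G.Arc S S' ∧ Rel S' s
  exists_arc : ∀ {S s x a}, Rel S s → 1 ≤ L.loss x s →
    L.loss x (Function.update s x a) = 0 → ∃ S', G.Arc S S' ∧ Rel S' (Function.update s x a)
  exists_reaches_equilibrium : ∀ {S s}, Rel S s → L.IsEquilibrium s →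
    ∃ S', ReflTransGen G.Arc S S' ∧ ∀ S'', ¬ G.Arc S' S''
  -- Required only at canonical representatives, and only when losses are at most one: then an
  -- improvement can only lower a loss from one to zero. Liveness needs this direction, termination
  -- the preceding ones.
  move_of_arc : ∀ {s S'}, (∀ x, L.loss x s ≤ 1) → G.Arc (state s) S' →
    ∃ s', L.Move s s' ∧ S' = state s'

namespace Implementation

variable {L} {G : StrategicGame L.n} (I : L.Implementation G)
include I

/-- By `move_of_arc`, play from the representative of a live profile never leaves representatives of
profiles reached by moves, and each of these allows a further move, hence an arc. -/
theorem hasNonSingletonSink [Finite G.State] {s : L.Profile} (hs : L.Live s) :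
    G.HasNonSingletonSink := by
  refine StrategicGame.hasNonSingletonSink_of_forall_exists_arc (I.state s) fun S hS => ?_
  obtain ⟨s', hs', rfl⟩ : ∃ s', ReflTransGen L.Move s s' ∧ S = I.state s' := by
    induction hS with
    | refl => exact ⟨s, .refl, rfl⟩
    | tail _ h ih =>
      obtain ⟨s', h1, rfl⟩ := ih
      obtain ⟨s'', h2, rfl⟩ := I.move_of_arc (hs s' h1).1 h
      exact ⟨s'', h1.tail h2, rfl⟩
  obtain ⟨-, s'', x, a, h1, rfl, h2⟩ := hs s' hs'
  obtain ⟨S', hS', -⟩ := I.exists_arc (I.rel_state s') h1 h2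
  exact ⟨S', hS'⟩

/-- Reach a represented profile, follow the moves to an equilibrium of the loss game, and from there
reach an arcless state. -/
theorem not_hasNonSingletonSink (h : L.Terminating) : ¬ G.HasNonSingletonSink := by
  refine StrategicGame.not_hasNonSingletonSink fun S => ?_
  obtain ⟨S₁, s, h1, hrel⟩ := I.exists_reaches S
  obtain ⟨s', hs', he⟩ := h s
  obtain ⟨S₂, h2, hrel'⟩ : ∃ S₂, ReflTransGen G.Arc S₁ S₂ ∧ I.Rel S₂ s' := by
    clear he
    induction hs' with
    | refl => exact ⟨S₁, .refl, hrel⟩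
    | tail _ h ih =>
      obtain ⟨S₂, h2, hr⟩ := ih
      obtain ⟨x, a, h3, rfl, h4⟩ := h
      obtain ⟨S₃, h5, hr'⟩ := I.exists_arc hr h3 h4
      exact ⟨S₃, h2.tail h5, hr'⟩
  obtain ⟨S₃, h3, h4⟩ := I.exists_reaches_equilibrium hrel' he
  exact ⟨S₃, (h1.trans h2).trans h3, h4⟩

end Implementation
end LossGame
end SinkEquilibria

namespace SinkEquilibria
open Turing Relation

/-! ### A loss game that simulates a Turing machine on a cyclic tape -/

section Simulation

set_option linter.unusedSectionVars false

variable {Γ Λ : Type} [DecidableEq Γ] [DecidableEq Λ] [Inhabited Γ] [Inhabited Λ]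

/-- The symbol in the scanned cell after the execution of a step. -/
def written (M : TM0.Machine Γ Λ) (q : Λ) (a : Γ) : Γ :=
  match M q a with
  | some (_, TM0.Stmt.write b) => b
  | _ => a

/-- On a cyclic tape with `N` cells, the head is moved from cell `i` to cell `j`. -/
def headMoves (N : ℕ) (t : TM0.Stmt Γ) (i j : ℕ) : Bool :=
  match t with
  | TM0.Stmt.write _ => decide (j = i)
  | TM0.Stmt.move Dir.right => decide (j = i + 1) || (decide (j = 0) && decide (i + 1 = N))
  | TM0.Stmt.move Dir.left => decide (i = j + 1) || (decide (i = 0) && decide (j + 1 = N))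

variable (M : TM0.Machine Γ Λ) (accept : Λ → Bool) (N : ℕ) (start : ℕ → Γ)

/-- The control code `c` at cell `i` comes directly after the control code `d` at cell `j`.
Codes at cell `N` stand for a reset. Otherwise `(q, a, false)` stands for reading the symbol `a`
in the state `q`, and `(q, a, true)` for executing the corresponding step. -/
def follows (i : ℕ) (c : Λ × Γ × Bool) (j : ℕ) (d : Λ × Γ × Bool) : Bool :=
  -- A reset may follow every read, even in the middle of the computation.
  (decide (i = N) && (!decide (j = N) && !d.2.2)) ||
  (!decide (i = N) && (c.2.2 &&
    (decide (j = i) && decide (d = (c.1, c.2.1, false) ∧ (M c.1 c.2.1).isSome)))) ||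
  (!decide (i = N) && (!c.2.2 && (
    (decide (j = N) && (decide (i = 0) && decide (c.1 = default))) ||
    (!decide (j = N) && (d.2.2 && (M d.1 d.2.1).elim false fun t =>
      decide (c.1 = t.1) && headMoves N t.2 j i)) ||
    -- The control may rest on a read exactly if the machine halts there without accepting. After an
    -- accepting halt only a reset remains.
    (decide (j = i) && (decide (d = c) && (!(M c.1 c.2.1).isSome && !accept c.1))))))

/-- The control codes `c` at cell `i` and `d` at cell `j` agree. -/
def sameCode (i : ℕ) (c : Λ × Γ × Bool) (j : ℕ) (d : Λ × Γ × Bool) : Bool :=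
  (decide (i = N) && decide (j = N)) || (decide (i = j) && decide (c = d))

/-- The control code `d` at cell `j` requires the symbol `a` in cell `i`. -/
def orders (i : ℕ) (a : Γ) (j : ℕ) (d : Λ × Γ × Bool) : Bool :=
  (decide (j = N) && decide (start i = a)) ||
  (decide (j = i) && (d.2.2 && decide (written M d.1 d.2.1 = a)))

/-- The relation of hindrance between the strategies of the players: the players `0, …, N - 1`
are the cells of the tape, `N` is the control, and `N + 1` remembers the last control code. -/
def hinders (x i : ℕ) (c : Λ × Γ × Bool) (z j : ℕ) (d : Λ × Γ × Bool) : Bool :=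
  (decide (x = N) && (decide (z = N + 1) && !follows M accept N i c j d)) ||
  (decide (x = N) && (!decide (z = N) && (!decide (z = N + 1) &&
    (decide (i = z) && (!c.2.2 && !decide (c.2.1 = d.2.1)))))) ||
  (decide (x = N + 1) && (decide (z = N) && !sameCode N i c j d)) ||
  (decide (x = N + 1) && (!decide (z = N) && (!decide (z = N + 1) &&
    ((decide (i = z) && (c.2.2 && !decide (d.2.1 = written M c.1 c.2.1))) ||
    (decide (i = N) && !decide (start z = d.2.1)))))) ||
  (!decide (x = N) && (!decide (x = N + 1) && (decide (z = N) &&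
    !orders M N start x c.2.1 j d)))

theorem hinders_self (x i : ℕ) (c : Λ × Γ × Bool) (j : ℕ) (d : Λ × Γ × Bool) :
    hinders M accept N start x i c x j d = false := by
  simp only [hinders, Bool.or_eq_false_iff, Bool.and_eq_false_imp, decide_eq_true_eq,
    Bool.not_eq_true', decide_eq_false_iff_not]
  refine ⟨⟨⟨⟨?_, ?_⟩, ?_⟩, ?_⟩, ?_⟩ <;> intros <;> omega

variable {k : ℕ} (code : Fin k ≃ Λ × Γ × Bool)

/-- The loss game that simulates the machine `M`. -/
def simulation : LossGame where
  n := N + 2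
  J := N + 1
  k := k
  bad x a z b := hinders M accept N start x a.1 (code a.2) z b.1 (code b.2)
  bad_self _ _ _ := hinders_self ..
  nonempty := ⟨Fin.last N, code.symm default⟩

/-- The meaning of the strategies of the control. -/
inductive Act (N : ℕ) (Γ Λ : Type)
  | reset
  | read (i : Fin N) (q : Λ) (a : Γ)
  | write (i : Fin N) (q : Λ) (a : Γ)

namespace Act

variable {N} {M accept start}

/-- The condition under which the control can follow the second act by the first one. -/
def Follows (M : TM0.Machine Γ Λ) (accept : Λ → Bool) : Act N Γ Λ → Act N Γ Λ → Prop
  | reset, read _ _ _ => True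
  | write i q a, read j q' a' => i = j ∧ q = q' ∧ a = a' ∧ (M q a).isSome
  | read i q _, reset => (i : ℕ) = 0 ∧ q = default
  | read i q _, write j q' a' => ∃ t, M q' a' = some t ∧ q = t.1 ∧ headMoves N t.2 j i = true
  | read i q a, read j q' a' => i = j ∧ q = q' ∧ a = a' ∧ M q a = none ∧ accept q = false
  | _, _ => False

/-- The symbol that is read is the scanned one. -/
def Matches : Act N Γ Λ → (Fin N → Γ) → Prop
  | read i _ a, w => a = w i
  | _, _ => True

/-- The act has been carried out. -/
def Done (M : TM0.Machine Γ Λ) (start : ℕ → Γ) : Act N Γ Λ → (Fin N → Γ) → Prop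
  | reset, w => ∀ i, w i = start i
  | read _ _ _, _ => True
  | write i q a, w => w i = written M q a

/-- The act requires the symbol `b` in cell `i`. -/
def Orders (M : TM0.Machine Γ Λ) (start : ℕ → Γ) (i : Fin N) (b : Γ) : Act N Γ Λ → Prop
  | reset => start i = b
  | read _ _ _ => False
  | write j q a => j = i ∧ written M q a = b

end Act

/-! ### Hindrance expressed through the acts of the players -/

namespace simulation

variable {M accept N start code}

local notation "𝒢" => simulation M accept N start code

/-- The control. -/
def control : Fin (𝒢).n := ⟨N, by simp [simulation]⟩

/-- The player that remembers the last act. -/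
def memory : Fin (𝒢).n := ⟨N + 1, by simp [simulation]⟩

/-- The players that form the tape. -/
def cell (i : Fin N) : Fin (𝒢).n := ⟨i, by simp [simulation]; omega⟩

theorem player_cases (x : Fin (𝒢).n) : x = control ∨ x = memory ∨ ∃ i, x = cell i := by
  obtain ⟨x, hx⟩ := x
  have hx' : x < N + 2 := hx
  rcases lt_trichotomy x N with h | h | h
  · exact Or.inr (Or.inr ⟨⟨x, h⟩, rfl⟩)
  · exact Or.inl (Fin.ext h)
  · exact Or.inr (Or.inl (Fin.ext (show x = N + 1 by omega)))

theorem cell_ne_control (i : Fin N) : (cell i : Fin (𝒢).n) ≠ control := by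
  intro h
  have : (i : ℕ) = N := congrArg Fin.val h
  omega

theorem cell_ne_memory (i : Fin N) : (cell i : Fin (𝒢).n) ≠ memory := by
  intro h
  have : (i : ℕ) = N + 1 := congrArg Fin.val h
  omega

theorem control_ne_memory : (control : Fin (𝒢).n) ≠ memory := by
  intro h
  have : N = N + 1 := congrArg Fin.val h
  omega

theorem cell_injective : Function.Injective (cell : Fin N → Fin (𝒢).n) := fun _ _ h =>
  Fin.ext (Fin.mk.inj_iff.1 h)

/-- The meaning of a strategy. -/
def act (a : (𝒢).Strategy) : Act N Γ Λ :=
  if h : (a.1 : ℕ) < N then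
    if (code a.2).2.2 then .write ⟨a.1, h⟩ (code a.2).1 (code a.2).2.1
    else .read ⟨a.1, h⟩ (code a.2).1 (code a.2).2.1
  else .reset

/-- The strategy with a given meaning. -/
def ofAct : Act N Γ Λ → (𝒢).Strategy
  | .reset => (Fin.last N, code.symm (default, default, false))
  | .read i q a => (i.castSucc, code.symm (q, a, false))
  | .write i q a => (i.castSucc, code.symm (q, a, true))

@[simp]
theorem act_ofAct (c : Act N Γ Λ) : act (ofAct c : (𝒢).Strategy) = c := by
  cases c <;> simp [act, ofAct]

/-- The symbol of a strategy. -/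
def symbol (a : (𝒢).Strategy) : Γ := (code a.2).2.1

/-- A strategy with a given symbol. -/
def ofSymbol (b : Γ) : (𝒢).Strategy := (Fin.last N, code.symm (default, b, false))

@[simp]
theorem symbol_ofSymbol (b : Γ) : symbol (ofSymbol b : (𝒢).Strategy) = b := by
  simp [symbol, ofSymbol]

/-- This and the next lemmas replace the numerical coding of hindrance by statements on acts, by
cases on the kinds of the acts involved. -/
theorem bad_control_memory (a b : (𝒢).Strategy) :
    (𝒢).bad control a memory b = false ↔ (act a).Follows M accept (act b) := by
  obtain ⟨⟨i, hi⟩, c⟩ := a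
  obtain ⟨⟨j, hj⟩, d⟩ := b
  have hi' : i < N + 1 := hi
  have hj' : j < N + 1 := hj
  rcases hc : code c with ⟨q, a, h⟩
  rcases hd : code d with ⟨q', a', h'⟩
  by_cases hiN : i < N <;> by_cases hjN : j < N <;> cases h <;> cases h' <;>
    simp [simulation, hinders, control, memory, act, hc, hd, follows, Act.Follows, hiN, hjN,
      show i = N ↔ ¬ i < N by omega, show j = N ↔ ¬ j < N by omega]
  · grind
  · cases M q' a' <;> grind
  · grind
  · grind
  · grind

theorem bad_control_cell (a b : (𝒢).Strategy) (z : Fin N) :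
    (𝒢).bad control a (cell z) b = true ↔ ∃ q c, act a = .read z q c ∧ c ≠ symbol b := by
  obtain ⟨⟨i, hi⟩, c⟩ := a
  have hi' : i < N + 1 := hi
  rcases hc : code c with ⟨q, a, h⟩
  have hz := z.2
  by_cases hiN : i < N <;> cases h <;>
    simp [simulation, hinders, control, cell, act, hc, hiN, symbol, Fin.ext_iff,
      show (z : ℕ) ≠ N by omega, show (z : ℕ) ≠ N + 1 by omega]
  omega

theorem bad_memory_control (a b : (𝒢).Strategy) :
    (𝒢).bad memory a control b = false ↔ act a = act b := by
  obtain ⟨⟨i, hi⟩, c⟩ := a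
  obtain ⟨⟨j, hj⟩, d⟩ := b
  have hi' : i < N + 1 := hi
  have hj' : j < N + 1 := hj
  rcases hc : code c with ⟨q, a, h⟩
  rcases hd : code d with ⟨q', a', h'⟩
  by_cases hiN : i < N <;> by_cases hjN : j < N <;> cases h <;> cases h' <;>
    simp [simulation, hinders, control, memory, act, hc, hd, sameCode, hiN, hjN,
      show i = N ↔ ¬ i < N by omega, show j = N ↔ ¬ j < N by omega]
  all_goals omega

theorem bad_memory_cell (a b : (𝒢).Strategy) (z : Fin N) :
    (𝒢).bad memory a (cell z) b = true ↔
      (∃ q c, act a = .write z q c ∧ symbol b ≠ written M q c) ∨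
        act a = .reset ∧ symbol b ≠ start z := by
  obtain ⟨⟨i, hi⟩, c⟩ := a
  have hi' : i < N + 1 := hi
  rcases hc : code c with ⟨q, a, h⟩
  have hz := z.2
  by_cases hiN : i < N <;> cases h <;>
    simp [simulation, hinders, memory, cell, act, hc, hiN, symbol, Fin.ext_iff,
      show i = N ↔ ¬ i < N by omega, eq_comm (a := start z),
      show (z : ℕ) ≠ N by omega, show (z : ℕ) ≠ N + 1 by omega]
  all_goals omega

theorem bad_cell_control (a b : (𝒢).Strategy) (x : Fin N) :
    (𝒢).bad (cell x) a control b = false ↔ (act b).Orders M start x (symbol a) := by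
  obtain ⟨⟨i, hi⟩, c⟩ := b
  have hi' : i < N + 1 := hi
  rcases hc : code c with ⟨q, a, h⟩
  have hx := x.2
  by_cases hiN : i < N <;> cases h <;>
    simp [simulation, hinders, control, cell, act, hc, hiN, symbol, Fin.ext_iff, orders,
      Act.Orders, show i = N ↔ ¬ i < N by omega,
      show (x : ℕ) ≠ N by omega, show (x : ℕ) ≠ N + 1 by omega]
  grind

theorem bad_cell_of_ne (a b : (𝒢).Strategy) (x : Fin N) (z : Fin (𝒢).n) (hz : z ≠ control) :
    (𝒢).bad (cell x) a z b = false := by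
  have hz' : (z : ℕ) ≠ N := fun h => hz (Fin.ext h)
  have hx := x.2
  simp [simulation, hinders, cell, hz', show (x : ℕ) ≠ N by omega,
    show (x : ℕ) ≠ N + 1 by omega]

/-- The contents of the tape. -/
def tape (s : (𝒢).Profile) (i : Fin N) : Γ := symbol (s (cell i))

end simulation

namespace LossGame

theorem loss_eq_zero_iff {L : LossGame} {x : Fin L.n} {s : L.Profile} :
    L.loss x s = 0 ↔ ∀ z, L.bad x (s x) z (s z) = false := by
  simp [loss, Finset.filter_eq_empty_iff]

theorem loss_update_eq_zero_iff {L : LossGame} {x : Fin L.n} {s : L.Profile} {a : L.Strategy} :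
    L.loss x (Function.update s x a) = 0 ↔ ∀ z, z ≠ x → L.bad x a z (s z) = false := by
  rw [loss_eq_zero_iff]
  refine ⟨fun h z hz => ?_, fun h z => ?_⟩
  · simpa [hz] using h z
  · by_cases hz : z = x
    · subst hz
      exact L.bad_self _ _ _
    · simpa [hz] using h z hz

theorem loss_le_one {L : LossGame} {x : Fin L.n} {s : L.Profile} (z₀ : Fin L.n)
    (h : ∀ z, z ≠ z₀ → L.bad x (s x) z (s z) = false) : L.loss x s ≤ 1 := by
  refine (Finset.card_le_card (t := {z₀}) fun z hz => ?_).trans_eq (Finset.card_singleton _)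
  rw [Finset.mem_singleton]
  by_contra hne
  simp [h z hne] at hz

end LossGame

/-! ### Losses in terms of acts and tape contents -/

namespace simulation

variable {M accept N start code}

local notation "𝒢" => simulation M accept N start code

theorem control_loss_zero {s : (𝒢).Profile} {a : (𝒢).Strategy} :
    (𝒢).loss control (Function.update s control a) = 0 ↔
      (act a).Follows M accept (act (s memory)) ∧ (act a).Matches (tape s) := by
  rw [LossGame.loss_update_eq_zero_iff]
  constructor
  · intro h
    refine ⟨bad_control_memory .. |>.1 (h _ control_ne_memory.symm), ?_⟩
    rcases ha : act a with _ | ⟨i, q, c⟩ | _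
    · trivial
    · by_contra hne
      have := (bad_control_cell a (s (cell i)) i).2 ⟨q, c, ha, hne⟩
      simp [h _ (cell_ne_control i)] at this
    · trivial
  · rintro ⟨h1, h2⟩ z hz
    rcases player_cases z with rfl | rfl | ⟨i, rfl⟩
    · exact absurd rfl hz
    · exact bad_control_memory .. |>.2 h1
    · rw [← Bool.not_eq_true, bad_control_cell]
      rintro ⟨q, c, hc, hne⟩
      rw [hc] at h2
      exact hne h2

theorem memory_loss_zero {s : (𝒢).Profile} {a : (𝒢).Strategy} :
    (𝒢).loss memory (Function.update s memory a) = 0 ↔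
      act a = act (s control) ∧ (act a).Done M start (tape s) := by
  rw [LossGame.loss_update_eq_zero_iff]
  constructor
  · intro h
    refine ⟨bad_memory_control .. |>.1 (h _ control_ne_memory), ?_⟩
    rcases ha : act a with _ | _ | ⟨i, q, c⟩
    · intro i
      by_contra hne
      have := (bad_memory_cell a (s (cell i)) i).2 (Or.inr ⟨ha, hne⟩)
      simp [h _ (cell_ne_memory i)] at this
    · trivial
    · by_contra hne
      have := (bad_memory_cell a (s (cell i)) i).2 (Or.inl ⟨q, c, ha, hne⟩)
      simp [h _ (cell_ne_memory i)] at this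
  · rintro ⟨h1, h2⟩ z hz
    rcases player_cases z with rfl | rfl | ⟨i, rfl⟩
    · exact bad_memory_control .. |>.2 h1
    · exact absurd rfl hz
    · rw [← Bool.not_eq_true, bad_memory_cell]
      rintro (⟨q, c, hc, hne⟩ | ⟨hc, hne⟩)
      · rw [hc] at h2
        exact hne h2
      · rw [hc] at h2
        exact hne (h2 i)

theorem cell_loss_zero {s : (𝒢).Profile} {a : (𝒢).Strategy} {i : Fin N} :
    (𝒢).loss (cell i) (Function.update s (cell i) a) = 0 ↔
      (act (s control)).Orders M start i (symbol a) := by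
  rw [LossGame.loss_update_eq_zero_iff]
  refine ⟨fun h => bad_cell_control .. |>.1 (h _ (cell_ne_control i).symm), fun h z hz => ?_⟩
  by_cases hzc : z = control
  · subst hzc
    exact bad_cell_control .. |>.2 h
  · exact bad_cell_of_ne _ _ _ _ hzc

/-- The essential part of a profile: the acts of the control and of the memory, and the contents
of the tape. -/
def view (s : (𝒢).Profile) : Act N Γ Λ × Act N Γ Λ × (Fin N → Γ) :=
  (act (s control), act (s memory), tape s)

theorem view_update_control (s : (𝒢).Profile) (a : (𝒢).Strategy) :
    view (Function.update s control a) = (act a, act (s memory), tape s) := by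
  refine Prod.ext (by simp [view]) (Prod.ext ?_ ?_)
  · simp [view, Function.update_of_ne control_ne_memory.symm]
  · funext i
    simp [view, tape, Function.update_of_ne (cell_ne_control i)]

theorem view_update_memory (s : (𝒢).Profile) (a : (𝒢).Strategy) :
    view (Function.update s memory a) = (act (s control), act a, tape s) := by
  refine Prod.ext ?_ (Prod.ext (by simp [view]) ?_)
  · simp [view, Function.update_of_ne control_ne_memory]
  · funext i
    simp [view, tape, Function.update_of_ne (cell_ne_memory i)]

theorem view_update_cell (s : (𝒢).Profile) (a : (𝒢).Strategy) (i : Fin N) :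
    view (Function.update s (cell i) a) =
      (act (s control), act (s memory), Function.update (tape s) i (symbol a)) := by
  refine Prod.ext ?_ (Prod.ext ?_ ?_)
  · simp [view, Function.update_of_ne (cell_ne_control i).symm]
  · simp [view, Function.update_of_ne (cell_ne_memory i).symm]
  · funext j
    by_cases hj : j = i
    · subst hj
      simp [view, tape]
    · simp [view, tape, hj, Function.update_of_ne (cell_injective.ne hj)]

end simulation

/-- The moves of the simulation, in terms of the essential parts of profiles. -/
inductive Act.Step (M : TM0.Machine Γ Λ) (accept : Λ → Bool) (start : ℕ → Γ) {N : ℕ} :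
    Act N Γ Λ × Act N Γ Λ × (Fin N → Γ) → Act N Γ Λ × Act N Γ Λ × (Fin N → Γ) → Prop
  | control {c d c' w} : ¬ (c.Follows M accept d ∧ c.Matches w) → c'.Follows M accept d →
      c'.Matches w → Step M accept start (c, d, w) (c', d, w)
  | memory {c d w} : ¬ (d = c ∧ d.Done M start w) → c.Done M start w →
      Step M accept start (c, d, w) (c, c, w)
  | cell {c d w} (i : Fin N) (b : Γ) : ¬ c.Orders M start i (w i) → c.Orders M start i b →
      Step M accept start (c, d, w) (c, d, Function.update w i b)

namespace simulation

variable {M accept N start code}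

local notation "𝒢" => simulation M accept N start code

theorem step_of_move {s s' : (𝒢).Profile} (h : (𝒢).Move s s') :
    Act.Step M accept start (view s) (view s') := by
  obtain ⟨x, a, h1, rfl, h2⟩ := h
  have h1' : ¬ (𝒢).loss x (Function.update s x (s x)) = 0 := by
    rw [Function.update_eq_self]
    omega
  rcases player_cases x with rfl | rfl | ⟨i, rfl⟩
  · rw [control_loss_zero] at h1' h2
    rw [view_update_control]
    exact .control h1' h2.1 h2.2
  · rw [memory_loss_zero] at h1' h2
    rw [view_update_memory, h2.1]
    exact .memory h1' (h2.1 ▸ h2.2)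
  · rw [cell_loss_zero] at h1' h2
    rw [view_update_cell]
    exact .cell i _ h1' h2

/-- Together with `step_of_move` this makes `view` a bisimulation, so runs can be studied on views,
where the irrelevant components of strategies have disappeared. -/
theorem exists_move {s : (𝒢).Profile} {v : Act N Γ Λ × Act N Γ Λ × (Fin N → Γ)}
    (h : Act.Step M accept start (view s) v) : ∃ s', (𝒢).Move s s' ∧ view s' = v := by
  obtain ⟨x, a, h1, h2, h3⟩ : ∃ x a, ¬ (𝒢).loss x (Function.update s x (s x)) = 0 ∧
      (𝒢).loss x (Function.update s x a) = 0 ∧ view (Function.update s x a) = v := by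
    generalize hv : view s = u at h
    cases h with
    | @control c d c' w h1 h2 h3 =>
      simp only [view, Prod.mk.injEq] at hv
      obtain ⟨rfl, rfl, rfl⟩ := hv
      exact ⟨control, ofAct c', by rwa [control_loss_zero], by
        rw [control_loss_zero, act_ofAct]
        exact ⟨h2, h3⟩, by rw [view_update_control, act_ofAct]⟩
    | @memory c d w h1 h2 =>
      simp only [view, Prod.mk.injEq] at hv
      obtain ⟨rfl, rfl, rfl⟩ := hv
      exact ⟨memory, ofAct (act (s control)), by rwa [memory_loss_zero], by
        rw [memory_loss_zero, act_ofAct]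
        exact ⟨rfl, h2⟩, by rw [view_update_memory, act_ofAct]⟩
    | @cell c d w i b h1 h2 =>
      simp only [view, Prod.mk.injEq] at hv
      obtain ⟨rfl, rfl, rfl⟩ := hv
      exact ⟨cell i, ofSymbol b, by rwa [cell_loss_zero], by
        rwa [cell_loss_zero, symbol_ofSymbol], by rw [view_update_cell, symbol_ofSymbol]⟩
  rw [Function.update_eq_self] at h1
  exact ⟨_, ⟨x, a, by omega, rfl, h2⟩, h3⟩

theorem exists_moves {s : (𝒢).Profile} {v : Act N Γ Λ × Act N Γ Λ × (Fin N → Γ)}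
    (h : ReflTransGen (Act.Step M accept start) (view s) v) :
    ∃ s', ReflTransGen (𝒢).Move s s' ∧ view s' = v := by
  induction h with
  | refl => exact ⟨s, .refl, rfl⟩
  | tail _ h ih =>
    obtain ⟨s', h1, rfl⟩ := ih
    obtain ⟨s'', h2, rfl⟩ := exists_move h
    exact ⟨s'', h1.tail h2, rfl⟩

theorem exists_view (v : Act N Γ Λ × Act N Γ Λ × (Fin N → Γ)) :
    ∃ s : (𝒢).Profile, view s = v := by
  obtain ⟨c, d, w⟩ := v
  refine ⟨fun x => if h : (x : ℕ) < N then ofSymbol (w ⟨x, h⟩) else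
    if (x : ℕ) = N then ofAct c else ofAct d, ?_⟩
  simp only [view, control, memory, Prod.mk.injEq]
  refine ⟨by simp, by simp, ?_⟩
  funext i
  simp [tape, cell]

/-- If what is read is right, and what is remembered has been done, then all losses are at most
one. -/
theorem loss_le_one {s : (𝒢).Profile} (h1 : (act (s control)).Matches (tape s))
    (h2 : (act (s memory)).Done M start (tape s)) (x : Fin (𝒢).n) : (𝒢).loss x s ≤ 1 := by
  rcases player_cases x with rfl | rfl | ⟨i, rfl⟩
  · refine LossGame.loss_le_one memory fun z hz => ?_
    rcases player_cases z with rfl | rfl | ⟨i, rfl⟩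
    · exact (𝒢).bad_self _ _ _
    · exact absurd rfl hz
    · rw [← Bool.not_eq_true, bad_control_cell]
      rintro ⟨q, c, hc, hne⟩
      rw [hc] at h1
      exact hne h1
  · refine LossGame.loss_le_one control fun z hz => ?_
    rcases player_cases z with rfl | rfl | ⟨i, rfl⟩
    · exact absurd rfl hz
    · exact (𝒢).bad_self _ _ _
    · rw [← Bool.not_eq_true, bad_memory_cell]
      rintro (⟨q, c, hc, hne⟩ | ⟨hc, hne⟩)
      · rw [hc] at h2
        exact hne h2
      · rw [hc] at h2
        exact hne (h2 i)
  · exact LossGame.loss_le_one control fun z hz => bad_cell_of_ne _ _ _ _ hz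

/-- By `loss_le_one` all losses are at most one, so only an alternative with loss zero could be
better; the hypotheses say that whoever has such an alternative has no loss already. -/
theorem isEquilibrium {s : (𝒢).Profile} (h1 : (act (s control)).Matches (tape s))
    (h2 : (act (s memory)).Done M start (tape s)) (h3 : act (s memory) = act (s control))
    (h4 : (act (s control)).Follows M accept (act (s memory)) ∨
      ∀ c : Act N Γ Λ, ¬ c.Follows M accept (act (s memory)))
    (h5 : ∀ i, (act (s control)).Orders M start i (tape s i) ∨
      ∀ b, ¬ (act (s control)).Orders M start i b) : (𝒢).IsEquilibrium s := by
  intro x a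
  rcases Nat.eq_zero_or_pos ((𝒢).loss x (Function.update s x a)) with h | h
  · suffices (𝒢).loss x (Function.update s x (s x)) = 0 by
      rw [Function.update_eq_self] at this
      omega
    rcases player_cases x with rfl | rfl | ⟨i, rfl⟩
    · rw [control_loss_zero] at h ⊢
      exact ⟨h4.resolve_right fun h' => h' _ h.1, h1⟩
    · rw [memory_loss_zero]
      exact ⟨h3, h2⟩
    · rw [cell_loss_zero] at h ⊢
      exact (h5 i).resolve_right fun h' => h' _ h
  · exact (loss_le_one h1 h2 x).trans h

end simulation
end Simulation
end SinkEquilibria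

namespace SinkEquilibria
open Turing Relation

/-! ### The moves of the simulation -/

section Simulation

set_option linter.unusedSectionVars false

variable {Γ Λ : Type} [Inhabited Γ] [Inhabited Λ]

/-- A step of the machine `M` on the cyclic tape; configurations consist of the state, the scanned
cell and the contents of the tape. -/
def CyclicStep (M : TM0.Machine Γ Λ) {N : ℕ} (c c' : Λ × Fin N × (Fin N → Γ)) : Prop :=
  ∃ t, M c.1 (c.2.2 c.2.1) = some (c'.1, t) ∧ headMoves N t c.2.1 c'.2.1 = true ∧
    c'.2.2 = Function.update c.2.2 c.2.1 (written M c.1 (c.2.2 c.2.1))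

/-- On a cyclic tape the head cannot fall off, so every transition of the machine can be carried
out. -/
theorem exists_headMoves {N : ℕ} (t : TM0.Stmt Γ) (i : Fin N) :
    ∃ j : Fin N, headMoves N t i j = true := by
  have hi := i.2
  rcases t with (_ | _) | b
  · by_cases h : (i : ℕ) = 0
    · exact ⟨⟨N - 1, by omega⟩, by simp [headMoves]; omega⟩
    · exact ⟨⟨i - 1, by omega⟩, by simp [headMoves]; omega⟩
  · by_cases h : (i : ℕ) + 1 = N
    · exact ⟨⟨0, by omega⟩, by simp [headMoves, h]⟩
    · exact ⟨⟨i + 1, by omega⟩, by simp [headMoves]⟩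
  · exact ⟨i, by simp [headMoves]⟩

variable {M : TM0.Machine Γ Λ} {accept : Λ → Bool} {N : ℕ} {start : ℕ → Γ}

namespace Act

/-- The configurations that are reached from the beginning. -/
def Reached (M : TM0.Machine Γ Λ) (start : ℕ → Γ) (c : Λ × Fin N × (Fin N → Γ)) : Prop :=
  ∃ i₀ : Fin N, (i₀ : ℕ) = 0 ∧
    ReflTransGen (CyclicStep M) (default, i₀, fun i => start i) c

/-- The essential parts of profiles that come up in the simulation. -/
inductive Sound (M : TM0.Machine Γ Λ) (accept : Λ → Bool) (start : ℕ → Γ) :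
    Act N Γ Λ × Act N Γ Λ × (Fin N → Γ) → Prop
  | arrive {q i w d} : Reached M start (q, i, w) → (read i q (w i)).Follows M accept d →
      d ≠ read i q (w i) → d.Done M start w → Sound M accept start (read i q (w i), d, w)
  | look {q i w} : Reached M start (q, i, w) →
      Sound M accept start (read i q (w i), read i q (w i), w)
  -- The scanned cell may or may not have obeyed yet.
  | write {q i w w'} : Reached M start (q, i, w) → (M q (w i)).isSome →
      w' = w ∨ w' = Function.update w i (written M q (w i)) →
      Sound M accept start (write i q (w i), read i q (w i), w')
  | wrote {q i w} : Reached M start (q, i, w) → (M q (w i)).isSome →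
      Sound M accept start (write i q (w i), write i q (w i),
        Function.update w i (written M q (w i)))
  -- The tape is arbitrary because any subset of the cells may have been restored.
  | reset {q i a w} : Sound M accept start (reset, read i q a, w)
  | clear : Sound M accept start (reset, reset, fun i => start i)

theorem Sound.matches {v : Act N Γ Λ × Act N Γ Λ × (Fin N → Γ)} (h : Sound M accept start v) :
    v.1.Matches v.2.2 := by
  cases h <;> simp [Matches]

theorem Sound.done {v : Act N Γ Λ × Act N Γ Λ × (Fin N → Γ)} (h : Sound M accept start v) :
    v.2.1.Done M start v.2.2 := by
  cases h with
  | arrive _ _ _ h => exact h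
  | wrote => simp [Done]
  | clear => exact fun _ => rfl
  | _ => trivial

theorem Sound.step {v v' : Act N Γ Λ × Act N Γ Λ × (Fin N → Γ)}
    (hM : ∀ q (i : Fin N) w, Reached M start (q, i, w) → M q (w i) = none → accept q = true)
    (h : Sound M accept start v) (hv : Step M accept start v v') : Sound M accept start v' := by
  cases h with
  | @arrive q i w d h1 h2 h3 h4 =>
    cases hv with
    | control h5 => exact absurd ⟨h2, rfl⟩ h5
    | memory => exact .look h1
    | cell _ _ _ h => exact h.elim
  | @look q i w h1 =>
    cases hv with
    | @control _ _ c' _ _ h2 h3 =>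
      rcases c' with _ | ⟨j, q', a⟩ | ⟨j, q', a⟩
      · exact .reset
      · obtain ⟨rfl, rfl, -, h4, h5⟩ := h2
        -- Reading the same again would require a halt without acceptance, which `hM` excludes.
        simp [hM _ _ _ h1 (h3 ▸ h4)] at h5
      · obtain ⟨rfl, rfl, rfl, h4⟩ := h2
        exact .write h1 h4 (Or.inl rfl)
    | memory => exact .look h1
    | cell _ _ _ h => exact h.elim
  | @write q i w w' h1 h2 h3 =>
    cases hv with
    | control h4 => exact absurd ⟨⟨rfl, rfl, rfl, h2⟩, trivial⟩ h4
    | memory _ h4 =>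
      have h4 : w' i = written M q (w i) := h4
      rcases h3 with rfl | rfl
      -- The cell held the symbol to be written from the outset, so writing leaves the tape
      -- unchanged.
      · have := Sound.wrote (accept := accept) h1 h2
        rwa [← h4, Function.update_eq_self] at this
      · exact .wrote h1 h2
    | cell j b _ h4 =>
      obtain ⟨rfl, rfl⟩ := h4
      exact .write h1 h2 (Or.inr (by rcases h3 with rfl | rfl <;> simp))
  | @wrote q i w h1 h2 =>
    cases hv with
    | @control _ _ c' _ _ h3 h4 =>
      rcases c' with _ | ⟨j, q', a⟩ | ⟨j, q', a⟩
      · exact h3.elim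
      · obtain ⟨⟨q', t⟩, h5, rfl, h6⟩ := h3
        obtain rfl : a = _ := h4
        obtain ⟨i₀, h7, h8⟩ := h1
        exact .arrive ⟨i₀, h7, h8.tail ⟨t, h5, h6, rfl⟩⟩ ⟨_, h5, rfl, h6⟩ (by simp)
          (by simp [Done])
      · exact h3.elim
    | memory => exact .wrote h1 h2
    | cell j b h3 h4 =>
      obtain ⟨rfl, rfl⟩ := h4
      simp [Orders] at h3
  | reset =>
    cases hv with
    | control h1 => exact absurd ⟨trivial, trivial⟩ h1
    | memory _ h1 =>
      obtain rfl := funext h1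
      exact .clear
    | cell => exact .reset
  | clear =>
    cases hv with
    | @control _ _ c' _ _ h1 h2 =>
      rcases c' with _ | ⟨j, q', a⟩ | ⟨j, q', a⟩
      · exact h1.elim
      · obtain ⟨h1, rfl⟩ := h1
        obtain rfl : a = _ := h2
        exact .arrive ⟨j, h1, .refl⟩ ⟨h1, rfl⟩ (by simp) fun _ => rfl
      · exact h1.elim
    | memory => exact .clear
    | cell _ _ h => exact absurd rfl h

/-- In each phase some player is still to act. The critical one is `look`: since no reachable halt
rejects, the control cannot rest there, and a reset is always open to it. -/
theorem Sound.exists_step (hN : 0 < N) {v : Act N Γ Λ × Act N Γ Λ × (Fin N → Γ)}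
    (hM : ∀ q (i : Fin N) w, Reached M start (q, i, w) → M q (w i) = none → accept q = true)
    (h : Sound M accept start v) : ∃ v', Step M accept start v v' := by
  cases h with
  | @arrive q i w d h1 h2 h3 h4 => exact ⟨_, .memory (fun h => h3 h.1) trivial⟩
  | @look q i w h1 =>
    refine ⟨_, .control (c' := .reset) ?_ trivial trivial⟩
    rintro ⟨⟨-, -, -, h2, h3⟩, -⟩
    simp [hM _ _ _ h1 h2] at h3
  | @write q i w w' h1 h2 h3 =>
    by_cases h4 : w' i = written M q (w i)
    · exact ⟨_, .memory (by simp) h4⟩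
    · exact ⟨_, .cell i _ (fun h => h4 h.2.symm) ⟨rfl, rfl⟩⟩
  | @wrote q i w h1 h2 =>
    obtain ⟨t, ht⟩ := Option.isSome_iff_exists.1 h2
    obtain ⟨j, hj⟩ := exists_headMoves t.2 i
    exact ⟨_, .control (c' := .read j t.1 _) (fun h => h.1) ⟨t, ht, rfl, hj⟩ rfl⟩
  | @reset q i a w =>
    by_cases h : ∀ i, w i = start i
    · exact ⟨_, .memory (by simp) h⟩
    · push Not at h
      obtain ⟨i, hi⟩ := h
      exact ⟨_, .cell i _ (fun h => hi h.symm) rfl⟩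
  | clear => exact ⟨_, .control (c' := .read ⟨0, hN⟩ default _) (fun h => h.1) ⟨rfl, rfl⟩ rfl⟩

/-- Nothing can be improved. -/
def Stuck (M : TM0.Machine Γ Λ) (accept : Λ → Bool) (start : ℕ → Γ)
    (v : Act N Γ Λ × Act N Γ Λ × (Fin N → Γ)) : Prop :=
  v.1.Matches v.2.2 ∧ v.2.1.Done M start v.2.2 ∧ v.2.1 = v.1 ∧
    (v.1.Follows M accept v.2.1 ∨ ∀ c : Act N Γ Λ, ¬ c.Follows M accept v.2.1) ∧
    ∀ i, v.1.Orders M start i (v.2.2 i) ∨ ∀ b, ¬ v.1.Orders M start i b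

theorem stuck_read {i : Fin N} {q : Λ} {w : Fin N → Γ} (h : M q (w i) = none)
    (hq : accept q = false) :
    Stuck M accept start (read i q (w i), read i q (w i), w) :=
  ⟨rfl, trivial, rfl, Or.inl ⟨rfl, rfl, rfl, h, hq⟩, fun _ => Or.inr fun _ h => h⟩

/-- No act may follow a write for which the machine has no transition, so the control cannot avoid
its loss. -/
theorem stuck_write {i : Fin N} {q : Λ} {a : Γ} {w : Fin N → Γ} (h : M q a = none)
    (hw : w i = written M q a) :
    Stuck M accept start (write i q a, write i q a, w) := by
  refine ⟨trivial, hw, rfl, Or.inr fun c hc => ?_, fun j => ?_⟩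
  · rcases c with _ | _ | _
    · exact hc
    · obtain ⟨t, ht, -⟩ := hc
      simp [h] at ht
    · exact hc
  · by_cases hj : i = j
    · subst hj
      exact Or.inl ⟨rfl, hw.symm⟩
    · exact Or.inr fun b hb => hj hb.1

theorem reaches_memory {c d : Act N Γ Λ} {w : Fin N → Γ} (h : c.Done M start w) :
    ReflTransGen (Step M accept start) (c, d, w) (c, c, w) := by
  by_cases hd : d = c
  · rw [hd]
  · exact .single (.memory (fun h => hd h.1) h)

theorem reaches_written {d : Act N Γ Λ} {i : Fin N} {q : Λ} {a : Γ} {w : Fin N → Γ} :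
    ReflTransGen (Step M accept start) (write i q a, d, w)
      (write i q a, write i q a, Function.update w i (written M q a)) := by
  refine ReflTransGen.trans ?_ (reaches_memory (d := d) (by simp [Done]))
  by_cases h : w i = written M q a
  · rw [← h, Function.update_eq_self]
  · exact .single (.cell i _ (fun h' => h h'.2.symm) ⟨rfl, rfl⟩)

/-- The wrong cells are restored one at a time, and then the memory copies the reset. -/
theorem reaches_reset {d : Act N Γ Λ} {w : Fin N → Γ} :
    ReflTransGen (Step M accept start) (reset, d, w) (reset, reset, fun i => start i) := by
  classical
  suffices ∀ S : Finset (Fin N), ReflTransGen (Step M accept start) (reset, d, w)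
      (reset, d, fun i => if i ∈ S then start i else w i) by
    simpa using (this Finset.univ).trans (reaches_memory (c := reset) fun i => by simp)
  intro S
  induction S using Finset.induction_on with
  | empty => simpa using ReflTransGen.refl
  | insert j S _ ih =>
    refine ih.trans ?_
    have : (fun i => if i ∈ insert j S then start i else w i) =
        Function.update (fun i => if i ∈ S then start i else w i) j (start j) := by
      funext i
      by_cases hi : i = j
      · subst hi
        simp
      · simp [hi]
    rw [this]
    by_cases h : start j = if j ∈ S then start j else w j
    · conv_rhs => rw [h]
      rw [Function.update_eq_self (f := fun i : Fin N => if i ∈ S then start i else w i)]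
    · exact .single (.cell j _ h rfl)

/-- The control and the memory read the scanned cell. -/
def looking (c : Λ × Fin N × (Fin N → Γ)) : Act N Γ Λ × Act N Γ Λ × (Fin N → Γ) :=
  (read c.2.1 c.1 (c.2.2 c.2.1), read c.2.1 c.1 (c.2.2 c.2.1), c.2.2)

theorem reaches_read {i : Fin N} {q : Λ} {d : Act N Γ Λ} {w : Fin N → Γ} :
    ReflTransGen (Step M accept start) (read i q (w i), d, w) (looking (q, i, w)) :=
  reaches_memory (c := read i q (w i)) trivial

/-- One machine step: the control announces the write, the cell and the memory follow if necessary,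
the control reads the next cell, and the memory follows. -/
theorem reaches_of_cyclicStep {c c' : Λ × Fin N × (Fin N → Γ)} (h : CyclicStep M c c') :
    ReflTransGen (Step M accept start) (looking c) (looking c') := by
  obtain ⟨q, i, w⟩ := c
  obtain ⟨q', j, w'⟩ := c'
  obtain ⟨t, h1, h2, rfl⟩ := h
  dsimp only at h1 h2
  refine .head (.control (c' := .write i q (w i)) ?_ ⟨rfl, rfl, rfl, by simp [h1]⟩ trivial)
    (reaches_written.trans (.head (.control (c' := .read j q' _) (fun h => h.1)
      ⟨_, h1, rfl, h2⟩ rfl) reaches_read))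
  rintro ⟨⟨-, -, -, h3, -⟩, -⟩
  simp [h1] at h3

/-- A pending write is completed; without a transition it is stuck, otherwise it leads to a read.
Once a read is remembered, it is either a rejecting rest point or gives the control a loss, which a
reset removes. After the reset the run to the rejecting halt is replayed. -/
theorem exists_stuck (hM : ∃ q, ∃ i : Fin N, ∃ w, Reached M start (q, i, w) ∧
      M q (w i) = none ∧ accept q = false) (v : Act N Γ Λ × Act N Γ Λ × (Fin N → Γ)) :
    ∃ v', ReflTransGen (Step M accept start) v v' ∧ Stuck M accept start v' := by
  have reset : ∀ (d : Act N Γ Λ) w, ∃ v', ReflTransGen (Step M accept start) (reset, d, w) v' ∧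
      Stuck M accept start v' := by
    intro d w
    obtain ⟨q, i, w', ⟨i₀, h0, h1⟩, h2, h3⟩ := hM
    refine ⟨_, reaches_reset.trans ?_, stuck_read (start := start) h2 h3⟩
    refine .head (.control (c' := .read i₀ default (start i₀)) (fun h => h.1) ⟨h0, rfl⟩ rfl)
      (reaches_read.trans (ReflTransGen.lift' looking (fun _ _ => reaches_of_cyclicStep) _ _ h1))
  have read : ∀ i q a (d : Act N Γ Λ) w, ∃ v',
      ReflTransGen (Step M accept start) (read i q a, d, w) v' ∧ Stuck M accept start v' := by
    intro i q a d w
    by_cases h : (read i q a).Follows M accept (read i q a) ∧ (read i q a).Matches w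
    · obtain ⟨⟨-, -, -, h1, h2⟩, h3⟩ := h
      obtain rfl : a = w i := h3
      exact ⟨_, reaches_read, stuck_read h1 h2⟩
    · obtain ⟨v', h1, h2⟩ := reset (.read i q a) w
      exact ⟨v', (reaches_memory (c := .read i q a) trivial).trans
        (.head (.control (c' := .reset) h trivial trivial) h1), h2⟩
  obtain ⟨c, d, w⟩ := v
  rcases c with _ | ⟨i, q, a⟩ | ⟨i, q, a⟩
  · exact reset d w
  · exact read i q a d w
  · rcases ht : M q a with _ | t
    · exact ⟨_, reaches_written, stuck_write ht (by simp)⟩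
    · obtain ⟨j, hj⟩ := exists_headMoves t.2 i
      obtain ⟨v', h1, h2⟩ := read j t.1 _ (.write i q a) _
      exact ⟨v', reaches_written.trans
        (.head (.control (c' := .read j t.1 _) (fun h => h.1) ⟨t, ht, rfl, hj⟩ rfl) h1), h2⟩

end Act

namespace simulation

variable [DecidableEq Γ] [DecidableEq Λ] {k : ℕ} {code : Fin k ≃ Λ × Γ × Bool}

local notation "𝒢" => simulation M accept N start code

theorem exists_live (hN : 0 < N)
    (hM : ∀ q (i : Fin N) w, Act.Reached M start (q, i, w) → M q (w i) = none → accept q = true) :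
    ∃ s, (𝒢).Live s := by
  obtain ⟨s, hs⟩ := exists_view (code := code) (M := M) (accept := accept) (start := start)
    (.reset, .reset, fun i : Fin N => start i)
  refine ⟨s, fun s' hs' => ?_⟩
  have sound : Act.Sound M accept start (view s') := by
    induction hs' with
    | refl =>
      rw [hs]
      exact .clear
    | tail _ h ih => exact ih.step hM (step_of_move h)
  refine ⟨loss_le_one sound.matches sound.done, ?_⟩
  obtain ⟨v, hv⟩ := sound.exists_step hN hM
  obtain ⟨s'', h, -⟩ := exists_move hv
  exact ⟨s'', h⟩

theorem terminating (hM : ∃ q, ∃ i : Fin N, ∃ w, Act.Reached M start (q, i, w) ∧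
    M q (w i) = none ∧ accept q = false) : (𝒢).Terminating := by
  intro s
  obtain ⟨v, h1, h2, h3, h4, h5, h6⟩ := Act.exists_stuck (start := start) hM (view s)
  obtain ⟨s', h7, rfl⟩ := exists_moves h1
  exact ⟨s', h7, isEquilibrium h2 h3 h4 h5 h6⟩

end simulation
end Simulation
end SinkEquilibria

namespace SinkEquilibria
open Turing Relation

/-! ### Machines on a cyclic tape -/

section Cyclic

set_option linter.unusedSectionVars false

variable {Γ Λ : Type} [Inhabited Γ] [Inhabited Λ]

/-- A configuration on the cyclic tape with `N` cells represents the configuration `c` with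
the head on cell `m`, as far as the cells from `-P` to `P` are concerned. -/
structure Represents (P : ℤ) (N : ℕ) (c : TM0.Cfg Γ Λ) (m : ℤ) (v : Λ × Fin N × (Fin N → Γ)) :
    Prop where
  state : c.q = v.1
  bound : |m| ≤ P
  position : (N : ℤ) ∣ m - (v.2.1 : ℕ)
  tape : ∀ m', |m'| ≤ P → ∀ j : Fin N, (N : ℤ) ∣ m' - (j : ℕ) → v.2.2 j = c.Tape.nth (m' - m)

/-- The initial contents of the cyclic tape. -/
def startTape (symbol : Bool → Γ) (x : List Bool) (i : ℕ) : Γ := (x[i]?.map symbol).getD default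

variable {M : TM0.Machine Γ Λ} {P : ℤ} {N : ℕ}

/-- Positions between `-P` and `P` differ by less than `N`, so a cell of the cyclic tape stands for
at most one of them. -/
theorem eq_of_dvd_sub (hN : 2 * P + 1 ≤ N) {m m' i : ℤ} (hm : |m| ≤ P) (hm' : |m'| ≤ P)
    (h : (N : ℤ) ∣ m - i) (h' : (N : ℤ) ∣ m' - i) : m = m' := by
  have h1 : (N : ℤ) ∣ m - m' := by simpa using dvd_sub h h'
  have h2 := Int.eq_zero_of_abs_lt_dvd h1 (by rw [abs_le] at hm hm'; rw [abs_lt]; omega)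
  omega

theorem Represents.head_eq {c : TM0.Cfg Γ Λ} {m : ℤ} {v : Λ × Fin N × (Fin N → Γ)}
    (h : Represents P N c m v) : c.Tape.head = v.2.2 v.2.1 := by
  rw [h.tape m h.bound _ h.position, sub_self, Tape.nth_zero]

theorem Represents.step (hN : 2 * P + 1 ≤ N) {c c' : TM0.Cfg Γ Λ} {m : ℤ}
    {v v' : Λ × Fin N × (Fin N → Γ)} (h : Represents P N c m v) (hc : c' ∈ TM0.step M c)
    (hv : CyclicStep M v v') (hP : |m + headShift M c| ≤ P) :
    Represents P N c' (m + headShift M c) v' := by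
  have hhead := h.head_eq
  obtain ⟨hq, hb, hp, ht⟩ := h
  obtain ⟨q, T⟩ := c
  obtain ⟨q, i, w⟩ := v
  obtain ⟨q', j, w'⟩ := v'
  obtain ⟨t, h1, h2, rfl⟩ := hv
  dsimp only at hq hp ht h1 h2 hhead
  subst hq
  rcases t with (_ | _) | b
  · have hs : headShift M ⟨q, T⟩ = -1 := by simp [headShift, hhead, h1]
    simp only [TM0.step, hhead, h1, Option.map_some, Option.mem_def, Option.some.injEq] at hc
    subst hc
    rw [hs] at hP ⊢
    refine ⟨rfl, hP, ?_, fun m' hm' l hl => ?_⟩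
    · simp only [headMoves, Bool.or_eq_true, decide_eq_true_eq, Bool.and_eq_true] at h2
      dsimp only
      rcases h2 with h2 | ⟨h2, h3⟩
      · convert hp using 1
        omega
      · have h4 : m + -1 - (j : ℕ) = m - (i : ℕ) - N := by omega
        exact h4 ▸ dvd_sub hp dvd_rfl
    · dsimp only
      rw [Tape.move_left_nth, show m' - (m + -1) - 1 = m' - m by ring, ← ht m' hm' l hl]
      simp [written, h1]
  · have hs : headShift M ⟨q, T⟩ = 1 := by simp [headShift, hhead, h1]
    simp only [TM0.step, hhead, h1, Option.map_some, Option.mem_def, Option.some.injEq] at hc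
    subst hc
    rw [hs] at hP ⊢
    refine ⟨rfl, hP, ?_, fun m' hm' l hl => ?_⟩
    · simp only [headMoves, Bool.or_eq_true, decide_eq_true_eq, Bool.and_eq_true] at h2
      dsimp only
      rcases h2 with h2 | ⟨h2, h3⟩
      · convert hp using 1
        omega
      · have h4 : m + 1 - (j : ℕ) = m - (i : ℕ) + N := by omega
        exact h4 ▸ dvd_add hp dvd_rfl
    · dsimp only
      rw [Tape.move_right_nth, show m' - (m + 1) + 1 = m' - m by ring, ← ht m' hm' l hl]
      simp [written, h1]
  · have hs : headShift M ⟨q, T⟩ = 0 := by simp [headShift, hhead, h1]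
    simp only [TM0.step, hhead, h1, Option.map_some, Option.mem_def, Option.some.injEq] at hc
    subst hc
    simp only [headMoves, decide_eq_true_eq] at h2
    obtain rfl := Fin.ext h2
    rw [hs, add_zero] at hP ⊢
    refine ⟨rfl, hP, hp, fun m' hm' l hl => ?_⟩
    dsimp only
    rw [Tape.write_nth, ← ht m' hm' l hl]
    by_cases hl' : l = j
    · subst hl'
      simp [written, h1, eq_of_dvd_sub hN hm' hb hl hp]
    · rw [Function.update_of_ne hl', if_neg]
      intro h
      obtain rfl : m' = m := by omega
      refine hl' (Fin.ext ?_)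
      have hd : (N : ℤ) ∣ ((l : ℕ) : ℤ) - (j : ℕ) := by simpa using dvd_sub hp hl
      have := Int.eq_zero_of_abs_lt_dvd hd (by rw [abs_lt]; omega)
      omega

theorem nth_mk₁ (l : List Γ) (m : ℤ) :
    (Tape.mk₁ l).nth m = if 0 ≤ m then l[m.toNat]?.getD default else default := by
  rcases m with (_ | n) | n
  · simp [Tape.mk₁, Tape.mk₂, Tape.mk']
    cases l <;> rfl
  · have := Tape.mk'_nth_nat (ListBlank.mk []) (ListBlank.mk l) (n + 1)
    simp only [ListBlank.nth_mk] at this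
    rw [if_pos (by exact Int.natCast_nonneg (n + 1))]
    simpa [Tape.mk₁, Tape.mk₂, List.getI_eq_getElem?_getD] using this
  · simp [Tape.mk₁, Tape.mk₂, Tape.mk', Tape.nth]

/-- A negative position `m ≥ -P` lies on cell `N + m`, which is past the input because `N ≥ 2 * P +
1 + x.length`, and hence blank as it should be. -/
theorem represents_init {symbol : Bool → Γ} {x : List Bool} (hP : 0 ≤ P)
    (hN : 2 * P + 1 + x.length ≤ N) {i₀ : Fin N} (h₀ : (i₀ : ℕ) = 0) :
    Represents P N (TM0.init (x.map symbol) : TM0.Cfg Γ Λ) 0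
      (default, i₀, fun i => startTape symbol x i) := by
  refine ⟨rfl, by simpa, by simp [h₀], fun m hm j hj => ?_⟩
  simp only [TM0.init, nth_mk₁, sub_zero, startTape]
  rw [abs_le] at hm
  split_ifs with h
  · have hj' := Int.eq_zero_of_abs_lt_dvd hj (by rw [abs_lt]; omega)
    rw [show m.toNat = j by omega]
    simp
  · have : x.length ≤ j := by
      have hd : (N : ℤ) ∣ m - (j : ℕ) + N := dvd_add hj dvd_rfl
      have := Int.eq_zero_of_abs_lt_dvd hd (by rw [abs_lt]; omega)
      omega
    simp [this]

/-- The space bound applies to every configuration visited, so the representation survives each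
step. -/
theorem exists_visits_of_reached {symbol : Bool → Γ} {x : List Bool}
    (hN : 2 * P + 1 + x.length ≤ N)
    (hP : ∀ c k, Visits M (TM0.init (x.map symbol)) 0 c k → |k| ≤ P)
    {v : Λ × Fin N × (Fin N → Γ)} (hv : Act.Reached M (startTape symbol x) v) :
    ∃ c m, Visits M (TM0.init (x.map symbol)) 0 c m ∧ Represents P N c m v := by
  obtain ⟨i₀, h₀, h⟩ := hv
  induction h with
  | refl => exact ⟨_, 0, .refl, represents_init (by simpa using hP _ _ .refl) hN h₀⟩
  | @tail v v' _ h ih =>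
    obtain ⟨c, m, h1, h2⟩ := ih
    obtain ⟨t, ht, -⟩ := id h
    have hc : ∃ c', c' ∈ TM0.step M c := by
      rw [← h2.head_eq, ← h2.state] at ht
      simp [TM0.step, ht]
    obtain ⟨c', hc⟩ := hc
    have h3 : Visits M (TM0.init (x.map symbol)) 0 c' (m + headShift M c) :=
      ReflTransGen.tail h1 ⟨hc, rfl⟩
    exact ⟨c', _, h3, h2.step (by omega) hc h (hP _ _ h3)⟩

theorem exists_reached_of_visits {symbol : Bool → Γ} {x : List Bool}
    (hN : 2 * P + 1 + x.length ≤ N)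
    (hP : ∀ c k, Visits M (TM0.init (x.map symbol)) 0 c k → |k| ≤ P)
    {c : TM0.Cfg Γ Λ} {m : ℤ} (hc : Visits M (TM0.init (x.map symbol)) 0 c m) :
    ∃ v : Λ × Fin N × (Fin N → Γ), Act.Reached M (startTape symbol x) v ∧
      Represents P N c m v := by
  have hP₀ : 0 ≤ P := by simpa using hP _ _ .refl
  suffices ∀ a, ReflTransGen (fun a b : TM0.Cfg Γ Λ × ℤ =>
      b.1 ∈ TM0.step M a.1 ∧ b.2 = a.2 + headShift M a.1) (TM0.init (x.map symbol), 0) a →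
      ∃ v : Λ × Fin N × (Fin N → Γ), Act.Reached M (startTape symbol x) v ∧
        Represents P N a.1 a.2 v from this (c, m) hc
  intro a ha
  induction ha with
  | refl =>
    let i₀ : Fin N := ⟨0, by omega⟩
    exact ⟨_, ⟨i₀, rfl, .refl⟩, represents_init hP₀ hN rfl⟩
  | @tail a b h hab ih =>
    obtain ⟨⟨q, i, w⟩, ⟨i₀, h₀, h1⟩, h2⟩ := ih
    obtain ⟨c, m⟩ := a
    obtain ⟨c', m'⟩ := b
    obtain ⟨hc, rfl⟩ : c' ∈ TM0.step M c ∧ m' = m + headShift M c := hab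
    have h3 := hP c' _ (ReflTransGen.tail h ⟨hc, rfl⟩)
    obtain ⟨⟨q', t⟩, ht, -⟩ := Option.map_eq_some_iff.1 hc
    obtain ⟨j, hj⟩ := exists_headMoves t i
    have h4 : CyclicStep M (q, i, w) (q', j, Function.update w i (written M q (w i))) :=
      ⟨t, by rwa [← h2.state, ← h2.head_eq], hj, rfl⟩
    exact ⟨_, ⟨i₀, h₀, h1.tail h4⟩, h2.step (by omega) hc h4 h3⟩

theorem Visits.reaches {c c' : TM0.Cfg Γ Λ} {k k' : ℤ} (h : Visits M c k c' k') :
    TM0.Reaches M c c' :=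
  ReflTransGen.lift Prod.fst (fun _ _ h => h.1) _ _ h

theorem exists_visits {c c' : TM0.Cfg Γ Λ} (h : TM0.Reaches M c c') (k : ℤ) :
    ∃ k', Visits M c k c' k' := by
  induction h with
  | refl => exact ⟨k, .refl⟩
  | tail _ h ih =>
    obtain ⟨k', hk⟩ := ih
    exact ⟨_, ReflTransGen.tail hk ⟨h, rfl⟩⟩

theorem step_eq_none {c : TM0.Cfg Γ Λ} : TM0.step M c = none ↔ M c.q c.Tape.head = none := by
  simp [TM0.step]

variable {symbol : Bool → Γ} {accept : Set Λ} {x : List Bool} {A : Prop}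

/-- A halt on the cyclic tape represents a halting configuration of the machine, and by determinism
there is only one, namely `c`. -/
theorem accept_of_reached (hN : 2 * P + 1 + x.length ≤ N)
    (hP : ∀ c k, Visits M (TM0.init (x.map symbol)) 0 c k → |k| ≤ P)
    (hc : ∃ c, TM0.Reaches M (TM0.init (x.map symbol)) c ∧ TM0.step M c = none ∧
      (c.q ∈ accept ↔ A)) (hA : A)
    (q : Λ) (i : Fin N) (w : Fin N → Γ) (h : Act.Reached M (startTape symbol x) (q, i, w))
    (hq : M q (w i) = none) : q ∈ accept := by
  obtain ⟨c, h1, h2, h3⟩ := hc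
  obtain ⟨c', m, h4, h5⟩ := exists_visits_of_reached hN hP h
  have h6 : TM0.step M c' = none := by
    rw [step_eq_none, h5.head_eq, h5.state]
    exact hq
  obtain rfl : c' = c :=
    Part.mem_unique (StateTransition.mem_eval.2 ⟨h4.reaches, h6⟩)
      (StateTransition.mem_eval.2 ⟨h1, h2⟩)
  have h7 : c'.q = q := h5.state
  exact h7 ▸ h3.2 hA

theorem exists_reached_reject (hN : 2 * P + 1 + x.length ≤ N)
    (hP : ∀ c k, Visits M (TM0.init (x.map symbol)) 0 c k → |k| ≤ P)
    (hc : ∃ c, TM0.Reaches M (TM0.init (x.map symbol)) c ∧ TM0.step M c = none ∧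
      (c.q ∈ accept ↔ A)) (hA : ¬ A) :
    ∃ q, ∃ i : Fin N, ∃ w, Act.Reached M (startTape symbol x) (q, i, w) ∧
      M q (w i) = none ∧ q ∉ accept := by
  obtain ⟨c, h1, h2, h3⟩ := hc
  obtain ⟨m, hm⟩ := exists_visits h1 0
  obtain ⟨⟨q, i, w⟩, h4, h5⟩ := exists_reached_of_visits hN hP hm
  rw [step_eq_none, h5.head_eq, h5.state] at h2
  exact ⟨q, i, w, h4, h2, fun h => hA (h3.1 (h5.state ▸ h))⟩

end Cyclic
end SinkEquilibria

namespace SinkEquilibria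
open Relation

/-! ### Markets that implement loss games -/

theorem MarketFrame.mem_won (F : MarketFrame) {S : Fin F.n → Finset (Fin F.m)} {x : Fin F.n}
    {y : Fin F.m} :
    y ∈ F.won S x ↔ (F.pref y).find? (fun x => decide (y ∈ S x)) = some x := by
  rw [won, Finset.mem_filter_univ]
  rfl

namespace LossGame

variable (L : LossGame)

theorem loss_update (s : L.Profile) (x : Fin L.n) (b : L.Strategy) :
    L.loss x (Function.update s x b) = (Finset.univ.filter fun z => L.bad x b z (s z)).card := by
  rw [loss]
  congr 1
  ext z
  by_cases hz : z = x
  · subst hz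
    simp [L.bad_self]
  · simp [hz]

theorem loss_le (s : L.Profile) (x : Fin L.n) : L.loss x s ≤ L.n :=
  (Finset.card_filter_le _ _).trans_eq (by simp)

/-- The list of all strategies. -/
def strategies : List L.Strategy :=
  (List.finRange L.J).flatMap fun j => (List.finRange L.k).map fun c => (j, c)

@[simp]
theorem mem_strategies (a : L.Strategy) : a ∈ L.strategies := by
  simp [strategies, Prod.ext_iff]

/-- The passive agents of the market. -/
abbrev Item : Type := Fin (L.n * (L.J * L.k * (L.n * 2)))

/-- The meaning of the passive agents: `item (x, a, z, 0)` is preferably won by `z`, which thereby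
takes it away from the player `x` with the strategy `a`, and `item (x, a, z, 1)` is its substitute
for `z` in case that `z` does not hinder `x`. -/
def item : Fin L.n × L.Strategy × Fin L.n × Fin 2 ≃ L.Item :=
  (Equiv.prodCongr (.refl _)
    ((Equiv.prodCongr finProdFinEquiv finProdFinEquiv).trans finProdFinEquiv)).trans
    finProdFinEquiv

/-- `0` or `1`, according to whether `b` is bad or not. -/
def flag (x : Fin L.n) (a : L.Strategy) (z : Fin L.n) (b : L.Strategy) : Fin 2 :=
  if L.bad x a z b then 0 else 1

/-- The set of passive agents that stands for the strategy `b` of `x`. -/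
def bundle (x : Fin L.n) (b : L.Strategy) : List L.Item :=
  ((List.finRange L.n).map fun w => L.item (x, b, w, 0)) ++
    (List.finRange L.n).flatMap fun x' => L.strategies.map fun a =>
      L.item (x', a, x, L.flag x' a x b)

theorem mem_bundle {x' z x : Fin L.n} {a b : L.Strategy} {f : Fin 2} :
    L.item (x', a, z, f) ∈ L.bundle x b ↔
      x' = x ∧ a = b ∧ f = 0 ∨ z = x ∧ f = L.flag x' a x b := by
  simp [bundle]
  grind

/-- The generators of the strategies of `x`. -/
def generators (x : Fin L.n) : List (List L.Item) :=
  L.strategies.map (L.bundle x) ++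
    -- A bundle of `x` need not exist for either flag. The singletons let `x` play these items in
    -- any case, so that preference lists do not depend on `bad`.
    (List.finRange L.n).flatMap fun x' => L.strategies.flatMap fun a =>
      [[L.item (x', a, x, 0)], [L.item (x', a, x, 1)]]

theorem mem_generators {x : Fin L.n} {A : List L.Item} :
    A ∈ L.generators x ↔ (∃ b, A = L.bundle x b) ∨ ∃ x' a f, A = [L.item (x', a, x, f)] := by
  simp [generators, eq_comm, Fin.exists_fin_two]

/-- The preference list of an item. -/
def ranking (t : Fin L.n × L.Strategy × Fin L.n × Fin 2) : List (Fin L.n) :=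
  if t.2.2.2 = 0 then if t.1 = t.2.2.1 then [t.1] else [t.2.2.1, t.1] else [t.2.2.1]

/-- The market. -/
def market : MarketFrame where
  n := L.n
  m := L.n * (L.J * L.k * (L.n * 2))
  gens := L.generators
  gens_ne x := by
    obtain ⟨b⟩ := L.nonempty
    exact List.ne_nil_of_mem (L.mem_generators.2 (Or.inl ⟨b, rfl⟩))
  pref y := L.ranking (L.item.symm y)
  pref_nodup y := by
    unfold ranking
    split_ifs <;> simp
    grind
  mem_pref x y := by
    obtain ⟨⟨x', a, z, f⟩, rfl⟩ := L.item.surjective y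
    simp only [mem_generators, ranking, Equiv.symm_apply_apply]
    constructor
    · intro h
      by_cases hz : x = z
      · subst hz
        exact ⟨_, Or.inr ⟨x', a, f, rfl⟩, by simp⟩
      · refine ⟨_, Or.inl ⟨a, rfl⟩, L.mem_bundle.2 (Or.inl ?_)⟩
        split_ifs at h with h1 h2 <;> simp_all
    · rintro ⟨A, ⟨b, rfl⟩ | ⟨x'', a', f', rfl⟩, h⟩
      · rw [mem_bundle] at h
        split_ifs with h1 h2 <;> simp_all <;> tauto
      · rw [List.mem_singleton, L.item.injective.eq_iff] at h
        simp only [Prod.mk.injEq] at h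
        obtain ⟨rfl, rfl, rfl, rfl⟩ := h
        split_ifs <;> simp_all

/-- The set of items that a player wins. -/
def won (S : Fin L.n → Finset L.Item) (x : Fin L.n) : Finset L.Item := L.market.won S x

/-- The game on the market in which every item has the value one. -/
noncomputable def marketGame : StrategicGame L.n :=
  L.market.game fun _ T => (T.card : ℝ)

variable {L}

/-- The items of a strategy. -/
def items {x : Fin L.n} (t : L.marketGame.Strat x) : Finset L.Item := t.1

/-- The sets that are played. -/
def sets (S : L.marketGame.State) (x : Fin L.n) : Finset L.Item := items (S x)

variable (L) in
/-- The set of items that stands for a strategy. -/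
def full (x : Fin L.n) (b : L.Strategy) : Finset L.Item := (L.bundle x b).toFinset

theorem mem_full {x' z x : Fin L.n} {a b : L.Strategy} {f : Fin 2} :
    L.item (x', a, z, f) ∈ L.full x b ↔
      x' = x ∧ a = b ∧ f = 0 ∨ z = x ∧ f = L.flag x' a x b := by
  rw [full, List.mem_toFinset]
  exact L.mem_bundle

theorem full_feasible (x : Fin L.n) (b : L.Strategy) : L.full x b ∈ L.market.feasible x :=
  ⟨_, L.mem_generators.2 (Or.inl ⟨b, rfl⟩), subset_rfl⟩

variable (L) in
/-- The market strategy that stands for a strategy. -/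
def fullStrat (x : Fin L.n) (b : L.Strategy) : L.marketGame.Strat x :=
  ⟨L.full x b, full_feasible x b⟩

theorem feasible_cases {x : Fin L.n} (s : L.marketGame.Strat x) :
    (∃ b, items s ⊆ L.full x b) ∨ (items s).card ≤ 1 := by
  obtain ⟨s, A, hA, hs⟩ := s
  rcases L.mem_generators.1 hA with ⟨b, rfl⟩ | ⟨x', a, f, rfl⟩
  · exact Or.inl ⟨b, hs⟩
  · exact Or.inr ((Finset.card_le_card hs).trans (List.toFinset_card_le _))

theorem sets_update (S : L.marketGame.State) (x : Fin L.n) (s : L.marketGame.Strat x) :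
    sets (Function.update S x s) = Function.update (sets S) x (items s) := by
  funext z
  exact Function.apply_update (fun _ t => items t) S x s z

theorem mem_won {S : Fin L.n → Finset L.Item} {x x' z : Fin L.n} {a : L.Strategy}
    {f : Fin 2} : L.item (x', a, z, f) ∈ L.won S x ↔ L.item (x', a, z, f) ∈ S x ∧
      (z = x ∨ x' = x ∧ f = 0 ∧ L.item (x', a, z, f) ∉ S z) := by
  have h : L.item (x', a, z, f) ∈ L.won S x ↔
      (L.ranking (L.item.symm (L.item (x', a, z, f)))).find?
        (fun x => decide (L.item (x', a, z, f) ∈ S x)) = some x :=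
    L.market.mem_won
  rw [h, Equiv.symm_apply_apply, ranking]
  dsimp only
  split_ifs with h1 h2 <;> simp only [List.find?] <;> grind

/-- The items that the player `x` with the set `T` wins, if the others play according to `s`. -/
def gain (s : L.Profile) (x : Fin L.n) (T : Finset L.Item) :
    Finset L.Item :=
  T.filter fun y => (L.item.symm y).2.2.1 = x ∨ (L.item.symm y).1 = x ∧
    (L.item.symm y).2.2.2 = 0 ∧
      L.bad x (L.item.symm y).2.1 (L.item.symm y).2.2.1 (s (L.item.symm y).2.2.1) = false

theorem mem_gain {s : L.Profile} {x x' z : Fin L.n} {T : Finset L.Item}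
    {a : L.Strategy} {f : Fin 2} : L.item (x', a, z, f) ∈ gain s x T ↔
      L.item (x', a, z, f) ∈ T ∧ (z = x ∨ x' = x ∧ f = 0 ∧ L.bad x a z (s z) = false) := by
  simp [gain]

/-- The set `T` of items stands for the strategy `b`; it may lack some items that are taken away
by other players. -/
def Plays (x : Fin L.n) (b : L.Strategy) (T : Finset L.Item) : Prop :=
  T ⊆ L.full x b ∧ ∀ x' a f, L.item (x', a, x, f) ∈ L.full x b → L.item (x', a, x, f) ∈ T

theorem plays_full (x : Fin L.n) (b : L.Strategy) : Plays x b (L.full x b) :=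
  ⟨subset_rfl, fun _ _ _ h => h⟩

theorem gain_subset (s : L.Profile) (x : Fin L.n) (T : Finset L.Item) : gain s x T ⊆ T :=
  Finset.filter_subset _ _

/-- The items that `Plays` allows another player to omit are never ones for which he is preferred.
Hence what he takes away depends only on the strategy that he stands for. -/
theorem won_eq_gain {S : Fin L.n → Finset L.Item} {s : L.Profile} {x : Fin L.n}
    (h : ∀ z, z ≠ x → Plays z (s z) (S z)) : L.won S x = gain s x (S x) := by
  ext y
  obtain ⟨⟨x', a, z, f⟩, rfl⟩ := L.item.surjective y
  rw [mem_won, mem_gain]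
  refine and_congr_right fun _ => ?_
  by_cases hz : z = x
  · simp [hz]
  simp only [hz, false_or]
  refine and_congr_right fun hx => and_congr_right fun hf => ?_
  subst hx hf
  have h1 : L.item (x', a, z, 0) ∈ S z ↔ L.item (x', a, z, 0) ∈ L.full z (s z) :=
    ⟨fun h' => (h z hz).1 h', fun h' => (h z hz).2 _ _ _ h'⟩
  rw [h1, mem_full]
  simp [flag, Ne.symm hz]

theorem gain_mono {s : L.Profile} {x : Fin L.n} {T T' : Finset L.Item} (h : T ⊆ T') :
    gain s x T ⊆ gain s x T' :=
  Finset.filter_subset_filter _ h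

/-- The number of items that a player without losses wins. -/
def reward (L : LossGame) : ℕ := L.n * (L.J * L.k) + L.n

/-- The items in which `x` is preferred number `n * (J * k)` besides his own `item (x, b, x, 0)`,
since each flag selects exactly one of two. Of the `n` items `item (x, b, z, 0)`, those with
hindering `z` are lost. -/
theorem card_gain_full (s : L.Profile) (x : Fin L.n) (b : L.Strategy) :
    (gain s x (L.full x b)).card + L.loss x (Function.update s x b) = L.reward := by
  classical
  have h : gain s x (L.full x b) =
      (Finset.univ.filter fun z => ¬ L.bad x b z (s z) = true).image
        (fun z => L.item (x, b, z, 0)) ∪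
      (Finset.univ : Finset (Fin L.n × L.Strategy)).image
        (fun p => L.item (p.1, p.2, x, L.flag p.1 p.2 x b)) := by
    ext y
    obtain ⟨⟨x', a, z, f⟩, rfl⟩ := L.item.surjective y
    rw [mem_gain, mem_full]
    simp only [Finset.mem_union, Finset.mem_image, Finset.mem_filter, Finset.mem_univ, true_and,
      L.item.injective.eq_iff, Prod.mk.injEq, Prod.exists]
    constructor
    · rintro ⟨⟨rfl, rfl, rfl⟩ | ⟨rfl, rfl⟩, h⟩
      · left
        refine ⟨z, ?_, rfl, rfl, rfl, rfl⟩
        rcases h with rfl | h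
        · simp [L.bad_self]
        · simp [h.2.2]
      · exact Or.inr ⟨x', a.1, a.2, rfl, rfl, rfl, rfl⟩
    · rintro (⟨z, h, rfl, rfl, rfl, rfl⟩ | ⟨x', j, c, rfl, rfl, rfl, rfl⟩)
      · simpa using Or.inr h
      · simp
  have h1 : Function.Injective fun z => L.item (x, b, z, 0) := fun z z' h => by
    simpa using h
  have h2 : Function.Injective fun p : Fin L.n × L.Strategy =>
      L.item (p.1, p.2, x, L.flag p.1 p.2 x b) := fun p p' h => by
    simp only [L.item.injective.eq_iff, Prod.mk.injEq] at h
    exact Prod.ext h.1 h.2.1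
  rw [h, Finset.card_union_of_disjoint, Finset.card_image_of_injective _ h1,
    Finset.card_image_of_injective _ h2, loss_update]
  · have := Finset.card_filter_add_card_filter_not (s := (Finset.univ : Finset (Fin L.n)))
      (fun z => L.bad x b z (s z) = true)
    simp only [Finset.card_univ, Fintype.card_fin, Fintype.card_prod] at this ⊢
    simp only [reward]
    omega
  -- A common item would be `item (x, b, x, 0)` with `x` hindering himself, against `bad_self`.
  · rw [Finset.disjoint_left]
    simp only [Finset.mem_image, Finset.mem_filter, Finset.mem_univ, true_and, Prod.exists,
      not_exists]
    rintro _ ⟨z, -, rfl⟩ x' j c h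
    simp only [L.item.injective.eq_iff, Prod.mk.injEq] at h
    obtain ⟨rfl, rfl, rfl, h⟩ := h
    simp [flag, L.bad_self] at h

theorem card_gain_le {s : L.Profile} {x : Fin L.n} {b : L.Strategy}
    {T : Finset L.Item} (h : T ⊆ L.full x b) :
    (gain s x T).card + L.loss x (Function.update s x b) ≤ L.reward := by
  have := Finset.card_le_card (gain_mono (s := s) (x := x) h)
  have := card_gain_full s x b
  omega

theorem won_subset (S : Fin L.n → Finset L.Item) (x : Fin L.n) :
    L.won S x ⊆ S x := fun y hy => by
  obtain ⟨⟨x', a, z, f⟩, rfl⟩ := L.item.surjective y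
  exact (mem_won.1 hy).1

theorem utility_update {S : L.marketGame.State} {s : L.Profile} {x : Fin L.n}
    (h : ∀ z, z ≠ x → Plays z (s z) (sets S z)) (t : L.marketGame.Strat x) :
    L.marketGame.utility x (Function.update S x t) = ((gain s x (items t)).card : ℝ) := by
  have h1 : L.won (Function.update (sets S) x (items t)) x = gain s x (items t) := by
    rw [won_eq_gain (s := s), Function.update_self]
    intro z hz
    rw [Function.update_of_ne hz]
    exact h z hz
  rw [← h1, ← sets_update]
  rfl

theorem utility_eq {S : L.marketGame.State} {s : L.Profile}
    (h : ∀ z, Plays z (s z) (sets S z)) (x : Fin L.n) :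
    L.marketGame.utility x S = ((gain s x (sets S x)).card : ℝ) := by
  simpa [sets] using utility_update (x := x) (fun z _ => h z) (S x)

theorem plays_update {S : L.marketGame.State} {s : L.Profile} {x : Fin L.n} {b : L.Strategy}
    {t : L.marketGame.Strat x} (h : ∀ z, z ≠ x → Plays z (s z) (sets S z))
    (ht : Plays x b (items t)) (z : Fin L.n) :
    Plays z (Function.update s x b z) (sets (Function.update S x t) z) := by
  rw [sets_update]
  by_cases hz : z = x
  · subst hz
    simpa using ht
  · simpa [hz] using h z hz

/-- Completing a part of a bundle strictly helps if an item is missing for which `x` is preferred,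
and a singleton is worth less than any bundle. -/
theorem exists_plays (S : L.marketGame.State) (x : Fin L.n) :
    ∃ t : L.marketGame.Strat x, ReflTransGen L.marketGame.Arc S (Function.update S x t) ∧
      ∃ b, Plays x b (items t) := by
  suffices (∃ b, Plays x b (sets S x)) ∨
      ∃ b, (L.won (sets S) x).card < (L.won (Function.update (sets S) x (L.full x b)) x).card by
    rcases this with h | ⟨b, h⟩
    · exact ⟨S x, by rw [Function.update_eq_self], h⟩
    · refine ⟨fullStrat L x b, .single (StrategicGame.arc_update ?_), b, plays_full x b⟩
      have h' : ((L.won (sets S) x).card : ℝ) <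
        (L.won (sets (Function.update S x (fullStrat L x b))) x).card := by
        rw [sets_update]
        exact_mod_cast h
      exact h'
  rcases feasible_cases (S x) with ⟨b, hb⟩ | h
  · by_cases hp : Plays x b (sets S x)
    · exact Or.inl ⟨b, hp⟩
    · refine Or.inr ⟨b, Finset.card_lt_card ?_⟩
      have : ∃ x' a f, L.item (x', a, x, f) ∈ L.full x b ∧ L.item (x', a, x, f) ∉ (sets S x) := by
        by_contra hne
        push Not at hne
        exact hp ⟨hb, hne⟩
      obtain ⟨x', a, f, h1, h2⟩ := this
      rw [Finset.ssubset_iff_of_subset]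
      · exact ⟨_, mem_won.2 ⟨by simpa using h1, Or.inl rfl⟩, fun h => h2 (mem_won.1 h).1⟩
      · intro y hy
        obtain ⟨⟨x'', a', z, f'⟩, rfl⟩ := L.item.surjective y
        rw [mem_won] at hy ⊢
        rw [Function.update_self]
        refine ⟨hb hy.1, ?_⟩
        by_cases hz : z = x
        · exact Or.inl hz
        · rw [Function.update_of_ne hz]
          exact hy.2
  · obtain ⟨b⟩ := L.nonempty
    refine Or.inr ⟨b, ((Finset.card_le_card (won_subset _ _)).trans h).trans_lt ?_⟩
    rw [Finset.one_lt_card]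
    -- These two items are won by `x` whatever the others play.
    refine ⟨L.item (x, b, x, 0), mem_won.2 ⟨?_, Or.inl rfl⟩,
      L.item (x, b, x, 1), mem_won.2 ⟨?_, Or.inl rfl⟩, by simp⟩
    · rw [Function.update_self, mem_full]
      exact Or.inl ⟨rfl, rfl, rfl⟩
    · rw [Function.update_self, mem_full]
      exact Or.inr ⟨rfl, by simp [flag, L.bad_self]⟩

/-- A complete bundle always wins at least one item, so passing to a singleton is never an
improvement. -/
theorem loss_lt_reward (s : L.Profile) (x : Fin L.n) : L.loss x s < L.reward := by
  have h1 := L.loss_le s x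
  have h2 : 0 < L.n * (L.J * L.k) := by
    obtain ⟨j, c⟩ := L.nonempty
    exact Nat.mul_pos x.pos (Nat.mul_pos j.pos c.pos)
  rw [reward]
  omega

theorem plays_state (s : L.Profile) (z : Fin L.n) :
    Plays z (s z) (sets (fun x => fullStrat L x (s x)) z) :=
  plays_full z (s z)

theorem card_gain_self (s : L.Profile) (x : Fin L.n) :
    (gain s x (L.full x (s x))).card + L.loss x s = L.reward := by
  simpa using card_gain_full s x (s x)

/-- The market implements the loss game. -/
noncomputable def marketImplementation : L.Implementation L.marketGame where
  Rel S s := ∀ x, Plays x (s x) (sets S x)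
  state s x := fullStrat L x (s x)
  rel_state := plays_state
  exists_reaches S := by
    obtain ⟨S', h1, -, h2⟩ := StrategicGame.exists_reaches_forall (I := fun _ => True)
      (P := fun x (t : L.marketGame.Strat x) => ∃ b, Plays x b (items t)) (fun S _ x => by simpa using exists_plays S x) S trivial
    choose s hs using h2
    exact ⟨S', s, h1, hs⟩
  exists_arc {S s x a} h h1 h2 := by
    refine ⟨_, StrategicGame.arc_update (i := x) (a := fullStrat L x a) ?_, fun z => ?_⟩
    · rw [utility_update (fun z _ => h z), utility_eq h]
      have h3 := card_gain_full s x a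
      have h4 := card_gain_le (s := s) (h x).1
      rw [Function.update_eq_self] at h4
      have : (gain s x (sets S x)).card < (gain s x (items (fullStrat L x a))).card :=
        show (gain s x (sets S x)).card < (gain s x (L.full x a)).card by omega
      exact_mod_cast this
    · exact plays_update (fun z _ => h z) (plays_full x a) z
  exists_reaches_equilibrium {S s} h he := by
    obtain ⟨S', h1, h2, h3⟩ := StrategicGame.exists_reaches_forall
      (I := fun S => ∀ x, Plays x (s x) (sets S x))
      -- Every player brings his gain up to that of the complete bundle. All continue to play `s`,
      -- so this does not affect the gains of the others.
      (P := fun x (t : L.marketGame.Strat x) => (gain s x (items t)).card + L.loss x s = L.reward) (fun S hS x => by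
        by_cases hx : (gain s x (sets S x)).card + L.loss x s = L.reward
        · exact ⟨S x, by rw [Function.update_eq_self], by rwa [Function.update_eq_self], hx⟩
        · refine ⟨fullStrat L x (s x), .single (StrategicGame.arc_update ?_), fun z => ?_,
            card_gain_self s x⟩
          · rw [utility_update (fun z _ => hS z), utility_eq hS]
            have h3 := card_gain_self s x
            have h4 := card_gain_le (s := s) (hS x).1
            rw [Function.update_eq_self] at h4
            have h5 : (gain s x (sets S x)).card + L.loss x s ≠ L.reward := hx
            have : (gain s x (sets S x)).card < (gain s x (items (fullStrat L x (s x)))).card :=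
              show (gain s x (sets S x)).card < (gain s x (L.full x (s x))).card by omega
            exact_mod_cast this
          · simpa using plays_update (t := fullStrat L x (s x)) (fun z _ => hS z)
              (plays_full x (s x)) z) S h
    refine ⟨S', h1, fun S'' h4 => ?_⟩
    obtain ⟨x, h5, h6⟩ := h4.eq_update
    generalize S'' x = t at h5
    subst h5
    rw [utility_update (fun z _ => h2 z), utility_eq h2, Nat.cast_lt] at h6
    have h7 : (gain s x (sets S' x)).card + L.loss x s = L.reward := h3 x
    rcases feasible_cases t with ⟨b, hb⟩ | ht
    · have h8 := card_gain_le (s := s) hb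
      have h9 := he x b
      omega
    · have h8 := (Finset.card_le_card (gain_subset s x (items t))).trans ht
      have h9 := loss_lt_reward s x
      omega
  move_of_arc {s S'} h h1 := by
    obtain ⟨x, h5, h6⟩ := h1.eq_update
    generalize S' x = t at h5
    subst h5
    rw [utility_update (fun z _ => plays_state s z), utility_eq (plays_state s), Nat.cast_lt] at h6
    have h6 : (gain s x (L.full x (s x))).card < (gain s x (items t)).card := h6
    have h7 := card_gain_self s x
    have h2 := h x
    rcases feasible_cases t with ⟨b, hb⟩ | ht
    · have h8 := card_gain_le (s := s) hb
      have h9 := card_gain_full s x b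
      -- The old gain is at least `reward - 1`, so the new one is `reward`: the old loss was one and
      -- the new one is zero.
      refine ⟨_, ⟨x, b, by omega, rfl, by omega⟩, ?_⟩
      have h10 : L.loss x (Function.update s x b) = 0 := by omega
      -- Without loss every item of the bundle is won, so leaving one out would cost utility.
      have h11 : t = fullStrat L x b := by
        refine Subtype.ext (hb.antisymm fun y hy => ?_)
        have h12 : gain s x (items t) = gain s x (L.full x b) :=
          Finset.eq_of_subset_of_card_le (gain_mono hb) (by omega)
        refine (Finset.mem_filter.1 (h12 ▸ ?_ : y ∈ gain s x (items t))).1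
        obtain ⟨⟨x', a, z, f⟩, rfl⟩ := L.item.surjective y
        refine mem_gain.2 ⟨hy, ?_⟩
        rcases mem_full.1 hy with ⟨rfl, rfl, rfl⟩ | ⟨rfl, -⟩
        · by_cases hz : z = x'
          · exact Or.inl hz
          · exact Or.inr ⟨rfl, rfl, loss_update_eq_zero_iff.1 h10 z hz⟩
        · exact Or.inl rfl
      funext z
      by_cases hz : z = x
      · subst hz
        simp [h11]
      · simp [hz]
    · have h8 := (Finset.card_le_card (gain_subset s x (items t))).trans ht
      have h9 := loss_lt_reward s x
      omega

instance : Finite L.marketGame.State :=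
  inferInstanceAs (Finite (∀ x, {s : Finset (Fin L.market.m) // s ∈ L.market.feasible x}))

end LossGame
end SinkEquilibria

namespace SinkEquilibria
open Relation

/-! ### Represented set functions -/

namespace SetPoly

variable {α β : Type} [DecidableEq α]

theorem eval_append (p q : SetPoly α) (T : Finset α) :
    SetPoly.eval (p ++ q) T = p.eval T + q.eval T := by
  simp [eval]

theorem eval_cons (t : ℤ × List α) (p : SetPoly α) (T : Finset α) :
    SetPoly.eval (t :: p) T = (if t.2.toFinset ⊆ T then t.1 else 0) + p.eval T := by
  simp [eval]

theorem eval_flatMap (l : List β) (f : β → SetPoly α) (T : Finset α) :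
    SetPoly.eval (l.flatMap f) T = (l.map fun b => (f b).eval T).sum := by
  induction l with
  | nil => rfl
  | cons b l ih => simp [eval_append, ih]

theorem eval_finRange {n : ℕ} (f : Fin n → SetPoly α) (T : Finset α) :
    SetPoly.eval ((List.finRange n).flatMap f) T = ∑ i, (f i).eval T := by
  rw [eval_flatMap, Fin.sum_univ_def]

theorem eval_const (l : List β) (T : Finset α) :
    SetPoly.eval (l.map fun _ => (1, [])) T = l.length := by
  simp [eval]

/-- With unit coefficients the number of terms bounds the value, which makes a constant social
function large enough. -/
theorem eval_le_length {p : SetPoly α} (h : ∀ t ∈ p, t.1 = 1) (T : Finset α) :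
    p.eval T ≤ p.length := by
  induction p with
  | nil => simp [eval]
  | cons t p ih =>
    have h1 := ih fun t ht => h t (List.mem_cons_of_mem _ ht)
    have h2 := h t List.mem_cons_self
    rw [eval_cons, h2, List.length_cons]
    split_ifs <;> push_cast <;> omega

end SetPoly

namespace LossGame

variable (L : LossGame)

/-! ### Instances of market games -/

/-- The market as a uniform utility-based market. -/
def uniformMarket : UniformMarket := { L.market with value := fun _ => 1 }

theorem uniformMarket_game : L.uniformMarket.game = L.marketGame := by
  simp only [UniformMarket.game, marketGame, uniformMarket, Nat.cast_one, Finset.sum_const,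
    nsmul_eq_mul, mul_one]

/-- The market as a many-to-one market. -/
def manyToOneMarket : ManyToOneMarket :=
  { L.market with util := fun _ => (List.finRange L.market.m).flatMap fun y => [(1, [y])] }

theorem manyToOneMarket_game : L.manyToOneMarket.game = L.marketGame := by
  have (T : Finset (Fin L.market.m)) :
      SetPoly.eval ((List.finRange L.market.m).flatMap fun y => [(1, [y])]) T = (T.card : ℤ) := by
    rw [SetPoly.eval_finRange]
    simp [SetPoly.eval]
  have h (T : Finset (Fin L.market.m)) : ((SetPoly.eval
      ((List.finRange L.market.m).flatMap fun y => [(1, [y])]) T : ℤ) : ℝ) = T.card := by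
    rw [this, Int.cast_natCast]
  exact congrArg L.market.game (funext fun x => funext h)

/-! ### Valid-utility games that implement loss games -/

/-- The utility of a player: one unit for playing and one unit for each player that does not hinder
him. -/
def payoff (x : Fin L.n) : SetPoly (Fin L.n × Fin (L.J * L.k)) :=
  (List.finRange L.J).flatMap fun j => (List.finRange L.k).flatMap fun c =>
    (1, [(x, finProdFinEquiv (j, c))]) :: (List.finRange L.n).flatMap fun z =>
      (List.finRange L.J).flatMap fun j' => (List.finRange L.k).flatMap fun c' =>
        if L.bad x (j, c) z (j', c') then []
        else [(1, [(x, finProdFinEquiv (j, c)), (z, finProdFinEquiv (j', c'))])]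

theorem payoff_coeff {x : Fin L.n} : ∀ t ∈ L.payoff x, t.1 = 1 := by
  intro t ht
  simp only [payoff, List.mem_flatMap, List.mem_cons, List.mem_finRange, true_and] at ht
  obtain ⟨j, c, rfl | ⟨z, j', c', ht⟩⟩ := ht
  · rfl
  · split_ifs at ht <;> simp_all

theorem eval_payoff (x : Fin L.n) (S : Fin L.n → Finset (Fin (L.J * L.k))) :
    (L.payoff x).eval (incidence S) = ∑ a : L.Strategy, if finProdFinEquiv a ∈ S x then
      1 + ∑ z, ∑ b : L.Strategy, (if finProdFinEquiv b ∈ S z then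
        if L.bad x a z b then 0 else 1 else 0) else 0 := by
  simp only [payoff, SetPoly.eval_finRange, SetPoly.eval_cons, Fintype.sum_prod_type]
  refine Finset.sum_congr rfl fun j _ => Finset.sum_congr rfl fun c _ => ?_
  by_cases h : finProdFinEquiv (j, c) ∈ S x
  · simp only [h, if_true]
    congr 1
    · simp [incidence, h]
    · refine Finset.sum_congr rfl fun z _ => Finset.sum_congr rfl fun j' _ =>
        Finset.sum_congr rfl fun c' _ => ?_
      split_ifs with h1 h2 h2
      · rfl
      · rfl
      · simp [SetPoly.eval, incidence, h, h2, Finset.insert_subset_iff]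
      · simp [SetPoly.eval, incidence, h, h2, Finset.insert_subset_iff]
  · simp only [h, if_false]
    rw [if_neg (by simp [incidence, h]), zero_add]
    refine Finset.sum_eq_zero fun z _ => Finset.sum_eq_zero fun j' _ =>
      Finset.sum_eq_zero fun c' _ => ?_
    split_ifs <;> simp [SetPoly.eval, incidence, h, Finset.insert_subset_iff]

/-- The social function is constant. -/
def welfare : SetPoly (Fin L.n × Fin (L.J * L.k)) :=
  (List.finRange L.n).flatMap fun x => (L.payoff x).map fun _ => (1, [])

theorem eval_welfare (T : Finset (Fin L.n × Fin (L.J * L.k))) :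
    L.welfare.eval T = ∑ x, ((L.payoff x).length : ℤ) := by
  simp only [welfare, SetPoly.eval_finRange, SetPoly.eval_const]

/-- The valid-utility game. -/
def validUtility : ValidUtilityInstance where
  n := L.n
  m := L.J * L.k
  strats _ := [] :: (List.finRange (L.J * L.k)).map fun a => [a]
  empty_mem _ := List.mem_cons_self
  util := L.payoff
  social := L.welfare
  valid :=
    { nonneg := fun S => by
        rw [eval_welfare]
        exact_mod_cast Nat.zero_le _
      mono := fun S S' _ => by simp only [eval_welfare, le_refl]
      submodular := fun S S' => by simp only [eval_welfare, le_refl]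
      -- The social function is constant, so contributions vanish and it suffices that utilities are
      -- non-negative.
      contribution := fun S _ i => by
        simp only [eval_welfare, sub_self, eval_payoff]
        norm_cast
        refine Finset.sum_nonneg fun a _ => ?_
        split_ifs
        · refine add_nonneg zero_le_one (Finset.sum_nonneg fun z _ => Finset.sum_nonneg fun b _ => ?_)
          split_ifs <;> norm_num
        · rfl
      sum_le := fun S _ => by
        rw [eval_welfare]
        exact_mod_cast Finset.sum_le_sum fun x (_ : x ∈ Finset.univ) =>
          SetPoly.eval_le_length (L.payoff_coeff (x := x)) (incidence S) }

variable {L}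

variable (L) in
/-- The game of the instance. -/
noncomputable def payoffGame : StrategicGame L.n := L.validUtility.game

/-- The set of elements of a strategy. -/
def elements {x : Fin L.n} (t : L.payoffGame.Strat x) : Finset (Fin (L.J * L.k)) := t.1

variable (L) in
/-- No action. -/
def idle (x : Fin L.n) : L.payoffGame.Strat x := ⟨∅, [], List.mem_cons_self, rfl⟩

variable (L) in
/-- The strategy in the valid-utility game that stands for a strategy in the loss game. -/
def unitStrat (x : Fin L.n) (b : L.Strategy) : L.payoffGame.Strat x :=
  ⟨{finProdFinEquiv b}, [finProdFinEquiv b],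
    List.mem_cons_of_mem _ (List.mem_map.2 ⟨_, List.mem_finRange _, rfl⟩), rfl⟩

theorem strat_cases {x : Fin L.n} (t : L.payoffGame.Strat x) :
    t = idle L x ∨ ∃ b, t = unitStrat L x b := by
  obtain ⟨s, A, hA, rfl⟩ := t
  rcases List.mem_cons.1 hA with rfl | hA
  · exact Or.inl rfl
  · obtain ⟨a, -, rfl⟩ := List.mem_map.1 hA
    refine Or.inr ⟨finProdFinEquiv.symm a, Subtype.ext ?_⟩
    exact congrArg (fun a => ({a} : Finset (Fin (L.J * L.k))))
      (finProdFinEquiv.apply_symm_apply a).symm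

theorem validUtility_utility (S : L.payoffGame.State) (x : Fin L.n) :
    L.payoffGame.utility x S =
      ((∑ a : L.Strategy, if finProdFinEquiv a ∈ elements (S x) then
      1 + ∑ z, ∑ b : L.Strategy, (if finProdFinEquiv b ∈ elements (S z) then
        if L.bad x a z b then 0 else 1 else 0) else 0 : ℤ) : ℝ) := by
  rw [← L.eval_payoff x fun z => elements (S z)]
  rfl

theorem not_mem_idle {x : Fin L.n} {a : Fin (L.J * L.k)} : a ∉ elements (idle L x) :=
  Finset.notMem_empty a

theorem mem_unitStrat {x : Fin L.n} {a b : L.Strategy} :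
    finProdFinEquiv a ∈ elements (unitStrat L x b) ↔ a = b :=
  Finset.mem_singleton.trans finProdFinEquiv.injective.eq_iff

theorem utility_idle {S : L.payoffGame.State} {x : Fin L.n} (h : S x = idle L x) :
    L.payoffGame.utility x S = 0 := by
  rw [validUtility_utility, h]
  simp [not_mem_idle]

/-- Acting yields at least one and idling zero, whatever the others do, so idle players join in and
nobody returns to idleness. -/
theorem utility_unit {S : L.payoffGame.State} {x : Fin L.n} {b : L.Strategy}
    (h : S x = unitStrat L x b) : 1 ≤ L.payoffGame.utility x S := by
  rw [validUtility_utility, h]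
  simp only [mem_unitStrat, Finset.sum_ite_eq', Finset.mem_univ, if_true]
  norm_cast
  refine le_add_of_nonneg_right (Finset.sum_nonneg fun z _ => Finset.sum_nonneg fun b _ => ?_)
  split_ifs <;> norm_num

variable (L) in
/-- The profile of the valid-utility game that stands for a profile of the loss game. -/
def unitState (s : L.Profile) : L.payoffGame.State := fun x => unitStrat L x (s x)

theorem update_unitState (s : L.Profile) (x : Fin L.n) (b : L.Strategy) :
    Function.update (unitState L s) x (unitStrat L x b) = unitState L (Function.update s x b) := by
  funext z
  by_cases hz : z = x
  · subst hz
    simp [unitState]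
  · simp [unitState, hz]

/-- One unit for acting and one for each non-hindering player, `x` himself included because of
`bad_self`. -/
theorem utility_unitState (s : L.Profile) (x : Fin L.n) :
    L.payoffGame.utility x (unitState L s) = 1 + L.n - L.loss x s := by
  rw [validUtility_utility]
  simp only [unitState, mem_unitStrat, Finset.sum_ite_eq', Finset.mem_univ, if_true]
  have h := Finset.card_filter_add_card_filter_not (s := (Finset.univ : Finset (Fin L.n)))
    (fun z => L.bad x (s x) z (s z) = true)
  have h' : ∑ z, (if L.bad x (s x) z (s z) then 0 else 1 : ℤ) =
      ((Finset.univ.filter fun z => ¬ L.bad x (s x) z (s z) = true).card : ℤ) := by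
    rw [Finset.card_filter]
    push_cast
    exact Finset.sum_congr rfl fun z _ => by split_ifs <;> simp_all
  rw [h', loss]
  rw [Finset.card_univ, Fintype.card_fin] at h
  have h1 : (L.n : ℝ) = _ := congrArg Nat.cast h.symm
  rw [h1]
  push_cast
  ring

/-- The valid-utility game implements the loss game. -/
noncomputable def validUtilityImplementation : L.Implementation L.payoffGame where
  Rel S s := S = unitState L s
  state := unitState L
  rel_state _ := rfl
  exists_reaches S := by
    obtain ⟨S', h1, -, h2⟩ := StrategicGame.exists_reaches_forall (I := fun _ => True)
      (P := fun x (t : L.payoffGame.Strat x) => ∃ b, t = unitStrat L x b)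
      (fun S _ x => by
        rcases strat_cases (S x) with h | h
        · obtain ⟨b⟩ := L.nonempty
          refine ⟨unitStrat L x b, .single (StrategicGame.arc_update ?_), trivial, b, rfl⟩
          rw [utility_idle h]
          exact zero_lt_one.trans_le (utility_unit (Function.update_self ..))
        · exact ⟨S x, by rw [Function.update_eq_self], trivial, h⟩) S trivial
    choose s hs using h2
    exact ⟨S', s, h1, funext hs⟩
  exists_arc {S s x a} h h1 h2 := by
    subst h
    refine ⟨_, StrategicGame.arc_update (i := x) (a := unitStrat L x a) ?_, update_unitState s x a⟩
    rw [update_unitState, utility_unitState, utility_unitState, h2]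
    have : (1 : ℝ) ≤ L.loss x s := by exact_mod_cast h1
    push_cast
    linarith
  exists_reaches_equilibrium {S s} h he := by
    subst h
    refine ⟨_, .refl, fun S' h4 => ?_⟩
    obtain ⟨x, h5, h6⟩ := h4.eq_update
    generalize S' x = t at h5
    subst h5
    rcases strat_cases t with rfl | ⟨b, rfl⟩
    · rw [utility_idle (Function.update_self ..)] at h6
      have := utility_unit (S := unitState L s) (x := x) rfl
      exact absurd h6 (by linarith)
    · rw [update_unitState, utility_unitState, utility_unitState] at h6
      have : (L.loss x s : ℝ) ≤ L.loss x (Function.update s x b) := by exact_mod_cast he x b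
      linarith
  move_of_arc {s S'} h h4 := by
    obtain ⟨x, h5, h6⟩ := h4.eq_update
    generalize S' x = t at h5
    subst h5
    rcases strat_cases t with rfl | ⟨b, rfl⟩
    · rw [utility_idle (Function.update_self ..)] at h6
      have := utility_unit (S := unitState L s) (x := x) rfl
      exact absurd h6 (by linarith)
    · rw [update_unitState] at h6 ⊢
      rw [utility_unitState, utility_unitState] at h6
      have h7 : (L.loss x (Function.update s x b) : ℝ) < L.loss x s := by linarith
      have h8 := h x
      rw [Nat.cast_lt] at h7
      exact ⟨_, ⟨x, b, by omega, rfl, by omega⟩, rfl⟩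

instance : Finite L.payoffGame.State :=
  inferInstanceAs (Finite (∀ x, {s : Finset (Fin L.validUtility.m) //
    ∃ A ∈ L.validUtility.strats x, s = A.toFinset}))

end LossGame
end SinkEquilibria

namespace SinkEquilibria
open Computability

/-! ### Generating the instances -/

theorem IsVariable.isExpr {α : Type} [Context α] {π : α → ℕ} (h : IsVariable π) :
    IsExpr fun (_ : List Bool) a => π a :=
  .var h

/-- The first component of a strategy ranges over a bound that grows with the input and needs a
loop; the second ranges over a fixed finite set. -/
theorem LossGame.strategies_flatMap {L : LossGame} {β : Type} {f : L.Strategy → List β}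
    (g : ℕ → Fin L.k → List β) (h : ∀ j c, f (j, c) = g j c) :
    L.strategies.flatMap f =
      (List.range L.J).flatMap fun j => (List.finRange L.k).flatMap (g j) := by
  rw [LossGame.strategies, List.flatMap_assoc]
  refine finRange_flatMap _ fun j => ?_
  rw [List.flatMap_map]
  exact congrArg (fun f => List.flatMap f _) (funext (h j))

/-- A family of loss games that is given by arithmetical expressions and tests. -/
structure GameFamily where
  /-- number of players -/
  n : List Bool → ℕ
  /-- range of the first component of strategies -/
  J : List Bool → ℕ
  /-- range of the second component of strategies -/
  k : ℕ
  /-- the relation of hindrance -/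
  bad : List Bool → ℕ → ℕ → Fin k → ℕ → ℕ → Fin k → Bool
  bad_self : ∀ w x i c j d, bad w x i c x j d = false
  nonempty : ∀ w, Nonempty (Fin (J w) × Fin k)
  n_expr : IsClosedExpr n
  J_expr : IsClosedExpr J
  -- The codes `c` and `d` are constants of the generator; only players and positions are variables.
  bad_test : ∀ {α : Type} [Context α] {x i z j : α → ℕ} (c d : Fin k), IsVariable x →
    IsVariable i → IsVariable z → IsVariable j →
    IsTest fun w a => bad w (x a) (i a) c (z a) (j a) d

namespace GameFamily

variable (F : GameFamily)

/-- The members of the family. -/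
def game (w : List Bool) : LossGame where
  n := F.n w
  J := F.J w
  k := F.k
  bad x a z b := F.bad w x a.1 a.2 z b.1 b.2
  bad_self _ _ _ := F.bad_self ..
  nonempty := F.nonempty w

/-- The number of an item. -/
def number (w : List Bool) (x j c z f : ℕ) : ℕ :=
  -- The mixed-radix expansion computed by the nested `finProdFinEquiv` in `item`.
  f + 2 * z + F.n w * 2 * (c + F.k * j) + F.J w * F.k * (F.n w * 2) * x

/-- The word that describes the items of a strategy. -/
def bundleWord (w : List Bool) (x j : ℕ) (c : Fin F.k) : List Γ' :=
  ((List.range (F.n w)).flatMap fun z => Γ'.comma :: encIndex (F.number w x j c z 0)) ++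
    (List.range (F.n w)).flatMap fun x' => (List.range (F.J w)).flatMap fun j' =>
      (List.finRange F.k).flatMap fun c' =>
        if F.bad w x' j' c' x j c then Γ'.comma :: encIndex (F.number w x' j' c' x 0)
        else Γ'.comma :: encIndex (F.number w x' j' c' x 1)

theorem encEntries_bundle (w : List Bool) (x : Fin (F.game w).n) (j : Fin (F.game w).J) (c : Fin (F.game w).k) :
    encEntries encFin ((F.game w).bundle x (j, c)) = F.bundleWord w x j c := by
  rw [LossGame.bundle, encEntries_append, encEntries_map, encEntries_flatMap]
  refine congrArg₂ (· ++ ·) (finRange_flatMap _ fun z => rfl) (finRange_flatMap _ fun x' => ?_)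
  rw [encEntries_map]
  refine LossGame.strategies_flatMap (L := F.game w) _ fun j' c' => ?_
  have h : (F.game w).bad x' (j', c') x (j, c) = F.bad w x' j' c' x j c := rfl
  simp only [LossGame.flag, h]
  split_ifs <;> rfl

/-- The word that describes the generators of a player. -/
def generatorsWord (w : List Bool) (x : ℕ) : List Γ' :=
  ((List.range (F.J w)).flatMap fun j => (List.finRange F.k).flatMap fun c =>
      Γ'.comma :: (F.bundleWord w x j c ++ [Γ'.ket])) ++
    (List.range (F.n w)).flatMap fun x' => (List.range (F.J w)).flatMap fun j =>
      (List.finRange F.k).flatMap fun c : Fin F.k =>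
        (Γ'.comma :: ((Γ'.comma :: encIndex (F.number w x' j c x 0)) ++ [Γ'.ket])) ++
        (Γ'.comma :: ((Γ'.comma :: encIndex (F.number w x' j c x 1)) ++ [Γ'.ket]))

theorem encEntries_generators (w : List Bool) (x : Fin (F.game w).n) :
    encEntries (encList encFin) ((F.game w).generators x) = F.generatorsWord w x := by
  rw [LossGame.generators, encEntries_append, encEntries_map, encEntries_flatMap]
  refine congrArg₂ (· ++ ·) (LossGame.strategies_flatMap (L := F.game w) _ fun j c => ?_)
    (finRange_flatMap _ fun x' => ?_)
  · rw [encList_eq]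
    exact congrArg (fun l => Γ'.comma :: (l ++ [Γ'.ket])) (F.encEntries_bundle w x j c)
  · rw [encEntries_flatMap]
    refine LossGame.strategies_flatMap (L := F.game w) _ fun j c => ?_
    rw [encEntries_pair, encList_eq, encList_eq, encEntries_singleton, encEntries_singleton]
    rfl

/-- The word that describes a preference list. -/
def rankingWord (x z : ℕ) (f : Fin 2) : List Γ' :=
  if f = 0 then
    if x = z then Γ'.comma :: encIndex x
    else (Γ'.comma :: encIndex z) ++ Γ'.comma :: encIndex x
  else Γ'.comma :: encIndex z

theorem encEntries_ranking (w : List Bool) (x : Fin (F.game w).n) (a : (F.game w).Strategy)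
    (z : Fin (F.game w).n) (f : Fin 2) :
    encEntries encFin ((F.game w).ranking (x, a, z, f)) = rankingWord x z f := by
  simp only [LossGame.ranking, rankingWord, Fin.ext_iff]
  split_ifs <;> simp only [encEntries_singleton, encEntries_pair] <;> rfl

/-- The word that describes a market. -/
def marketWord (w : List Bool) : List Γ' :=
  encIndex (F.n w) ++ (encIndex (F.n w * (F.J w * F.k * (F.n w * 2))) ++
    (((List.range (F.n w)).flatMap fun x =>
      Γ'.comma :: (F.generatorsWord w x ++ [Γ'.ket])) ++ [Γ'.ket] ++
    (((List.range (F.n w)).flatMap fun x => (List.range (F.J w)).flatMap fun _ =>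
      (List.range F.k).flatMap fun _ => (List.range (F.n w)).flatMap fun z =>
        (List.finRange 2).flatMap fun f =>
          Γ'.comma :: (rankingWord x z f ++ [Γ'.ket])) ++ [Γ'.ket])))

theorem encMarketFrame_eq (w : List Bool) :
    encMarketFrame (F.game w).market = F.marketWord w := by
  refine congrArg₂ (· ++ ·) rfl (congrArg₂ (· ++ ·) rfl (congrArg₂ (· ++ ·) ?_ ?_))
  · rw [encFamily_eq]
    refine congrArg (· ++ [Γ'.ket]) (finRange_flatMap _ fun x => ?_)
    rw [encList_eq]
    exact congrArg (fun l => Γ'.comma :: (l ++ [Γ'.ket])) (F.encEntries_generators w x)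
  · rw [encFamily_eq]
    refine congrArg (· ++ [Γ'.ket]) ?_
    refine (finRange_mul_flatMap (m := F.n w) (n := F.J w * F.k * (F.n w * 2)) _).trans
      (finRange_flatMap _ fun x => ?_)
    refine (finRange_mul_flatMap (m := F.J w * F.k) (n := F.n w * 2) _).trans
      ((finRange_mul_flatMap (m := F.J w) (n := F.k) _).trans (finRange_flatMap _ fun j =>
        (finRange_flatMap _ fun c => ?_)))
    refine (finRange_mul_flatMap (m := F.n w) (n := 2) _).trans (finRange_flatMap _ fun z => ?_)
    refine congrArg (fun f => List.flatMap f _) (funext fun f => ?_)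
    rw [encList_eq, ← F.encEntries_ranking w x (j, c) z f]
    have : (F.game w).market.pref ((F.game w).item (x, (j, c), z, f)) =
      (F.game w).ranking (x, (j, c), z, f) := by simp [LossGame.market]
    rw [← this]
    rfl

end GameFamily
end SinkEquilibria

/-! ### Generators for the words of the three kinds of instances -/

namespace SinkEquilibria
open Computability

theorem Generated.element {α : Type} [Context α] {e : List Bool → α → ℕ} (he : IsExpr e) :
    Generated fun w a => Γ'.comma :: encIndex (e w a) :=
  (Generated.index he).cons _

theorem Generated.entry {α : Type} [Context α] {G : List Bool → α → List Γ'} (h : Generated G) :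
    Generated fun w a => Γ'.comma :: (G w a ++ [Γ'.ket]) :=
  (h.append (.word _)).cons _

namespace GameFamily

variable (F : GameFamily) {α : Type} [Context α]

theorem isExpr_number {x j z : α → ℕ} (hx : IsVariable x) (hj : IsVariable j)
    (hz : IsVariable z) (c f : ℕ) : IsExpr fun w a => F.number w (x a) (j a) c (z a) f :=
  have hn := F.n_expr.isExpr (α := α)
  have hJ := F.J_expr.isExpr (α := α)
  (((IsExpr.const f).add ((IsExpr.const 2).mul hz.isExpr)).add
    ((hn.mul (.const 2)).mul ((IsExpr.const c).add ((IsExpr.const F.k).mul hj.isExpr)))).add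
    (((hJ.mul (.const F.k)).mul (hn.mul (.const 2))).mul hx.isExpr)

theorem generated_bundleWord {x j : α → ℕ} (hx : IsVariable x) (hj : IsVariable j)
    (c : Fin F.k) : Generated fun w a => F.bundleWord w (x a) (j a) c := by
  refine .append (.range F.n_expr.isExpr (.element
    (F.isExpr_number hx.fst hj.fst .last c 0))) ?_
  refine .range F.n_expr.isExpr (.range F.J_expr.isExpr (.list _ fun c' => ?_))
  exact .ite (F.bad_test c' c IsVariable.last.fst .last hx.fst.fst hj.fst.fst)
    (.element (F.isExpr_number IsVariable.last.fst .last hx.fst.fst c' 0))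
    (.element (F.isExpr_number IsVariable.last.fst .last hx.fst.fst c' 1))

theorem generated_generatorsWord {x : α → ℕ} (hx : IsVariable x) :
    Generated fun w a => F.generatorsWord w (x a) := by
  refine .append (.range F.J_expr.isExpr (.list _ fun c =>
    .entry (F.generated_bundleWord hx.fst .last c)))
    (.range F.n_expr.isExpr (.range F.J_expr.isExpr (.list _ fun c => .append ?_ ?_)))
  · exact .entry (.element (F.isExpr_number IsVariable.last.fst .last hx.fst.fst c 0))
  · exact .entry (.element (F.isExpr_number IsVariable.last.fst .last hx.fst.fst c 1))

theorem generated_rankingWord {x z : α → ℕ} (hx : IsVariable x) (hz : IsVariable z) (f : Fin 2) :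
    Generated fun (_ : List Bool) a => rankingWord (x a) (z a) f := by
  by_cases hf : f = 0
  · simp only [rankingWord, hf, if_true]
    have := Generated.ite (IsTest.eq hx.isExpr hz.isExpr) (.element hx.isExpr)
      (.append (.element hz.isExpr) (.element hx.isExpr))
    simpa only [decide_eq_true_eq] using this
  · simp only [rankingWord, hf, if_false]
    exact .element hz.isExpr

theorem generated_marketWord : Generated fun w (_ : α) => F.marketWord w := by
  have hn := F.n_expr.isExpr (α := α)
  have hJ := F.J_expr.isExpr (α := α)
  refine .append (.index hn) (.append (.index
    (hn.mul ((hJ.mul (.const F.k)).mul (hn.mul (.const 2)))))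
    (.append (.append (.range hn (.entry (F.generated_generatorsWord .last))) (.word _))
      (.append (.range hn (.range F.J_expr.isExpr (.range (.const F.k)
        (.range F.n_expr.isExpr (.list _ fun f => .entry
          (generated_rankingWord (IsVariable.last.fst.fst.fst) .last f)))))) (.word _))))

theorem generated_uniformMarket :
    Generated fun w (_ : Unit) => encUniformMarket (F.game w).uniformMarket := by
  have h (w : List Bool) : encUniformMarket (F.game w).uniformMarket = F.marketWord w ++
      ((List.range (F.n w * (F.J w * F.k * (F.n w * 2)))).flatMap (fun _ => Γ'.comma :: encNat 1) ++
        [Γ'.ket]) := by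
    refine congrArg₂ (· ++ ·) (F.encMarketFrame_eq w) ?_
    rw [encFamily_eq]
    exact congrArg (· ++ [Γ'.ket]) (finRange_flatMap _ fun _ => rfl)
  simp only [h]
  have hn := F.n_expr.isExpr (α := Unit)
  have hJ := F.J_expr.isExpr (α := Unit)
  exact .append F.generated_marketWord (.append
    (.range (hn.mul ((hJ.mul (.const F.k)).mul (hn.mul (.const 2)))) (.word _)) (.word _))

theorem generated_manyToOneMarket :
    Generated fun w (_ : Unit) => encManyToOneMarket (F.game w).manyToOneMarket := by
  have h (w : List Bool) : encManyToOneMarket (F.game w).manyToOneMarket = F.marketWord w ++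
      ((List.range (F.n w)).flatMap (fun _ => Γ'.comma ::
        ((List.range (F.n w * (F.J w * F.k * (F.n w * 2)))).flatMap (fun y => Γ'.comma ::
          (encInt 1 ++ ((Γ'.comma :: encIndex y) ++ [Γ'.ket]))) ++ [Γ'.ket])) ++ [Γ'.ket]) := by
    refine congrArg₂ (· ++ ·) (F.encMarketFrame_eq w) ?_
    rw [encFamily_eq]
    refine congrArg (· ++ [Γ'.ket]) (finRange_flatMap _ fun _ => ?_)
    simp only [encSetPoly, encList_eq]
    refine congrArg (fun l => Γ'.comma :: (l ++ [Γ'.ket])) ?_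
    refine (encEntries_flatMap _ _ _).trans (finRange_flatMap _ fun y => ?_)
    exact encEntries_singleton _ _
  simp only [h]
  have hn := F.n_expr.isExpr (α := Unit × ℕ)
  have hJ := F.J_expr.isExpr (α := Unit × ℕ)
  exact .append F.generated_marketWord (.append (.range F.n_expr.isExpr (.entry
    (.range (hn.mul ((hJ.mul (.const F.k)).mul (hn.mul (.const 2))))
      (.cons (.append (.word _) (.append (.element IsVariable.last.isExpr) (.word _))) _))))
    (.word _))

/-- The concatenation of words for the terms of the utility of a player. -/
def payoffWord (w : List Bool) (x : ℕ) (A : ℕ → Fin F.k → List Γ')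
    (B : ℕ → Fin F.k → ℕ → ℕ → Fin F.k → List Γ') : List Γ' :=
  (List.range (F.J w)).flatMap fun j => (List.finRange F.k).flatMap fun c =>
    A j c ++ (List.range (F.n w)).flatMap fun z => (List.range (F.J w)).flatMap fun j' =>
      (List.finRange F.k).flatMap fun c' => if F.bad w x j c z j' c' then [] else B j c z j' c'

/-- The words for the two kinds of terms are parameters, since the same traversal writes the
utilities and, with the sets emptied, the constant social function. -/
theorem payoff_flatMap {w : List Bool} {x : Fin (F.game w).n}
    {f : ℤ × List (Fin (F.game w).n × Fin ((F.game w).J * (F.game w).k)) → List Γ'}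
    {A : ℕ → Fin F.k → List Γ'} {B : ℕ → Fin F.k → ℕ → ℕ → Fin F.k → List Γ'}
    (hA : ∀ j c, f (1, [(x, finProdFinEquiv (j, c))]) = A j c)
    (hB : ∀ j c z j' c', f (1, [(x, finProdFinEquiv (j, c)), (z, finProdFinEquiv (j', c'))]) =
      B j c z j' c') :
    ((F.game w).payoff x).flatMap f = F.payoffWord w x A B := by
  refine List.flatMap_assoc.trans (finRange_flatMap _ fun j => List.flatMap_assoc.trans
    (congrArg (fun f => List.flatMap f _) (funext fun c => ?_)))
  refine congrArg₂ (· ++ ·) (hA j c) ?_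
  refine List.flatMap_assoc.trans (finRange_flatMap _ fun z => List.flatMap_assoc.trans
    (finRange_flatMap _ fun j' => List.flatMap_assoc.trans
    (congrArg (fun f => List.flatMap f _) (funext fun c' => ?_))))
  have h : (F.game w).bad x (j, c) z (j', c') = F.bad w x j c z j' c' := rfl
  simp only [h]
  split_ifs
  · rfl
  · exact (List.flatMap_singleton _ _).trans (hB ..)

theorem generated_payoffWord {x : α → ℕ} (hx : IsVariable x) {A : α → ℕ → Fin F.k → List Γ'}
    {B : α → ℕ → Fin F.k → ℕ → ℕ → Fin F.k → List Γ'}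
    (hA : ∀ c, Generated fun (_ : List Bool) (p : α × ℕ) => A p.1 p.2 c)
    (hB : ∀ c c', Generated fun (_ : List Bool) (p : ((α × ℕ) × ℕ) × ℕ) =>
      B p.1.1.1 p.1.1.2 c p.1.2 p.2 c') :
    Generated fun w a => F.payoffWord w (x a) (A a) (B a) := by
  refine .range F.J_expr.isExpr (.list _ fun c => .append (hA c) (.range F.n_expr.isExpr
    (.range F.J_expr.isExpr (.list _ fun c' => ?_))))
  exact .ite (F.bad_test c c' hx.fst.fst.fst IsVariable.last.fst.fst IsVariable.last.fst .last)
    (.word _) (hB c c')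

/-- The word for a pair of a player and a strategy. -/
def pairWord (x j c : ℕ) : List Γ' := Γ'.comma :: (encIndex x ++ encIndex (c + F.k * j))

theorem generated_pairWord {x j : α → ℕ} (hx : IsVariable x) (hj : IsVariable j) (c : ℕ) :
    Generated fun (_ : List Bool) a => F.pairWord (x a) (j a) c :=
  .cons (.append (.index hx.isExpr) (.index ((IsExpr.const c).add
    ((IsExpr.const F.k).mul hj.isExpr)))) _

/-- The word for a term with the coefficient one. -/
def termWord (A : List Γ') : List Γ' := Γ'.comma :: (encInt 1 ++ (A ++ [Γ'.ket]))

theorem generated_termWord {A : α → List Γ'} (h : Generated fun (_ : List Bool) a => A a) :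
    Generated fun (_ : List Bool) a => termWord (A a) :=
  .cons (.append (.word _) (.append h (.word _))) _

theorem generated_validUtility :
    Generated fun w (_ : Unit) => encValidUtility (F.game w).validUtility := by
  have h (w : List Bool) : encValidUtility (F.game w).validUtility =
      encIndex (F.n w) ++ (encIndex (F.J w * F.k) ++
        (((List.range (F.n w)).flatMap (fun _ => Γ'.comma :: (([Γ'.comma, Γ'.ket] ++
          (List.range (F.J w * F.k)).flatMap fun y => Γ'.comma ::
            ((Γ'.comma :: encIndex y) ++ [Γ'.ket])) ++ [Γ'.ket])) ++ [Γ'.ket]) ++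
        (((List.range (F.n w)).flatMap (fun x => Γ'.comma :: (F.payoffWord w x
          (fun j c => termWord (F.pairWord x j c))
          (fun j c z j' c' => termWord (F.pairWord x j c ++ F.pairWord z j' c')) ++ [Γ'.ket])) ++
            [Γ'.ket]) ++
        ((List.range (F.n w)).flatMap (fun x => F.payoffWord w x (fun _ _ => termWord [])
          (fun _ _ _ _ _ => termWord [])) ++ [Γ'.ket])))) := by
    refine congrArg₂ (· ++ ·) rfl (congrArg₂ (· ++ ·) rfl (congrArg₂ (· ++ ·) ?_
      (congrArg₂ (· ++ ·) ?_ ?_)))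
    · rw [encFamily_eq]
      refine congrArg (· ++ [Γ'.ket]) (finRange_flatMap _ fun _ => ?_)
      rw [encList_eq]
      refine congrArg (fun l => Γ'.comma :: (l ++ [Γ'.ket]))
        ((encEntries_append _ [[]] _).trans (congrArg₂ (· ++ ·) rfl ?_))
      exact (encEntries_map _ _ _).trans (finRange_flatMap _ fun y => rfl)
    · rw [encFamily_eq]
      refine congrArg (· ++ [Γ'.ket]) (finRange_flatMap _ fun x => ?_)
      rw [encSetPoly, encList_eq]
      refine congrArg (fun l => Γ'.comma :: (l ++ [Γ'.ket])) ?_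
      refine F.payoff_flatMap (fun j c => rfl) (fun j c z j' c' => ?_)
      exact congrArg (fun l => Γ'.comma :: (encInt 1 ++ l))
        ((encList_eq _ _).trans (congrArg (· ++ [Γ'.ket]) (encEntries_pair _ _ _)))
    · rw [encSetPoly, encList_eq]
      refine congrArg (· ++ [Γ'.ket]) ?_
      refine (encEntries_flatMap _ _ _).trans (finRange_flatMap _ fun x => ?_)
      exact (encEntries_map _ _ _).trans
        (F.payoff_flatMap (fun _ _ => rfl) (fun _ _ _ _ _ => rfl))
  simp only [h]
  have hn := F.n_expr.isExpr (α := Unit)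
  have hJ := F.J_expr.isExpr (α := Unit)
  refine .append (.index hn) (.append (.index (hJ.mul (.const F.k))) (.append (.append
    (.range hn (.entry (.append (.word _) (.range (F.J_expr.isExpr.mul (.const F.k))
      (.entry (.element IsVariable.last.isExpr)))))) (.word _)) (.append (.append (.range hn
        (.entry (F.generated_payoffWord .last (fun c => generated_termWord ?_)
          fun c c' => generated_termWord (.append ?_ ?_)))) (.word _))
      (.append (.range hn (F.generated_payoffWord .last (fun _ => .word _) fun _ _ => .word _))
        (.word _)))))
  · exact F.generated_pairWord IsVariable.last.fst .last c
  · exact F.generated_pairWord IsVariable.last.fst.fst.fst IsVariable.last.fst.fst c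
  · exact F.generated_pairWord IsVariable.last.fst .last c'

end GameFamily
end SinkEquilibria

namespace SinkEquilibria
open Computability Turing

/-! ### The family of simulations -/

section Family

set_option linter.unusedSectionVars false

variable {Γ Λ : Type} [DecidableEq Γ] [DecidableEq Λ] [Inhabited Γ] [Inhabited Λ]
  (M : TM0.Machine Γ Λ) (accept : Λ → Bool) {N : List Bool → ℕ} (hN : IsClosedExpr N)
  (symbol : Bool → Γ) {α : Type} [Context α] {x i z j : α → ℕ}

theorem isTest_eq_bound (hN : IsClosedExpr N) (hx : IsVariable x) :
    IsTest fun w a => decide (x a = N w) :=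
  .eq hx.isExpr hN.isExpr

theorem isTest_headMoves {Γ : Type} (hN : IsClosedExpr N) (t : TM0.Stmt Γ) (hi : IsVariable i)
    (hj : IsVariable j) : IsTest fun w a => headMoves (N w) t (i a) (j a) := by
  have one : IsExpr fun (_ : List Bool) (_ : α) => 1 := .const 1
  have zero : IsExpr fun (_ : List Bool) (_ : α) => 0 := .const 0
  rcases t with (_ | _) | b
  · exact .or (.eq hi.isExpr (hj.isExpr.add one))
      (.and (.eq hi.isExpr zero) (.eq (hj.isExpr.add one) hN.isExpr))
  · exact .or (.eq hj.isExpr (hi.isExpr.add one))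
      (.and (.eq hj.isExpr zero) (.eq (hi.isExpr.add one) hN.isExpr))
  · exact .eq hj.isExpr hi.isExpr

/-- For fixed codes everything that concerns the machine is constant, and only comparisons of
positions are left to be tested. -/
theorem isTest_follows (hN : IsClosedExpr N) (c d : Λ × Γ × Bool) (hi : IsVariable i)
    (hj : IsVariable j) : IsTest fun w a => follows M accept (N w) (i a) c (j a) d := by
  have hi' := isTest_eq_bound hN hi
  have hj' := isTest_eq_bound hN hj
  have hji : IsTest fun (_ : List Bool) a => decide (j a = i a) := .eq hj.isExpr hi.isExpr
  refine .or (.or (.and hi' (.and hj'.not (.const _)))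
    (.and hi'.not (.and (.const _) (.and hji (.const _)))))
    (.and hi'.not (.and (.const _) (.or (.or (.and hj' (.and (.eq hi.isExpr (.const 0)) (.const _)))
      (.and hj'.not (.and (.const _) ?_))) (.and hji (.and (.const _) (.const _))))))
  rcases M d.1 d.2.1 with _ | t
  · exact .const false
  · exact .and (.const _) (isTest_headMoves hN t.2 hj hi)

theorem isTest_startTape (hx : IsVariable x) (b : Γ) :
    IsTest fun w a => decide (startTape symbol w (x a) = b) :=
  .bit hx.isExpr fun o => decide ((o.map symbol).getD default = b)

theorem isTest_hinders (hN : IsClosedExpr N) (c d : Λ × Γ × Bool) (hx : IsVariable x)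
    (hi : IsVariable i) (hz : IsVariable z) (hj : IsVariable j) : IsTest fun w a =>
      hinders M accept (N w) (startTape symbol w) (x a) (i a) c (z a) (j a) d := by
  have hx' := isTest_eq_bound hN hx
  have hz' := isTest_eq_bound hN hz
  have hi' := isTest_eq_bound hN hi
  have hj' := isTest_eq_bound hN hj
  have memory {y : α → ℕ} (hy : IsVariable y) : IsTest fun w a => decide (y a = N w + 1) :=
    .eq hy.isExpr (hN.isExpr.add (.const 1))
  have hiz : IsTest fun (_ : List Bool) a => decide (i a = z a) := .eq hi.isExpr hz.isExpr
  have hij : IsTest fun (_ : List Bool) a => decide (i a = j a) := .eq hi.isExpr hj.isExpr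
  have hjx : IsTest fun (_ : List Bool) a => decide (j a = x a) := .eq hj.isExpr hx.isExpr
  refine .or (.or (.or (.or ?_ ?_) ?_) ?_) ?_
  · exact .and hx' (.and (memory hz) (isTest_follows M accept hN c d hi hj).not)
  · exact .and hx' (.and hz'.not (.and (memory hz).not (.and hiz (.and (.const _) (.const _)))))
  · exact .and (memory hx) (.and hz' (IsTest.or (.and hi' hj') (.and hij (.const _))).not)
  · exact .and (memory hx) (.and hz'.not (.and (memory hz).not (.or
      (.and hiz (.and (.const _) (.const _)))
      (.and hi' (isTest_startTape symbol hz d.2.1).not))))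
  · exact .and hx'.not (.and (memory hx).not (.and hz' (IsTest.or
      (.and hj' (isTest_startTape symbol hx c.2.1))
      (.and hjx (.and (.const _) (.const _)))).not))

/-- The simulations for all inputs. -/
def simulationFamily {k : ℕ} (code : Fin k ≃ Λ × Γ × Bool) : GameFamily where
  n w := N w + 2
  J w := N w + 1
  k := k
  bad w x i c z j d :=
    hinders M accept (N w) (startTape symbol w) x i (code c) z j (code d)
  bad_self _ _ _ _ _ _ := hinders_self ..
  nonempty w := ⟨Fin.last (N w), code.symm default⟩
  n_expr := hN.add (.const 2)
  J_expr := hN.add (.const 1)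
  bad_test c d hx hi hz hj := isTest_hinders M accept symbol hN (code c) (code d) hx hi hz hj

theorem game_simulationFamily {k : ℕ} (code : Fin k ≃ Λ × Γ × Bool) (w : List Bool) :
    (simulationFamily M accept hN symbol code).game w =
      simulation M accept (N w) (startTape symbol w) code := rfl

end Family

/-- Every language in `PSPACE` is decided by a family of loss games. -/
theorem InPSPACE.exists_gameFamily {L : Set (List Bool)} (hL : InPSPACE L) :
    ∃ F : GameFamily, ∀ x, (x ∈ L → ∃ s, (F.game x).Live s) ∧
      (x ∉ L → (F.game x).Terminating) := by
  classical
  obtain ⟨Γ, Λ, _, _, _, _, M, symbol, accept, p, -, h⟩ := hL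
  -- The summand `2 * p + 1` keeps the visited positions on distinct cells, and `x.length` more
  -- cells keep the negative ones off the input.
  have hN : IsClosedExpr fun x => 2 * p.eval x.length + 1 + x.length :=
    (((IsClosedExpr.const 2).mul (.polynomial p)).add (.const 1)).add .length
  refine ⟨simulationFamily M (fun q => decide (q ∈ accept)) hN symbol
    (Fintype.equivFin (Λ × Γ × Bool)).symm, fun x => ?_⟩
  obtain ⟨h1, h2⟩ := h x
  have h3 : 2 * ((p.eval x.length : ℕ) : ℤ) + 1 + x.length ≤
    ((2 * p.eval x.length + 1 + x.length : ℕ) : ℤ) := by push_cast; rfl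
  rw [game_simulationFamily]
  refine ⟨fun hx => simulation.exists_live (by omega) fun q i w hr hq => ?_,
    fun hx => simulation.terminating ?_⟩
  · simpa using accept_of_reached h3 h1 h2 hx q i w hr hq
  · simpa using exists_reached_reject h3 h1 h2 hx

/-! ### From loss games to the three hardness results -/

theorem LossGame.Implementation.iff_hasNonSingletonSink {L : LossGame} {G : StrategicGame L.n}
    [Finite G.State] (I : L.Implementation G) {A : Prop}
    (h : (A → ∃ s, L.Live s) ∧ (¬ A → L.Terminating)) : A ↔ G.HasNonSingletonSink := by
  refine ⟨fun hA => ?_, fun hG => ?_⟩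
  · obtain ⟨s, hs⟩ := h.1 hA
    exact I.hasNonSingletonSink hs
  · by_contra hA
    exact I.not_hasNonSingletonSink (h.2 hA) hG

theorem pspaceHard_uniformMarket :
    PSPACEHard uniformMarketEncoding (fun I => I.game.HasNonSingletonSink) := by
  intro L hL
  obtain ⟨F, hF⟩ := hL.exists_gameFamily
  refine ⟨_, F.generated_uniformMarket.computableInPolyTime, fun x => ?_⟩
  exact (LossGame.marketImplementation.iff_hasNonSingletonSink (hF x)).trans (iff_of_eq
    (congrArg (StrategicGame.HasNonSingletonSink (n := (F.game x).n))
      (F.game x).uniformMarket_game.symm))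

theorem pspaceHard_manyToOneMarket :
    PSPACEHard manyToOneMarketEncoding (fun I => I.game.HasNonSingletonSink) := by
  intro L hL
  obtain ⟨F, hF⟩ := hL.exists_gameFamily
  refine ⟨_, F.generated_manyToOneMarket.computableInPolyTime, fun x => ?_⟩
  exact (LossGame.marketImplementation.iff_hasNonSingletonSink (hF x)).trans (iff_of_eq
    (congrArg (StrategicGame.HasNonSingletonSink (n := (F.game x).n))
      (F.game x).manyToOneMarket_game.symm))

theorem pspaceHard_validUtility :
    PSPACEHard validUtilityEncoding (fun I => I.game.HasNonSingletonSink) := by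
  intro L hL
  obtain ⟨F, hF⟩ := hL.exists_gameFamily
  exact ⟨_, F.generated_validUtility.computableInPolyTime, fun x =>
    LossGame.validUtilityImplementation.iff_hasNonSingletonSink (hF x)⟩

end SinkEquilibria

theorem mainTheorem8 :
    SinkEquilibria.PSPACEHard SinkEquilibria.uniformMarketEncoding
      (fun I => I.game.HasNonSingletonSink) ∧
    SinkEquilibria.PSPACEHard SinkEquilibria.manyToOneMarketEncoding
      (fun I => I.game.HasNonSingletonSink) ∧
    SinkEquilibria.PSPACEHard SinkEquilibria.validUtilityEncoding
      (fun I => I.game.HasNonSingletonSink) :=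
  ⟨SinkEquilibria.pspaceHard_uniformMarket, SinkEquilibria.pspaceHard_manyToOneMarket,
    SinkEquilibria.pspaceHard_validUtility⟩
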